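/- **Conventions.** Let $X\neq\{0\}$ be a complex Banach space, let $E=\ell^2(\mathbb Z,X)$ be the Banach space of sequences $x=(x_j)_{j\in\mathbb Z}$ in $X$ with $\|x\|=(\sum_j\|x_j\|^2)^{1/2}<\infty$, and let $A\in L(E)$ be a bounded operator with matrix representation $[a_{i,j}]_{i,j\in\mathbb Z}$, $a_{i,j}\in L(X)$. For a bounded operator $B$ on a Banach space put $\|B^{-1}\|:=\infty$ if $B$ is not invertible, $1/\infty:=0$, and let $$\mathrm{Spec}_\varepsilon B=\{\lambda\in\mathbb C:1/\|(B-\lambda I)^{-1}\|\le\varepsilon\}\ (\varepsilon\ge 0),\qquad \mathrm{spec}_\varepsilon B=\{\lambda\in\mathbb C:1/\|(B-\lambda I)^{-1}\|<\varepsilon\}\ (\varepsilon>0),$$ so that $\mathrm{Spec}_0B=\mathrm{Spec}\,B$ is the spectrum. For $n\in\mathbb N=\{1,2,\dots\}$ and $k\in\mathbb Z$ let $A_{n,k}=[a_{i,j}]_{i,j=k+1}^{k+n}$, acting on $X^n$ with norm $(\sum_{j=1}^n\|x_j\|^2)^{1/2}$, and let $$\sigma^n_\varepsilon(A)=\bigcup_{k\in\mathbb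 Z}\mathrm{spec}_\varepsilon A_{n,k}\ (\varepsilon>0),\qquad \Sigma^n_\varepsilon(A)=\overline{\bigcup_{k\in\mathbb Z}\mathrm{Spec}_\varepsilon A_{n,k}}\ (\varepsilon\ge0).$$ With $\|\alpha\|_\infty=\sup_j\|a_{j+1,j}\|$ and $\|\gamma\|_\infty=\sup_j\|a_{j-1,j}\|$, let $$\varepsilon_n=2\inf_{0<\phi<1}\left(\sqrt{\frac{\|\alpha\|_\infty^2}{\phi}+\frac{\|\gamma\|_\infty^2}{1-\phi}}\;\sin\frac{\theta_n(\phi)}2\right),$$ where $\theta_n(\phi)$ is the unique solution $t\in\left[\frac{\pi}{2n+1},\frac{\pi}{n+2}\right]$ of $2\sin\frac t2\cos\left((n+\tfrac12)t\right)+\phi(1-\phi)\sin((n-1)t)=0$. A complex Banach space $Y$ is complex uniformly convex if for every $\varepsilon>0$ there is $\delta>0$ such that $\|x\|\le1-\delta$ whenever $x,y\in Y$, $\|y\|\ge\varepsilon$, and $\|x+\zeta y\|\le1$ for all $\zeta\in\mathbb C$ with $|\zeta|\le1$. $X$ has Globevnik's property if $X$ is finite-dimensional, or $X$ or its dual $X^*$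 is complex uniformly convex. The $\tau$ method does not suffer from spectral pollution for $A$ if there is a sequence $\eta_n>0$ with $\eta_n\to0$ such that, for every $\varepsilon>0$, $\mathrm{spec}_\varepsilon A_{n,k}\subset\mathrm{spec}_{\varepsilon+\eta_n}A$ for all $n\in\mathbb N$ and $k\in\mathbb Z$. For non-empty bounded $S_n,S\subset\mathbb C$, write $S_n\to S$ if the Hausdorff distance between $S_n$ and $S$ tends to $0$. **Theorem 1.3 (convergence of the $\tau$ method).** Suppose that $A$ is tridiagonal ($a_{i,j}=0$ for $|i-j|>1$), that the $\tau$ method does not suffer from spectral pollution for $A$, and that $X$ has Globevnik's property. Then, as $n\to\infty$ (all the sets involved being non-empty and bounded), 1. $\Sigma^n_{\varepsilon+\varepsilon_n}(A)\to\mathrm{Spec}_\varepsilon A$ for every $\varepsilon\ge0$, where in the case $\varepsilon=0$ it is assumed that $A$ is not diagonal or that $X$ is finite-dimensional; in particular, $\Sigma^n_{\varepsilon_n}(A)\to\mathrm{Spec}\,A$ under the same proviso; 2. $\sigma^n_{\varepsilon+\varepsilon_n}(A)\to\mathrm{spec}_\varepsilon A$ for every $\varepsilon>0$. -/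

import Mathlib

open Filter Topology
open scoped ENNReal

noncomputable section

/-- The (extended) norm `‖B⁻¹‖` of the inverse of a bounded operator `B`, with the convention
that `‖B⁻¹‖ = ∞` if `B` is not invertible. -/
def inverseENorm {Y : Type*} [NormedAddCommGroup Y] [NormedSpace ℂ Y] (B : Y →L[ℂ] Y) : ℝ≥0∞ :=
  open Classical in if IsUnit B then ‖Ring.inverse B‖ₑ else ⊤

/-- The closed `ε`-pseudospectrum `Spec_ε B = {z : 1 / ‖(B - z I)⁻¹‖ ≤ ε}`, `ε ≥ 0`,
where `1 / ∞ = 0`.  For `ε = 0` it is the spectrum of `B`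
(see `closedPseudospectrum_zero`). -/
def closedPseudospectrum {Y : Type*} [NormedAddCommGroup Y] [NormedSpace ℂ Y]
    (B : Y →L[ℂ] Y) (ε : ℝ) : Set ℂ :=
  {z | (inverseENorm (B - z • ContinuousLinearMap.id ℂ Y))⁻¹ ≤ ENNReal.ofReal ε}

/-- The open `ε`-pseudospectrum `spec_ε B = {z : 1 / ‖(B - z I)⁻¹‖ < ε}`, `ε > 0`. -/
def openPseudospectrum {Y : Type*} [NormedAddCommGroup Y] [NormedSpace ℂ Y]
    (B : Y →L[ℂ] Y) (ε : ℝ) : Set ℂ :=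
  {z | (inverseENorm (B - z • ContinuousLinearMap.id ℂ Y))⁻¹ < ENNReal.ofReal ε}

theorem closedPseudospectrum_zero {Y : Type*} [NormedAddCommGroup Y] [NormedSpace ℂ Y]
    (B : Y →L[ℂ] Y) : closedPseudospectrum B 0 = spectrum ℂ B := by
  ext z
  have h : IsUnit (B - z • ContinuousLinearMap.id ℂ Y) ↔
      IsUnit (algebraMap ℂ (Y →L[ℂ] Y) z - B) := by
    rw [← IsUnit.neg_iff, neg_sub, Algebra.algebraMap_eq_smul_one]
    rfl
  by_cases hu : IsUnit (B - z • ContinuousLinearMap.id ℂ Y)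
  · simp [closedPseudospectrum, inverseENorm, hu, spectrum.mem_iff, ← h]
  · simp [closedPseudospectrum, inverseENorm, hu, spectrum.mem_iff, ← h]

/-- Complex uniform convexity: for every `ε > 0` there is `δ > 0` such that `‖y‖ ≥ ε` and
`‖x + ζ y‖ ≤ 1` for all complex `|ζ| ≤ 1` imply `‖x‖ ≤ 1 - δ`. -/
def ComplexUniformlyConvex (Y : Type*) [NormedAddCommGroup Y] [NormedSpace ℂ Y] : Prop :=
  ∀ ε : ℝ, 0 < ε → ∃ δ : ℝ, 0 < δ ∧ ∀ x y : Y, ε ≤ ‖y‖ →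
    (∀ ζ : ℂ, ‖ζ‖ ≤ 1 → ‖x + ζ • y‖ ≤ 1) → ‖x‖ ≤ 1 - δ

/-- Globevnik's property: `Y` is finite-dimensional, or `Y` or its dual is complex uniformly
convex. -/
def GlobevnikProperty (Y : Type*) [NormedAddCommGroup Y] [NormedSpace ℂ Y] : Prop :=
  FiniteDimensional ℂ Y ∨ ComplexUniformlyConvex Y ∨ ComplexUniformlyConvex (Y →L[ℂ] ℂ)

/-- Convergence `S n → T` as `n → ∞` of non-empty bounded subsets of `ℂ` (indexed by the
positive integers) with respect to the Hausdorff distance. -/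
def HausdorffTendsto (S : ℕ → Set ℂ) (T : Set ℂ) : Prop :=
  (∀ n : ℕ, 1 ≤ n → (S n).Nonempty ∧ Bornology.IsBounded (S n)) ∧
  T.Nonempty ∧ Bornology.IsBounded T ∧
  Tendsto (fun n => Metric.hausdorffDist (S n) T) atTop (𝓝 0)

/-- The space `ℓ²(ℤ, X)` of square-summable bi-infinite `X`-valued sequences. -/
abbrev BiSeq (X : Type*) [NormedAddCommGroup X] : Type _ := lp (fun _ : ℤ => X) 2

section Operators

variable {X : Type*} [NormedAddCommGroup X] [NormedSpace ℂ X]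

/-- The entry `a_{i,j}`, an operator on `X`, of the matrix representation of an operator `A` on
`ℓ²(ℤ, X)`. -/
def matrixEntry (A : BiSeq X →L[ℂ] BiSeq X) (i j : ℤ) : X →L[ℂ] X :=
  (lp.evalCLM ℂ (fun _ : ℤ => X) 2 i).comp
    (A.comp (lp.singleContinuousLinearMap ℂ (fun _ : ℤ => X) 2 j))

/-- The matrix representation of `A` is tridiagonal. -/
def IsTridiagonal (A : BiSeq X →L[ℂ] BiSeq X) : Prop :=
  ∀ i j : ℤ, 1 < |i - j| → matrixEntry A i j = 0

/-- The matrix representation of `A` is diagonal. -/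
def IsDiagonalOperator (A : BiSeq X →L[ℂ] BiSeq X) : Prop :=
  ∀ i j : ℤ, i ≠ j → matrixEntry A i j = 0

/-- The finite section `A_{n,k}`: the `n × n` principal submatrix
`[a_{i,j}]`, `i, j ∈ {k+1, …, k+n}`, acting on `Xⁿ` with the norm
`‖(x₁, …, xₙ)‖ = (∑ ‖x_j‖²)^{1/2}`. -/
def finiteSection (A : BiSeq X →L[ℂ] BiSeq X) (n : ℕ) (k : ℤ) :
    PiLp 2 (fun _ : Fin n => X) →L[ℂ] PiLp 2 (fun _ : Fin n => X) :=
  ((PiLp.continuousLinearEquiv 2 ℂ (fun _ : Fin n => X)).symm :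
      (Fin n → X) →L[ℂ] PiLp 2 (fun _ : Fin n => X)).comp
    (ContinuousLinearMap.pi fun i : Fin n => ∑ j : Fin n,
      (matrixEntry A (k + 1 + (i : ℤ)) (k + 1 + (j : ℤ))).comp
        (PiLp.proj 2 (fun _ : Fin n => X) j))

/-- `σⁿ_ε(A)`, the union over `k ∈ ℤ` of the open `ε`-pseudospectra of `A_{n,k}`. -/
def tauOpenSet (A : BiSeq X →L[ℂ] BiSeq X) (n : ℕ) (ε : ℝ) : Set ℂ :=
  ⋃ k : ℤ, openPseudospectrum (finiteSection A n k) ε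

/-- `Σⁿ_ε(A)`, the closure of the union over `k ∈ ℤ` of the closed `ε`-pseudospectra of
`A_{n,k}`. -/
def tauClosedSet (A : BiSeq X →L[ℂ] BiSeq X) (n : ℕ) (ε : ℝ) : Set ℂ :=
  closure (⋃ k : ℤ, closedPseudospectrum (finiteSection A n k) ε)

/-- `‖α‖_∞`, where `α_j = a_{j+1,j}` is the first subdiagonal. -/
def subdiagNorm (A : BiSeq X →L[ℂ] BiSeq X) : ℝ := ⨆ j : ℤ, ‖matrixEntry A (j + 1) j‖

/-- `‖γ‖_∞`, where `γ_j = a_{j-1,j}` is the first superdiagonal. -/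
def superdiagNorm (A : BiSeq X →L[ℂ] BiSeq X) : ℝ := ⨆ j : ℤ, ‖matrixEntry A (j - 1) j‖

/-- `θ_n(φ)`: the solution `t` (it is unique, for `n ≥ 1` and `0 ≤ φ ≤ 1`) in
`[π/(2n+1), π/(n+2)]` of
`2 sin(t/2) cos((n + 1/2) t) + φ (1 - φ) sin((n - 1) t) = 0`. -/
def tauTheta (n : ℕ) (φ : ℝ) : ℝ :=
  sInf {t : ℝ | t ∈ Set.Icc (Real.pi / (2 * (n : ℝ) + 1)) (Real.pi / ((n : ℝ) + 2)) ∧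
    2 * Real.sin (t / 2) * Real.cos (((n : ℝ) + 1 / 2) * t)
      + φ * (1 - φ) * Real.sin (((n : ℝ) - 1) * t) = 0}

/-- The truncation penalty
`ε_n = 2 inf_{0<φ<1} (‖α‖_∞² / φ + ‖γ‖_∞² / (1 - φ))^{1/2} sin(θ_n(φ) / 2)`. -/
def tauPenalty (A : BiSeq X →L[ℂ] BiSeq X) (n : ℕ) : ℝ :=
  2 * ⨅ φ : Set.Ioo (0 : ℝ) 1,
    Real.sqrt (subdiagNorm A ^ 2 / (φ : ℝ) + superdiagNorm A ^ 2 / (1 - (φ : ℝ)))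
      * Real.sin (tauTheta n φ / 2)

/-- The `τ` method does not suffer from spectral pollution for `A`: there is a positive null
sequence `η` such that `spec_ε A_{n,k} ⊆ spec_{ε + η_n} A` for all `ε > 0`, `n ≥ 1`, `k ∈ ℤ`. -/
def TauNoSpectralPollution (A : BiSeq X →L[ℂ] BiSeq X) : Prop :=
  ∃ η : ℕ → ℝ, (∀ n, 0 < η n) ∧ Tendsto η atTop (𝓝 0) ∧
    ∀ ε : ℝ, 0 < ε → ∀ n : ℕ, 1 ≤ n → ∀ k : ℤ,
      openPseudospectrum (finiteSection A n k) ε ⊆ openPseudospectrum A (ε + η n)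

end Operators

end

/-! Write g(B) = 1/‖B⁻¹‖, so that pseudospectra are sublevel sets of z ↦ g(B - z).

Upper half. Absence of pollution puts the `τ` sets at level ε + ε_n into pseudospectra of A at a
level tending to ε. By compactness and lower semicontinuity of g, these shrink to
`closedPseudospectrum A ε`.

Lower half, open sets. If g(A - z) < ε, then A - z or its transpose has an approximate null vector
x. Multiply x by weights w supported on a window of length n, and slide the window along ℤ. Since A
is tridiagonal, commuting A with w costs only differences of neighbouring weights. Summed over all
positions the total cost is a quadratic form in w. The chosen w is an eigenvector of that form, with
eigenvalue (2 sin(θ/2))², which accounts for ε_n. Hence some window is good (`exists_window`,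
`exists_inverseGap_finiteSection_lt`).

Lower half, closed sets. Suppose w ∈ Spec_ε A lies outside the closed set Σⁿ. Then g(A_{n,k} - z)
exceeds ε + ε_n on a disc about w, for all k. A maximum principle that is uniform in k
(`UniformMaximumPrinciple`) raises the bound at w to ε + ε_n + δ, which contradicts the averaging
argument at level ε + δ. The same principle shows that spec_ε A is dense in Spec_ε A.

The maximum principle. Let R = B⁻¹, with resolvent bounded by 1/s on a disc about 0. Averaging the
resolvent against a positive kernel gives ‖R + ζ c R^{m+1}‖ ≤ 1/s for all |ζ| ≤ 1
(`norm_inverse_add_smul_pow_le`). If X or X* is complex uniformly convex, so is ℓ²(ℤ, X) or its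
dual, and m = 1 forces ‖R‖ strictly below 1/s. A finite-dimensional X need not be complex uniformly
convex; there all m are used, together with tridiagonality. A failure of the principle yields, after
localisation and an ultralimit, a backward orbit T e_{m+1} = e_m of a tridiagonal map on sequences
in which, at every site, a norming functional of e_0 kills all later e_m. Counting dimensions on
long intervals rules this out (`false_of_backwardOrbit`). Finite sections are brought into this
setting by extending them by a scalar outside their window. -/

/-! ### The reciprocal of the norm of the inverse -/

section InverseGap

variable {Y : Type*} [NormedAddCommGroup Y] [NormedSpace ℂ Y]

/-- The number `1 / ‖B⁻¹‖`, which is `0` if `B` is not invertible. -/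
noncomputable def inverseGap (B : Y →L[ℂ] Y) : ℝ := ((inverseENorm B)⁻¹).toReal

theorem inverseGap_of_isUnit {B : Y →L[ℂ] Y} (h : IsUnit B) :
    inverseGap B = ‖Ring.inverse B‖⁻¹ := by
  simp [inverseGap, inverseENorm, h]

theorem inverseGap_of_not_isUnit {B : Y →L[ℂ] Y} (h : ¬ IsUnit B) : inverseGap B = 0 := by
  simp [inverseGap, inverseENorm, h]

theorem inverseGap_nonneg (B : Y →L[ℂ] Y) : 0 ≤ inverseGap B := ENNReal.toReal_nonneg

theorem isUnit_of_inverseGap_pos {B : Y →L[ℂ] Y} (h : 0 < inverseGap B) : IsUnit B := by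
  by_contra hu
  rw [inverseGap_of_not_isUnit hu] at h
  exact lt_irrefl _ h

theorem norm_inverse_pos [Nontrivial Y] {B : Y →L[ℂ] Y} (h : IsUnit B) :
    0 < ‖Ring.inverse B‖ := by
  rw [norm_pos_iff]
  intro h0
  have := Ring.inverse_mul_cancel B h
  rw [h0, zero_mul] at this
  exact zero_ne_one this

/-- On the zero space the inverse has norm 0, its reciprocal is ∞, and `toReal` would turn that into
0; nontriviality excludes this. -/
theorem inv_inverseENorm_eq [Nontrivial Y] (B : Y →L[ℂ] Y) :
    (inverseENorm B)⁻¹ = ENNReal.ofReal (inverseGap B) := by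
  rw [inverseGap, ENNReal.ofReal_toReal]
  by_cases h : IsUnit B
  · have := norm_inverse_pos h
    simp only [inverseENorm, h, if_true, ne_eq, ENNReal.inv_eq_top]
    rw [← ofReal_norm, ENNReal.ofReal_eq_zero]
    exact not_le.2 this
  · simp [inverseENorm, h]

theorem mem_openPseudospectrum_iff [Nontrivial Y] {B : Y →L[ℂ] Y} {ε : ℝ} (hε : 0 < ε) {z : ℂ} :
    z ∈ openPseudospectrum B ε ↔ inverseGap (B - z • ContinuousLinearMap.id ℂ Y) < ε := by
  rw [openPseudospectrum, Set.mem_ofPred_eq, inv_inverseENorm_eq,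
    ENNReal.ofReal_lt_ofReal_iff hε]

theorem mem_closedPseudospectrum_iff [Nontrivial Y] {B : Y →L[ℂ] Y} {ε : ℝ} (hε : 0 ≤ ε) {z : ℂ} :
    z ∈ closedPseudospectrum B ε ↔ inverseGap (B - z • ContinuousLinearMap.id ℂ Y) ≤ ε := by
  rw [closedPseudospectrum, Set.mem_ofPred_eq, inv_inverseENorm_eq,
    ENNReal.ofReal_le_ofReal_iff hε]

theorem inverseGap_mul_norm_le (B : Y →L[ℂ] Y) (x : Y) : inverseGap B * ‖x‖ ≤ ‖B x‖ := by
  by_cases h : IsUnit B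
  · rw [inverseGap_of_isUnit h]
    have h1 : x = Ring.inverse B (B x) := by
      have := Ring.inverse_mul_cancel B h
      exact (congrArg (fun T : Y →L[ℂ] Y => T x) this).symm
    have h2 : ‖x‖ ≤ ‖Ring.inverse B‖ * ‖B x‖ := by
      conv_lhs => rw [h1]
      exact (Ring.inverse B).le_opNorm _
    rcases (norm_nonneg (Ring.inverse B)).eq_or_lt with h0 | h0
    · rw [← h0, inv_zero, zero_mul]; exact norm_nonneg _
    · rwa [inv_mul_le_iff₀ h0]
  · rw [inverseGap_of_not_isUnit h, zero_mul]; exact norm_nonneg _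

theorem inverseGap_mul_norm_comp_le (B : Y →L[ℂ] Y) (f : Y →L[ℂ] ℂ) :
    inverseGap B * ‖f‖ ≤ ‖f.comp B‖ := by
  by_cases h : IsUnit B
  · rw [inverseGap_of_isUnit h]
    have h1 : f = (f.comp B).comp (Ring.inverse B) := by
      have := Ring.mul_inverse_cancel B h
      ext x
      exact congrArg f (congrArg (fun T : Y →L[ℂ] Y => T x) this).symm
    have h2 : ‖f‖ ≤ ‖Ring.inverse B‖ * ‖f.comp B‖ := by
      conv_lhs => rw [h1]
      rw [mul_comm]
      exact ContinuousLinearMap.opNorm_comp_le _ _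
    rcases (norm_nonneg (Ring.inverse B)).eq_or_lt with h0 | h0
    · rw [← h0, inv_zero, zero_mul]; exact norm_nonneg _
    · rwa [inv_mul_le_iff₀ h0]
  · rw [inverseGap_of_not_isUnit h, zero_mul]; exact norm_nonneg _

theorem le_inverseGap_of_forall [Nontrivial Y] {B : Y →L[ℂ] Y} (h : IsUnit B) {s : ℝ} (hs : 0 < s)
    (hB : ∀ x, s * ‖x‖ ≤ ‖B x‖) : s ≤ inverseGap B := by
  rw [inverseGap_of_isUnit h, le_inv_comm₀ hs (norm_inverse_pos h)]
  refine ContinuousLinearMap.opNorm_le_bound _ (by positivity) fun y => ?_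
  have h1 : B (Ring.inverse B y) = y :=
    congrArg (fun T : Y →L[ℂ] Y => T y) (Ring.mul_inverse_cancel B h)
  have h2 := hB (Ring.inverse B y)
  rw [h1] at h2
  rwa [inv_mul_eq_div, le_div_iff₀' hs]

theorem norm_inverse_le_of_le_inverseGap [Nontrivial Y] {B : Y →L[ℂ] Y} {s : ℝ} (hs : 0 < s)
    (h : s ≤ inverseGap B) : IsUnit B ∧ ‖Ring.inverse B‖ ≤ s⁻¹ := by
  have hu := isUnit_of_inverseGap_pos (hs.trans_le h)
  refine ⟨hu, ?_⟩
  rw [inverseGap_of_isUnit hu] at h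
  rwa [← le_inv_comm₀ hs (norm_inverse_pos hu)]

/-- Either `B` or its transpose has a vector on which it is small, if `1 / ‖B⁻¹‖` is small. -/
theorem exists_small_of_inverseGap_lt [CompleteSpace Y] [Nontrivial Y] {B : Y →L[ℂ] Y} {ε : ℝ}
    (hε : 0 < ε) (h : inverseGap B < ε) :
    (∃ x, ‖B x‖ < ε * ‖x‖) ∨ ∃ f : Y →L[ℂ] ℂ, ‖f.comp B‖ < ε * ‖f‖ := by
  by_contra! hcon
  obtain ⟨h1, h2⟩ := hcon
  have hal : AntilipschitzWith ⟨ε⁻¹, by positivity⟩ B := by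
    refine ContinuousLinearMap.antilipschitz_of_bound B fun x => ?_
    show ‖x‖ ≤ ε⁻¹ * ‖B x‖
    rw [inv_mul_eq_div, le_div_iff₀' hε]
    exact h1 x
  -- Boundedness below makes the range closed. A failure of surjectivity then gives, by Hahn–Banach,
  -- a nonzero functional that kills the range, against `h2`.
  have hcl : IsClosed (Set.range B) := hal.isClosed_range B.uniformContinuous
  have hu : IsUnit B := by
    rw [ContinuousLinearMap.isUnit_iff_bijective]
    refine ⟨hal.injective, ?_⟩
    intro y
    by_contra hy
    have hy' : y ∉ (LinearMap.range (B : Y →ₗ[ℂ] Y)) := fun ⟨x, hx⟩ => hy ⟨x, hx⟩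
    have hcl' : IsClosed ((LinearMap.range (B : Y →ₗ[ℂ] Y) : Submodule ℂ Y) : Set Y) := by
      rw [LinearMap.coe_range]; exact hcl
    have hconv : Convex ℝ ((LinearMap.range (B : Y →ₗ[ℂ] Y) : Submodule ℂ Y) : Set Y) :=
      ((LinearMap.range (B : Y →ₗ[ℂ] Y)).restrictScalars ℝ).convex
    obtain ⟨f, u, hf1, hf2⟩ :=
      RCLike.geometric_hahn_banach_point_closed (𝕜 := ℂ) hconv hcl' hy'
    have hu0 : u < 0 := by simpa using hf2 0 (Submodule.zero_mem _)
    have hfB : f.comp B = 0 := by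
      ext x
      by_contra hx
      have hx' : f (B x) ≠ 0 := hx
      -- The real part of `f` stays above `u` on a subspace; rescaling the vector so that `f` takes
      -- the value `u` itself is the contradiction.
      have := hf2 (B (((u : ℂ) / f (B x)) • x)) ⟨_, rfl⟩
      rw [map_smul, map_smul, smul_eq_mul, div_mul_cancel₀ _ hx'] at this
      simp at this
    have hf0 : f ≠ 0 := by
      rintro rfl
      have : (0 : ℝ) < u := by simpa using hf1
      exact lt_asymm this hu0
    have := h2 f
    rw [hfB, norm_zero] at this
    exact absurd this (not_le.2 (mul_pos hε (norm_pos_iff.2 hf0)))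
  exact absurd (le_inverseGap_of_forall hu hε h1) (not_le.2 h)

theorem eventually_lt_inverseGap [CompleteSpace Y] [Nontrivial Y] {B : Y →L[ℂ] Y} {s : ℝ}
    (hs : 0 ≤ s) (h : s < inverseGap B) : ∀ᶠ B' in 𝓝 B, s < inverseGap B' := by
  have hu := isUnit_of_inverseGap_pos (hs.trans_lt h)
  obtain ⟨u, rfl⟩ := hu
  have h1 : ContinuousAt (fun B' : Y →L[ℂ] Y => ‖Ring.inverse B'‖⁻¹) (u : Y →L[ℂ] Y) :=
    (NormedRing.inverse_continuousAt u).norm.inv₀ (norm_inverse_pos u.isUnit).ne'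
  rw [inverseGap_of_isUnit u.isUnit] at h
  filter_upwards [h1.eventually (lt_mem_nhds h), Units.nhds u] with B' hB' hB''
  rwa [inverseGap_of_isUnit hB'']

theorem sub_norm_le_inverseGap [CompleteSpace Y] [Nontrivial Y] (B : Y →L[ℂ] Y) (z : ℂ) :
    ‖z‖ - ‖B‖ ≤ inverseGap (B - z • ContinuousLinearMap.id ℂ Y) := by
  rcases le_or_gt (‖z‖ - ‖B‖) 0 with h | h
  · exact h.trans (inverseGap_nonneg _)
  · refine le_inverseGap_of_forall ?_ h fun x => ?_
    · have : z ∈ resolventSet ℂ B := spectrum.mem_resolventSet_of_norm_lt (by linarith)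
      rw [spectrum.mem_resolventSet_iff, ← IsUnit.neg_iff, neg_sub,
        Algebra.algebraMap_eq_smul_one] at this
      exact this
    · have h1 := B.le_opNorm x
      have h2 : ‖z • x‖ - ‖B x‖ ≤ ‖B x - z • x‖ := by
        rw [norm_sub_rev]; exact norm_sub_norm_le _ _
      rw [norm_smul] at h2
      have : (B - z • ContinuousLinearMap.id ℂ Y) x = B x - z • x := rfl
      rw [this]
      nlinarith

theorem continuous_sub_smul_id (B : Y →L[ℂ] Y) :
    Continuous fun z : ℂ => B - z • ContinuousLinearMap.id ℂ Y := by fun_prop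

theorem norm_le_of_mem_openPseudospectrum [CompleteSpace Y] [Nontrivial Y] {B : Y →L[ℂ] Y} {ε : ℝ}
    (hε : 0 < ε) {z : ℂ} (hz : z ∈ openPseudospectrum B ε) : ‖z‖ ≤ ‖B‖ + ε := by
  rw [mem_openPseudospectrum_iff hε] at hz
  linarith [sub_norm_le_inverseGap B z]

theorem openPseudospectrum_mono {B : Y →L[ℂ] Y} {ε δ : ℝ} (h : ε ≤ δ) :
    openPseudospectrum B ε ⊆ openPseudospectrum B δ :=
  fun _ hz => lt_of_lt_of_le hz (ENNReal.ofReal_le_ofReal h)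

theorem closedPseudospectrum_subset_open {B : Y →L[ℂ] Y} {ε δ : ℝ} (hε : 0 ≤ ε) (h : ε < δ) :
    closedPseudospectrum B ε ⊆ openPseudospectrum B δ :=
  fun _ hz => lt_of_le_of_lt hz ((ENNReal.ofReal_lt_ofReal_iff (hε.trans_lt h)).2 h)

theorem closedPseudospectrum_mono {B : Y →L[ℂ] Y} {ε δ : ℝ} (h : ε ≤ δ) :
    closedPseudospectrum B ε ⊆ closedPseudospectrum B δ :=
  fun _ hz => le_trans hz (ENNReal.ofReal_le_ofReal h)

/-- Pseudospectra are upper semicontinuous in the parameter. -/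
theorem exists_openPseudospectrum_subset_thickening [CompleteSpace Y] [Nontrivial Y]
    (B : Y →L[ℂ] Y) {ε ρ : ℝ} (hε : 0 ≤ ε) (hρ : 0 < ρ) :
    ∃ τ > 0, openPseudospectrum B (ε + τ) ⊆ Metric.thickening ρ (closedPseudospectrum B ε) := by
  by_contra! hcon
  have hpos : ∀ n : ℕ, (0 : ℝ) < 1 / ((n : ℝ) + 1) := fun n => by positivity
  have hle : ∀ n : ℕ, 1 / ((n : ℝ) + 1) ≤ 1 := fun n => by
    rw [div_le_one (by positivity)]; linarith [(Nat.cast_nonneg n : (0 : ℝ) ≤ n)]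
  have h1 : ∀ n : ℕ, ∃ z, z ∈ openPseudospectrum B (ε + 1 / ((n : ℝ) + 1)) ∧
      z ∉ Metric.thickening ρ (closedPseudospectrum B ε) := fun n =>
    Set.not_subset.1 (hcon _ (hpos n))
  choose z hz hz' using h1
  have hb : ∀ n, z n ∈ Metric.closedBall (0 : ℂ) (‖B‖ + (ε + 1)) := fun n => by
    rw [mem_closedBall_zero_iff]
    have := norm_le_of_mem_openPseudospectrum (by linarith [hpos n]) (hz n)
    linarith [hle n]
  obtain ⟨w, -, φ, hφ, hw⟩ := (isCompact_closedBall (0 : ℂ) (‖B‖ + (ε + 1))).tendsto_subseq hb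
  -- Lower semicontinuity suffices: a gap above ε at the limit would stay above some s > ε along the
  -- sequence, while the levels tend to ε.
  have hwmem : w ∈ closedPseudospectrum B ε := by
    rw [mem_closedPseudospectrum_iff hε]
    by_contra! hlt
    obtain ⟨s, hs1, hs2⟩ := exists_between hlt
    have h2 := eventually_lt_inverseGap (hε.trans hs1.le) hs2
    have h3 := hw.eventually ((continuous_sub_smul_id B).continuousAt.eventually h2)
    have h4 : Tendsto (fun n : ℕ => ε + 1 / ((φ n : ℝ) + 1)) atTop (𝓝 (ε + 0)) :=
      (tendsto_one_div_add_atTop_nhds_zero_nat.comp hφ.tendsto_atTop).const_add ε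
    rw [add_zero] at h4
    obtain ⟨n, hn1, hn2⟩ := (h3.and (h4.eventually (gt_mem_nhds hs1))).exists
    have h5 := (mem_openPseudospectrum_iff (by linarith [hpos (φ n)])).1 (hz (φ n))
    exact lt_irrefl _ ((hn1.trans h5).trans hn2)
  have h6 : Metric.thickening ρ (closedPseudospectrum B ε) ∈ 𝓝 w :=
    Metric.isOpen_thickening.mem_nhds (Metric.self_subset_thickening hρ _ hwmem)
  obtain ⟨n, hn⟩ := (hw.eventually h6).exists
  exact hz' _ hn

end InverseGap

/-! ### The truncation penalty -/

section Penalty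

theorem exists_tauTheta {n : ℕ} (hn : 1 ≤ n) {φ : ℝ} (h0 : 0 < φ) (h1 : φ < 1) :
    ∃ t ∈ Set.Icc (Real.pi / (2 * (n : ℝ) + 1)) (Real.pi / ((n : ℝ) + 2)),
      2 * Real.sin (t / 2) * Real.cos (((n : ℝ) + 1 / 2) * t)
        + φ * (1 - φ) * Real.sin (((n : ℝ) - 1) * t) = 0 := by
  have hn' : (1 : ℝ) ≤ n := by exact_mod_cast hn
  have hpi := Real.pi_pos
  have hle : Real.pi / (2 * (n : ℝ) + 1) ≤ Real.pi / ((n : ℝ) + 2) := by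
    apply div_le_div_of_nonneg_left hpi.le <;> linarith
  have hφ : 0 ≤ φ * (1 - φ) := mul_nonneg h0.le (by linarith)
  have hφ' : φ * (1 - φ) ≤ 1 / 4 := by nlinarith [sq_nonneg (φ - 1 / 2)]
  set g : ℝ → ℝ := fun t => 2 * Real.sin (t / 2) * Real.cos (((n : ℝ) + 1 / 2) * t)
        + φ * (1 - φ) * Real.sin (((n : ℝ) - 1) * t) with hg
  have hcont : ContinuousOn g (Set.Icc (Real.pi / (2 * (n : ℝ) + 1)) (Real.pi / ((n : ℝ) + 2))) := by
    apply Continuous.continuousOn; fun_prop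
  -- Here (n + 1/2) t = π/2, so the cosine vanishes and only the term with factor φ(1 - φ) ≥ 0 is
  -- left.
  have hl : 0 ≤ g (Real.pi / (2 * (n : ℝ) + 1)) := by
    have e1 : ((n : ℝ) + 1 / 2) * (Real.pi / (2 * (n : ℝ) + 1)) = Real.pi / 2 := by
      field_simp
    simp only [hg, e1, Real.cos_pi_div_two, mul_zero, zero_add]
    refine mul_nonneg hφ (Real.sin_nonneg_of_nonneg_of_le_pi ?_ ?_)
    · exact mul_nonneg (by linarith) (by positivity)
    · rw [← mul_div_assoc, div_le_iff₀ (by linarith)]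
      nlinarith
  -- With n t = π - 2t the expression becomes sin t - sin 2t + φ(1 - φ) sin 3t. Replacing φ(1 - φ)
  -- by its maximum 1/4 gives sin t (cos t - 1/2)(cos t - 3/2), which is ≤ 0 because n ≥ 1 means t ≤
  -- π/3.
  have hr : g (Real.pi / ((n : ℝ) + 2)) ≤ 0 := by
    set t := Real.pi / ((n : ℝ) + 2) with ht
    have hnt : (n : ℝ) * t = Real.pi - 2 * t := by
      rw [ht]; field_simp; ring
    have ht0 : 0 < t := by positivity
    have ht3 : t ≤ Real.pi / 3 := by
      rw [ht]; apply div_le_div_of_nonneg_left hpi.le <;> linarith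
    have e1 : 2 * Real.sin (t / 2) * Real.cos (((n : ℝ) + 1 / 2) * t)
        = Real.sin t - Real.sin (2 * t) := by
      have e2 : ((n : ℝ) + 1 / 2) * t = Real.pi - 3 * (t / 2) := by linarith
      have e3 : Real.sin t = Real.sin (2 * (t / 2)) := by ring_nf
      have e4 : Real.sin (2 * t) = Real.sin (2 * (2 * (t / 2))) := by ring_nf
      rw [e2, Real.cos_pi_sub, e3, e4, Real.cos_three_mul, Real.sin_two_mul (2 * (t / 2)),
        Real.sin_two_mul, Real.cos_two_mul]
      ring
    have e2 : Real.sin (((n : ℝ) - 1) * t) = Real.sin (3 * t) := by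
      rw [show ((n : ℝ) - 1) * t = Real.pi - 3 * t by linarith, Real.sin_pi_sub]
    have h3 : 0 ≤ Real.sin (3 * t) :=
      Real.sin_nonneg_of_nonneg_of_le_pi (by linarith) (by linarith)
    have hs : 0 ≤ Real.sin t := Real.sin_nonneg_of_nonneg_of_le_pi ht0.le (by linarith)
    have hc : 1 / 2 ≤ Real.cos t := by
      rw [← Real.cos_pi_div_three]
      exact Real.cos_le_cos_of_nonneg_of_le_pi ht0.le (by linarith) ht3
    have hc' := Real.cos_le_one t
    have h4 : φ * (1 - φ) * Real.sin (3 * t) ≤ 1 / 4 * Real.sin (3 * t) :=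
      mul_le_mul_of_nonneg_right hφ' h3
    have h5 : Real.sin t - Real.sin (2 * t) + 1 / 4 * Real.sin (3 * t)
        = Real.sin t * ((Real.cos t - 1 / 2) * (Real.cos t - 3 / 2)) := by
      rw [Real.sin_two_mul, Real.sin_three_mul]
      have := Real.sin_sq_add_cos_sq t
      linear_combination (-Real.sin t) * this
    have h6 : Real.sin t * ((Real.cos t - 1 / 2) * (Real.cos t - 3 / 2)) ≤ 0 :=
      mul_nonpos_of_nonneg_of_nonpos hs
        (mul_nonpos_of_nonneg_of_nonpos (by linarith) (by linarith))
    simp only [hg, e1, e2]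
    linarith
  obtain ⟨t, ht, hgt⟩ := intermediate_value_Icc' hle hcont ⟨hr, hl⟩
  exact ⟨t, ht, hgt⟩

/-- The solution set is closed, non-empty and bounded below, so its infimum is itself a solution;
uniqueness plays no role. -/
theorem tauTheta_spec {n : ℕ} (hn : 1 ≤ n) {φ : ℝ} (h0 : 0 < φ) (h1 : φ < 1) :
    tauTheta n φ ∈ Set.Icc (Real.pi / (2 * (n : ℝ) + 1)) (Real.pi / ((n : ℝ) + 2)) ∧
      2 * Real.sin (tauTheta n φ / 2) * Real.cos (((n : ℝ) + 1 / 2) * tauTheta n φ)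
        + φ * (1 - φ) * Real.sin (((n : ℝ) - 1) * tauTheta n φ) = 0 := by
  have hcl : IsClosed {t : ℝ | t ∈ Set.Icc (Real.pi / (2 * (n : ℝ) + 1)) (Real.pi / ((n : ℝ) + 2)) ∧
    2 * Real.sin (t / 2) * Real.cos (((n : ℝ) + 1 / 2) * t)
      + φ * (1 - φ) * Real.sin (((n : ℝ) - 1) * t) = 0} := by
    refine isClosed_Icc.inter (isClosed_eq ?_ continuous_const)
    fun_prop
  obtain ⟨t, ht⟩ := exists_tauTheta hn h0 h1
  exact hcl.csInf_mem ⟨t, ht⟩ ⟨_, fun s hs => hs.1.1⟩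

/-- Transposition exchanges the two off-diagonals, hence φ and 1 - φ; this symmetry makes the
penalty the same for vectors and for functionals. -/
theorem tauTheta_symm (n : ℕ) (φ : ℝ) : tauTheta n (1 - φ) = tauTheta n φ := by
  unfold tauTheta
  congr 1
  ext t
  rw [Set.mem_ofPred_eq, Set.mem_ofPred_eq, sub_sub_cancel, mul_comm (1 - φ) φ]

/-- The weights `w₁, …, wₙ` extended by zero. -/
noncomputable def tauWeight (n : ℕ) (φ : ℝ) (i : ℤ) : ℝ :=
  if 1 ≤ i ∧ i ≤ n then
    Real.sin (i * tauTheta n φ) - (1 - φ) * Real.sin ((i - 1) * tauTheta n φ) else 0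

theorem tauWeight_eq_zero {n : ℕ} {φ : ℝ} {i : ℤ} (h : ¬ (1 ≤ i ∧ i ≤ n)) :
    tauWeight n φ i = 0 := if_neg h

/-- The quadratic form `∑ (1 - φ) (w_{i+1} - w_i)² + φ (w_i - w_{i-1})²` at weights which are
an eigenvector of the corresponding tridiagonal matrix. -/
theorem sum_sq_sub_of_recurrence (m : ℕ) (φ c : ℝ) (v w : ℤ → ℝ)
    (hv : ∀ i, v (i + 1) + v (i - 1) = 2 * c * v i)
    (hv0 : v 0 = (1 - φ) * v 1) (hvn : v (m + 1 + 1) = φ * v (m + 1))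
    (hw : ∀ i : ℤ, 1 ≤ i → i ≤ m + 1 → w i = v i) (hw0 : w 0 = 0) (hwn : w (m + 1 + 1) = 0) :
    ∑ i ∈ Finset.range (m + 1), ((1 - φ) * (w (i + 1 + 1) - w (i + 1)) ^ 2
        + φ * (w (i + 1) - w i) ^ 2)
      = (2 - 2 * c) * ∑ i ∈ Finset.range (m + 1), w (i + 1) ^ 2 := by
  -- Summation by parts: by the recurrence the summands telescope, so only boundary terms survive,
  -- here and in `hT2`.
  have hT1 : ∀ k : ℕ, ∑ i ∈ Finset.range k,
      ((v (i + 1 + 1) - v (i + 1)) ^ 2 - (2 - 2 * c) * v (i + 1) ^ 2)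
      = v (k + 1) * (v (k + 1) - v k) - v 1 * (v 1 - v 0) := by
    intro k
    induction k with
    | zero => simp
    | succ k ih =>
      rw [Finset.sum_range_succ, ih]
      have := hv (k + 1)
      rw [add_sub_cancel_right] at this
      push_cast
      linear_combination (-v (k + 1)) * this
  have hT2 : ∀ k : ℕ, ∑ i ∈ Finset.range k,
      ((v (i + 1) - v i) ^ 2 - (2 - 2 * c) * v (i + 1) ^ 2)
      = v k * (v (k + 1) - v k) - v 0 * (v 1 - v 0) := by
    intro k
    induction k with
    | zero => simp
    | succ k ih =>
      rw [Finset.sum_range_succ, ih]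
      have := hv (k + 1)
      rw [add_sub_cancel_right] at this
      push_cast
      linear_combination (-v (k + 1)) * this
  -- Cutting `v` off outside 1, …, m + 1 changes only the last difference here, and only the first
  -- one in `e2`.
  have e1 : ∑ i ∈ Finset.range (m + 1), (w (i + 1 + 1) - w (i + 1)) ^ 2
      = ∑ i ∈ Finset.range (m + 1), (v (i + 1 + 1) - v (i + 1)) ^ 2
        - (v (m + 1 + 1) - v (m + 1)) ^ 2 + v (m + 1) ^ 2 := by
    rw [Finset.sum_range_succ, Finset.sum_range_succ, hwn, hw (m + 1) (by omega) le_rfl]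
    rw [Finset.sum_congr rfl (g := fun i : ℕ => (v (i + 1 + 1) - v (i + 1)) ^ 2)]
    · ring
    · intro i hi
      have := Finset.mem_range.1 hi
      rw [hw (i + 1 + 1) (by omega) (by omega), hw (i + 1) (by omega) (by omega)]
  have e2 : ∑ i ∈ Finset.range (m + 1), (w (i + 1) - w i) ^ 2
      = ∑ i ∈ Finset.range (m + 1), (v (i + 1) - v i) ^ 2 - (v 1 - v 0) ^ 2 + v 1 ^ 2 := by
    rw [Finset.sum_range_succ', Finset.sum_range_succ']
    rw [Finset.sum_congr rfl (g := fun i : ℕ =>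
      (v (((i + 1 : ℕ) : ℤ) + 1) - v ((i + 1 : ℕ) : ℤ)) ^ 2)]
    · simp only [Nat.cast_zero, zero_add, hw0, hw 1 le_rfl (by omega)]
      ring
    · intro i hi
      have := Finset.mem_range.1 hi
      rw [hw _ (by push_cast; omega) (by push_cast; omega),
        hw _ (by push_cast; omega) (by push_cast; omega)]
  have e3 : ∑ i ∈ Finset.range (m + 1), w (i + 1) ^ 2 = ∑ i ∈ Finset.range (m + 1), v (i + 1) ^ 2 :=
    Finset.sum_congr rfl fun i hi => by
      have := Finset.mem_range.1 hi
      rw [hw _ (by omega) (by omega)]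
  have h1 := hT1 (m + 1)
  have h2 := hT2 (m + 1)
  rw [Finset.sum_sub_distrib, ← Finset.mul_sum] at h1 h2
  push_cast at h1 h2
  rw [Finset.sum_add_distrib, ← Finset.mul_sum, ← Finset.mul_sum, e1, e2, e3]
  -- The two boundary conditions on `v` are what cancels the remaining end terms.
  linear_combination (1 - φ) * h1 + φ * h2 + v (m + 1) * hvn + v 1 * hv0

theorem tauTheta_pos {n : ℕ} (hn : 1 ≤ n) {φ : ℝ} (h0 : 0 < φ) (h1 : φ < 1) :
    0 < tauTheta n φ :=
  lt_of_lt_of_le (by have := Real.pi_pos; positivity) (tauTheta_spec hn h0 h1).1.1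

theorem tauTheta_le_pi_div_three {n : ℕ} (hn : 1 ≤ n) {φ : ℝ} (h0 : 0 < φ) (h1 : φ < 1) :
    tauTheta n φ ≤ Real.pi / 3 := by
  refine (tauTheta_spec hn h0 h1).1.2.trans ?_
  have hn' : (1 : ℝ) ≤ n := by exact_mod_cast hn
  apply div_le_div_of_nonneg_left Real.pi_pos.le <;> linarith

theorem tauWeight_one_pos {n : ℕ} (hn : 1 ≤ n) {φ : ℝ} (h0 : 0 < φ) (h1 : φ < 1) :
    0 < tauWeight n φ 1 := by
  rw [tauWeight, if_pos ⟨le_rfl, by exact_mod_cast hn⟩]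
  have : 0 < Real.sin (tauTheta n φ) := Real.sin_pos_of_pos_of_lt_pi (tauTheta_pos hn h0 h1)
    (by linarith [tauTheta_le_pi_div_three hn h0 h1, Real.pi_pos])
  simpa using this

theorem sin_tauTheta_half_pos {n : ℕ} (hn : 1 ≤ n) {φ : ℝ} (h0 : 0 < φ) (h1 : φ < 1) :
    0 < Real.sin (tauTheta n φ / 2) :=
  Real.sin_pos_of_pos_of_lt_pi (by linarith [tauTheta_pos hn h0 h1])
    (by linarith [tauTheta_le_pi_div_three hn h0 h1, Real.pi_pos])

/-- With t the angle, the sequence sin(i t) - (1 - φ) sin((i - 1) t) satisfies the recurrence with c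
= cos t and, by its form, the left boundary condition. The right boundary condition is exactly the
equation defining t, and 2 - 2 cos t = (2 sin(t/2))². -/
theorem sum_sq_tauWeight {n : ℕ} (hn : 1 ≤ n) {φ : ℝ} (h0 : 0 < φ) (h1 : φ < 1) :
    ∑ i ∈ Finset.range n, ((1 - φ) * (tauWeight n φ (i + 1 + 1) - tauWeight n φ (i + 1)) ^ 2
        + φ * (tauWeight n φ (i + 1) - tauWeight n φ i) ^ 2)
      = (2 * Real.sin (tauTheta n φ / 2)) ^ 2 * ∑ i ∈ Finset.range n, tauWeight n φ (i + 1) ^ 2 := by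
  obtain ⟨m, rfl⟩ : ∃ m, n = m + 1 := ⟨n - 1, by omega⟩
  set t := tauTheta (m + 1) φ with ht
  have hc : (2 * Real.sin (t / 2)) ^ 2 = 2 - 2 * Real.cos t := by
    have h2 : Real.cos t = Real.cos (2 * (t / 2)) := by ring_nf
    have := Real.sin_sq_add_cos_sq (t / 2)
    rw [h2, Real.cos_two_mul]
    linear_combination 4 * this
  rw [hc]
  refine sum_sq_sub_of_recurrence m φ (Real.cos t)
    (fun i => Real.sin (i * t) - (1 - φ) * Real.sin ((i - 1) * t)) (tauWeight (m + 1) φ) ?_ ?_ ?_ ?_ ?_ ?_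
  · intro i
    have key : ∀ y : ℝ, Real.sin ((y + 1) * t) + Real.sin ((y - 1) * t)
        = 2 * Real.cos t * Real.sin (y * t) := by
      intro y
      rw [add_mul, sub_mul, one_mul, Real.sin_add, Real.sin_sub]; ring
    have a1 := key i
    have a2 := key ((i : ℝ) - 1)
    rw [sub_add_cancel] at a2
    push_cast
    rw [add_sub_cancel_right]
    linear_combination a1 - (1 - φ) * a2
  · simp
  · have h2 := (tauTheta_spec hn h0 h1).2
    rw [← ht] at h2
    push_cast at h2 ⊢
    have a1 : Real.sin (((m : ℝ) + 1 + 1) * t) - Real.sin (((m : ℝ) + 1) * t)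
        = 2 * Real.sin (t / 2) * Real.cos (((m : ℝ) + 1 + 1 / 2) * t) := by
      rw [Real.sin_sub_sin]; ring_nf
    have a2 : ((m : ℝ) + 1 + 1 - 1) * t = ((m : ℝ) + 1) * t := by ring
    rw [a2]
    linear_combination a1 + h2
  · intro i hi1 hi2
    rw [tauWeight, if_pos ⟨hi1, by exact_mod_cast hi2⟩]
  · exact tauWeight_eq_zero (by omega)
  · exact tauWeight_eq_zero (by push_cast; omega)

/-- Cauchy–Schwarz twice: `p` against the rest with weights ε and κ, then the two off-diagonal terms
with weights φ and 1 - φ. This choice makes the errors ε and κ add up linearly. -/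
theorem sq_add_mul_add_mul_le {a b φ ε κ : ℝ} (hφ0 : 0 < φ) (hφ1 : φ < 1) (hε : 0 < ε)
    (hκ : 0 < κ) (p u v : ℝ) : (p + (a * u + b * v)) ^ 2 ≤
      (ε + κ) * (p ^ 2 / ε + (a ^ 2 / φ + b ^ 2 / (1 - φ)) / κ *
        (φ * u ^ 2 + (1 - φ) * v ^ 2)) := by
  have hφ1' : 0 < 1 - φ := by linarith
  have h1 : (a * u + b * v) ^ 2 ≤
      (a ^ 2 / φ + b ^ 2 / (1 - φ)) * (φ * u ^ 2 + (1 - φ) * v ^ 2) := by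
    rw [div_add_div _ _ hφ0.ne' hφ1'.ne', div_mul_eq_mul_div,
      le_div_iff₀ (mul_pos hφ0 hφ1')]
    nlinarith [sq_nonneg (a * (1 - φ) * v - b * φ * u)]
  have h2 : ∀ r : ℝ, (p + r) ^ 2 ≤ (ε + κ) * (p ^ 2 / ε + r ^ 2 / κ) := by
    intro r
    rw [div_add_div _ _ hε.ne' hκ.ne', ← mul_div_assoc, le_div_iff₀ (mul_pos hε hκ)]
    nlinarith [sq_nonneg (κ * p - ε * r)]
  refine (h2 _).trans (mul_le_mul_of_nonneg_left ?_ (by linarith))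
  refine add_le_add_right ?_ _
  rw [div_mul_eq_mul_div]
  exact div_le_div_of_nonneg_right h1 hκ.le

theorem HasSum.comp_add_right {f : ℤ → ℝ} {S : ℝ} (h : HasSum f S) (c : ℤ) :
    HasSum (fun k => f (k + c)) S :=
  ((Equiv.addRight c).hasSum_iff (f := f)).2 h

/-- The averaging argument behind the inclusion of pseudospectra in those of finite sections. -/
theorem exists_window {n : ℕ} {w x y : ℤ → ℝ} {a b φ μ Sx Sy ε κ : ℝ}
    (hx : HasSum (fun j => x j ^ 2) Sx) (hy : HasSum (fun j => y j ^ 2) Sy)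
    (hφ0 : 0 < φ) (hφ1 : φ < 1)
    (hw : ∑ i ∈ Finset.range n, ((1 - φ) * (w (i + 1 + 1) - w (i + 1)) ^ 2
        + φ * (w (i + 1) - w i) ^ 2) = μ ^ 2 * ∑ i ∈ Finset.range n, w (i + 1) ^ 2)
    (hwpos : 0 < ∑ i ∈ Finset.range n, w (i + 1) ^ 2)
    (hε : 0 < ε) (hκ : 0 < κ) (hμ : (a ^ 2 / φ + b ^ 2 / (1 - φ)) * μ ^ 2 ≤ κ ^ 2)
    (hxy : Sy < ε ^ 2 * Sx) :
    ∃ k : ℤ, ∑ i ∈ Finset.range n, (|w (i + 1)| * y (k + 1 + i)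
        + (a * |w (i + 1) - w i| * x (k + 1 + i - 1)
          + b * |w (i + 1 + 1) - w (i + 1)| * x (k + 1 + i + 1))) ^ 2
      < (ε + κ) ^ 2 * ∑ i ∈ Finset.range n, w (i + 1) ^ 2 * x (k + 1 + i) ^ 2 := by
  -- If every window failed, the reverse inequalities could be summed over k ∈ ℤ. For a fixed offset
  -- i, the shifted indices run through all of ℤ, so each offset contributes a full sum `Sx` or
  -- `Sy`.
  by_contra! hcon
  have hφ1' : 0 < 1 - φ := by linarith
  set W := ∑ i ∈ Finset.range n, w (i + 1) ^ 2 with hW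
  have hSx0 : 0 ≤ Sx := hx.nonneg fun _ => sq_nonneg _
  have hsumL : HasSum (fun k : ℤ => (ε + κ) ^ 2 * ∑ i ∈ Finset.range n, w (i + 1) ^ 2 * x (k + 1 + i) ^ 2)
      ((ε + κ) ^ 2 * (W * Sx)) := by
    have h1 : ∀ i ∈ Finset.range n,
        HasSum (fun k : ℤ => w (i + 1) ^ 2 * x (k + 1 + i) ^ 2) (w (i + 1) ^ 2 * Sx) := by
      intro i _
      have h0 := (hx.comp_add_right (1 + i)).mul_left (w (i + 1) ^ 2)
      simpa only [add_assoc] using h0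
    have h2 := (hasSum_sum h1).mul_left ((ε + κ) ^ 2)
    rwa [← Finset.sum_mul] at h2
  set α := a ^ 2 / φ + b ^ 2 / (1 - φ) with hα
  have hα0 : 0 ≤ α := by positivity
  have hsumR : HasSum (fun k : ℤ => ∑ i ∈ Finset.range n,
      (ε + κ) * (w (i + 1) ^ 2 * y (k + 1 + i) ^ 2 / ε + α / κ *
        (φ * (w (i + 1) - w i) ^ 2 * x (k + 1 + i - 1) ^ 2
          + (1 - φ) * (w (i + 1 + 1) - w (i + 1)) ^ 2 * x (k + 1 + i + 1) ^ 2)))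
      ((ε + κ) * (W * Sy / ε + α / κ * (μ ^ 2 * W * Sx))) := by
    have e : (ε + κ) * (W * Sy / ε + α / κ * (μ ^ 2 * W * Sx)) = ∑ i ∈ Finset.range n,
      (ε + κ) * (w (i + 1) ^ 2 * Sy / ε + α / κ *
        (φ * (w (i + 1) - w i) ^ 2 * Sx + (1 - φ) * (w (i + 1 + 1) - w (i + 1)) ^ 2 * Sx)) := by
      have e1 : (ε + κ) * (W * Sy / ε + α / κ * (μ ^ 2 * W * Sx))
          = (ε + κ) * (Sy / ε) * W + (ε + κ) * (α / κ) * Sx * (μ ^ 2 * W) := by ring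
      rw [e1, ← hw, hW, Finset.mul_sum, Finset.mul_sum, ← Finset.sum_add_distrib]
      refine Finset.sum_congr rfl fun i _ => ?_
      ring
    rw [e]
    have h1 : ∀ i ∈ Finset.range n, HasSum (fun k : ℤ =>
      (ε + κ) * (w (i + 1) ^ 2 * y (k + 1 + i) ^ 2 / ε + α / κ *
        (φ * (w (i + 1) - w i) ^ 2 * x (k + 1 + i - 1) ^ 2
          + (1 - φ) * (w (i + 1 + 1) - w (i + 1)) ^ 2 * x (k + 1 + i + 1) ^ 2)))
      ((ε + κ) * (w (i + 1) ^ 2 * Sy / ε + α / κ *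
        (φ * (w (i + 1) - w i) ^ 2 * Sx + (1 - φ) * (w (i + 1 + 1) - w (i + 1)) ^ 2 * Sx))) := by
      intro i _
      have s1 : HasSum (fun k : ℤ => y (k + 1 + i) ^ 2) Sy := by
        simpa only [add_assoc] using hy.comp_add_right (1 + i)
      have s2 : HasSum (fun k : ℤ => x (k + 1 + i - 1) ^ 2) Sx := by
        simpa only [add_assoc, add_sub_assoc] using hx.comp_add_right (1 + (i - 1))
      have s3 : HasSum (fun k : ℤ => x (k + 1 + i + 1) ^ 2) Sx := by
        simpa only [add_assoc] using hx.comp_add_right (1 + (i + 1))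
      have s4 := (s2.mul_left (φ * (w (i + 1) - w i) ^ 2)).add
        (s3.mul_left ((1 - φ) * (w (i + 1 + 1) - w (i + 1)) ^ 2))
      have s5 := ((s1.mul_left (w (i + 1) ^ 2)).div_const ε).add (s4.mul_left (α / κ))
      exact s5.mul_left (ε + κ)
    exact hasSum_sum h1
  have hle : (ε + κ) ^ 2 * (W * Sx) ≤ (ε + κ) * (W * Sy / ε + α / κ * (μ ^ 2 * W * Sx)) := by
    have hk : ∀ k : ℤ, ∀ i ∈ Finset.range n, (|w (i + 1)| * y (k + 1 + i)
        + (a * |w (i + 1) - w i| * x (k + 1 + i - 1)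
          + b * |w (i + 1 + 1) - w (i + 1)| * x (k + 1 + i + 1))) ^ 2 ≤
        (ε + κ) * (w (i + 1) ^ 2 * y (k + 1 + i) ^ 2 / ε + α / κ *
        (φ * (w (i + 1) - w i) ^ 2 * x (k + 1 + i - 1) ^ 2
          + (1 - φ) * (w (i + 1 + 1) - w (i + 1)) ^ 2 * x (k + 1 + i + 1) ^ 2)) := by
      intro k i _
      have := sq_add_mul_add_mul_le (a := a) (b := b) hφ0 hφ1 hε hκ (|w (i + 1)| * y (k + 1 + i))
        (|w (i + 1) - w i| * x (k + 1 + i - 1)) (|w (i + 1 + 1) - w (i + 1)| * x (k + 1 + i + 1))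
      simp only [mul_pow, sq_abs] at this
      simp only [mul_assoc] at this ⊢
      exact this
    exact hasSum_le (fun k => (hcon k).trans (Finset.sum_le_sum (hk k))) hsumL hsumR
  -- With W the sum of squared weights, the residual contributes less than ε W Sx and the commutator
  -- at most κ W Sx. The right-hand side thus stays below (ε + κ)² W Sx, the left-hand side.
  have h1 : W * Sy / ε < W * (ε * Sx) := by
    rw [div_lt_iff₀ hε]
    nlinarith
  have h2 : α / κ * (μ ^ 2 * W * Sx) ≤ κ * (W * Sx) := by
    rw [div_mul_eq_mul_div, div_le_iff₀ hκ]
    have : α * μ ^ 2 * (W * Sx) ≤ κ ^ 2 * (W * Sx) :=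
      mul_le_mul_of_nonneg_right hμ (mul_nonneg hwpos.le hSx0)
    nlinarith
  have h3 : 0 < ε + κ := by linarith
  nlinarith

variable {X : Type*} [NormedAddCommGroup X] [NormedSpace ℂ X]

theorem norm_matrixEntry_le (A : BiSeq X →L[ℂ] BiSeq X) (i j : ℤ) : ‖matrixEntry A i j‖ ≤ ‖A‖ := by
  refine ContinuousLinearMap.opNorm_le_bound _ (norm_nonneg _) fun x => ?_
  have h1 : ‖matrixEntry A i j x‖ ≤ ‖A (lp.single 2 j x)‖ :=
    lp.norm_apply_le_norm (by norm_num) (A (lp.single 2 j x)) i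
  refine h1.trans ((A.le_opNorm _).trans_eq ?_)
  rw [lp.norm_single (by norm_num)]

theorem bddAbove_subdiag (A : BiSeq X →L[ℂ] BiSeq X) :
    BddAbove (Set.range fun j : ℤ => ‖matrixEntry A (j + 1) j‖) :=
  ⟨‖A‖, by rintro _ ⟨j, rfl⟩; exact norm_matrixEntry_le A _ _⟩

theorem bddAbove_superdiag (A : BiSeq X →L[ℂ] BiSeq X) :
    BddAbove (Set.range fun j : ℤ => ‖matrixEntry A (j - 1) j‖) :=
  ⟨‖A‖, by rintro _ ⟨j, rfl⟩; exact norm_matrixEntry_le A _ _⟩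

theorem norm_entry_le_subdiagNorm (A : BiSeq X →L[ℂ] BiSeq X) (j : ℤ) :
    ‖matrixEntry A (j + 1) j‖ ≤ subdiagNorm A := le_ciSup (bddAbove_subdiag A) j

theorem norm_entry_le_superdiagNorm (A : BiSeq X →L[ℂ] BiSeq X) (j : ℤ) :
    ‖matrixEntry A (j - 1) j‖ ≤ superdiagNorm A := le_ciSup (bddAbove_superdiag A) j

/-- The quantity of which half the truncation penalty is the infimum. -/
noncomputable def penaltyTerm (A : BiSeq X →L[ℂ] BiSeq X) (n : ℕ) (φ : ℝ) : ℝ :=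
  Real.sqrt (subdiagNorm A ^ 2 / φ + superdiagNorm A ^ 2 / (1 - φ)) * Real.sin (tauTheta n φ / 2)

theorem penaltyTerm_nonneg (A : BiSeq X →L[ℂ] BiSeq X) {n : ℕ} (hn : 1 ≤ n)
    (φ : Set.Ioo (0 : ℝ) 1) : 0 ≤ penaltyTerm A n φ :=
  mul_nonneg (Real.sqrt_nonneg _) (sin_tauTheta_half_pos hn φ.2.1 φ.2.2).le

theorem tauPenalty_eq (A : BiSeq X →L[ℂ] BiSeq X) (n : ℕ) :
    tauPenalty A n = 2 * ⨅ φ : Set.Ioo (0 : ℝ) 1, penaltyTerm A n φ := rfl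

theorem tauPenalty_nonneg (A : BiSeq X →L[ℂ] BiSeq X) {n : ℕ} (hn : 1 ≤ n) :
    0 ≤ tauPenalty A n := by
  rw [tauPenalty_eq]
  exact mul_nonneg zero_le_two (Real.iInf_nonneg fun φ => penaltyTerm_nonneg A hn φ)

instance nonempty_Ioo_zero_one : Nonempty (Set.Ioo (0 : ℝ) 1) :=
  ⟨⟨1 / 2, by norm_num, by norm_num⟩⟩

theorem exists_penaltyTerm_lt (A : BiSeq X →L[ℂ] BiSeq X) (n : ℕ) {s : ℝ} (h : tauPenalty A n < s) :
    ∃ φ : ℝ, 0 < φ ∧ φ < 1 ∧ 2 * penaltyTerm A n φ < s := by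
  rw [tauPenalty_eq] at h
  obtain ⟨φ, hφ⟩ := exists_lt_of_ciInf_lt (show (⨅ φ : Set.Ioo (0 : ℝ) 1, penaltyTerm A n φ) < s / 2 by
    linarith)
  exact ⟨φ, φ.2.1, φ.2.2, by linarith⟩

theorem tendsto_tauPenalty (A : BiSeq X →L[ℂ] BiSeq X) :
    Tendsto (tauPenalty A) atTop (𝓝 0) := by
  set c := Real.sqrt (subdiagNorm A ^ 2 / (1 / 2) + superdiagNorm A ^ 2 / (1 - 1 / 2)) with hc
  have hc0 : 0 ≤ c := Real.sqrt_nonneg _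
  have hlim : Tendsto (fun n : ℕ => c * Real.pi * (1 / ((n : ℝ) + 1))) atTop (𝓝 (c * Real.pi * 0)) :=
    tendsto_one_div_add_atTop_nhds_zero_nat.const_mul _
  rw [mul_zero] at hlim
  refine tendsto_of_tendsto_of_tendsto_of_le_of_le' tendsto_const_nhds hlim ?_ ?_
  · filter_upwards [eventually_ge_atTop 1] with n hn using tauPenalty_nonneg A hn
  · filter_upwards [eventually_ge_atTop 1] with n hn
    have h0 : (0 : ℝ) < 1 / 2 := by norm_num
    have h1 : (1 / 2 : ℝ) < 1 := by norm_num
    have hle : (⨅ φ : Set.Ioo (0 : ℝ) 1, penaltyTerm A n φ) ≤ penaltyTerm A n (1 / 2) :=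
      ciInf_le (f := fun φ : Set.Ioo (0 : ℝ) 1 => penaltyTerm A n φ)
        ⟨0, by rintro _ ⟨φ, rfl⟩; exact penaltyTerm_nonneg A hn φ⟩ ⟨1 / 2, h0, h1⟩
    have hθ := tauTheta_pos hn h0 h1
    have hsin : Real.sin (tauTheta n (1 / 2) / 2) ≤ tauTheta n (1 / 2) / 2 :=
      Real.sin_le (by linarith)
    have hθ' : tauTheta n (1 / 2) ≤ Real.pi * (1 / ((n : ℝ) + 1)) := by
      refine (tauTheta_spec hn h0 h1).1.2.trans ?_
      rw [mul_one_div]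
      apply div_le_div_of_nonneg_left Real.pi_pos.le (by positivity) (by linarith)
    rw [tauPenalty_eq]
    have : penaltyTerm A n (1 / 2) ≤ c * (tauTheta n (1 / 2) / 2) :=
      mul_le_mul_of_nonneg_left hsin hc0
    have : c * tauTheta n (1 / 2) ≤ c * (Real.pi * (1 / ((n : ℝ) + 1))) :=
      mul_le_mul_of_nonneg_left hθ' hc0
    linarith

/-- Since 1/φ and 1/(1 - φ) are at least 1 and θ ≥ π/(2n + 1), the terms of the infimum have a
positive lower bound independent of φ. This keeps the level positive at ε = 0, as the maximum
principle requires. -/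
theorem tauPenalty_pos {A : BiSeq X →L[ℂ] BiSeq X} (hA : IsTridiagonal A)
    (hd : ¬ IsDiagonalOperator A) {n : ℕ} (hn : 1 ≤ n) : 0 < tauPenalty A n := by
  have hmax : 0 < max (subdiagNorm A) (superdiagNorm A) := by
    simp only [IsDiagonalOperator, not_forall] at hd
    obtain ⟨i, j, hij, hne⟩ := hd
    have hle : |i - j| ≤ 1 := by
      by_contra! h
      exact hne (hA i j h)
    have hpos : 0 < ‖matrixEntry A i j‖ := norm_pos_iff.2 hne
    rw [abs_le] at hle
    rcases (by omega : i = j + 1 ∨ i = j - 1) with rfl | rfl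
    · exact lt_max_of_lt_left (hpos.trans_le (norm_entry_le_subdiagNorm A j))
    · exact lt_max_of_lt_right (hpos.trans_le (norm_entry_le_superdiagNorm A j))
  have hn' : (1 : ℝ) ≤ n := by exact_mod_cast hn
  have hpi := Real.pi_pos
  set t := Real.pi / (2 * (n : ℝ) + 1) with ht
  have ht0 : 0 < t := by positivity
  have ht1 : t ≤ Real.pi / 3 := by
    rw [ht]; apply div_le_div_of_nonneg_left hpi.le <;> linarith
  have hsin : 0 < Real.sin (t / 2) := Real.sin_pos_of_pos_of_lt_pi (by linarith) (by linarith)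
  have hlow : max (subdiagNorm A) (superdiagNorm A) * Real.sin (t / 2) ≤
      ⨅ φ : Set.Ioo (0 : ℝ) 1, penaltyTerm A n φ := by
    refine le_ciInf fun φ => ?_
    obtain ⟨φ, h0, h1⟩ := φ
    have h1' : 0 < 1 - φ := by linarith
    refine mul_le_mul ?_ ?_ hsin.le (Real.sqrt_nonneg _)
    · have e1 : subdiagNorm A ^ 2 ≤ subdiagNorm A ^ 2 / φ :=
        le_div_self (sq_nonneg _) h0 h1.le
      have e2 : superdiagNorm A ^ 2 ≤ superdiagNorm A ^ 2 / (1 - φ) :=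
        le_div_self (sq_nonneg _) h1' (by linarith)
      refine max_le (Real.le_sqrt_of_sq_le ?_) (Real.le_sqrt_of_sq_le ?_)
      · have := sq_nonneg (superdiagNorm A); linarith
      · have := sq_nonneg (subdiagNorm A); linarith
    · have := (tauTheta_spec hn h0 h1).1.1
      have h3 := tauTheta_le_pi_div_three hn h0 h1
      exact Real.sin_le_sin_of_le_of_le_pi_div_two (by linarith) (by linarith) (by linarith)
  rw [tauPenalty_eq]
  have := mul_pos hmax hsin
  linarith

end Penalty

/-! ### Coordinates of sequences and of functionals -/

section Coordinates

theorem BiSeq.hasSum_norm_sq {X : Type*} [NormedAddCommGroup X] (x : BiSeq X) : HasSum (fun j => ‖x j‖ ^ 2) (‖x‖ ^ 2) := by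
  have := lp.hasSum_norm (p := 2) (by norm_num) x
  simpa using this

variable {X : Type*} [NormedAddCommGroup X] [NormedSpace ℂ X]

theorem BiSeq.hasSum_single (x : BiSeq X) :
    HasSum (fun j => lp.singleContinuousLinearMap ℂ (fun _ : ℤ => X) 2 j (x j)) x :=
  lp.hasSum_single (by norm_num) x

theorem BiSeq.norm_sum_single_sq (x : ℤ → X) (s : Finset ℤ) :
    ‖∑ j ∈ s, lp.singleContinuousLinearMap ℂ (fun _ : ℤ => X) 2 j (x j)‖ ^ 2
      = ∑ j ∈ s, ‖x j‖ ^ 2 := by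
  have := lp.norm_sum_single (p := 2) (E := fun _ : ℤ => X) (by norm_num) x s
  simpa using this

theorem BiSeq.single_apply (i j : ℤ) (x : X) :
    (lp.singleContinuousLinearMap ℂ (fun _ : ℤ => X) 2 j x : BiSeq X) i = if i = j then x else 0 := by
  show (lp.single 2 j x : BiSeq X) i = _
  rw [lp.single_apply]
  by_cases h : i = j
  · subst h; simp
  · simp [h]

theorem matrixEntry_apply (A : BiSeq X →L[ℂ] BiSeq X) (i j : ℤ) (x : X) :
    matrixEntry A i j x = A (lp.singleContinuousLinearMap ℂ (fun _ : ℤ => X) 2 j x) i := rfl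

theorem hasSum_matrixEntry (A : BiSeq X →L[ℂ] BiSeq X) (x : BiSeq X) (i : ℤ) :
    HasSum (fun j => matrixEntry A i j (x j)) (A x i) := by
  have h := ((lp.evalCLM ℂ (fun _ : ℤ => X) 2 i).comp A).hasSum (BiSeq.hasSum_single x)
  exact h

theorem IsTridiagonal.apply_eq {A : BiSeq X →L[ℂ] BiSeq X} (hA : IsTridiagonal A) (x : BiSeq X)
    (i : ℤ) : A x i = matrixEntry A i (i - 1) (x (i - 1)) + matrixEntry A i i (x i)
      + matrixEntry A i (i + 1) (x (i + 1)) := by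
  have h := hasSum_matrixEntry A x i
  have h2 : HasSum (fun j => matrixEntry A i j (x j))
      (∑ j ∈ {i - 1, i, i + 1}, matrixEntry A i j (x j)) := by
    refine hasSum_sum_of_ne_finset_zero fun j hj => ?_
    rw [hA i j, zero_apply]
    simp only [Finset.mem_insert, Finset.mem_singleton, not_or] at hj
    rw [lt_abs]
    omega
  rw [h.unique h2, Finset.sum_insert (by simp; omega), Finset.sum_insert (by simp), Finset.sum_singleton,
    add_assoc]

/-- The coordinates of a functional on `ℓ²(ℤ, X)`. -/
noncomputable def dualCoord (f : BiSeq X →L[ℂ] ℂ) (j : ℤ) : X →L[ℂ] ℂ :=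
  f.comp (lp.singleContinuousLinearMap ℂ (fun _ : ℤ => X) 2 j)

theorem dualCoord_apply (f : BiSeq X →L[ℂ] ℂ) (j : ℤ) (x : X) :
    dualCoord f j x = f (lp.singleContinuousLinearMap ℂ (fun _ : ℤ => X) 2 j x) := rfl

/-- Test `f` on vectors whose j-th coordinate nearly norms the j-th coordinate functional, scaled by
the norm of that functional. The factor t < 1 is there because these norms need not be attained. -/
theorem sum_norm_dualCoord_sq_le (f : BiSeq X →L[ℂ] ℂ) (s : Finset ℤ) :
    ∑ j ∈ s, ‖dualCoord f j‖ ^ 2 ≤ ‖f‖ ^ 2 := by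
  set S := ∑ j ∈ s, ‖dualCoord f j‖ ^ 2 with hS
  have hS0 : 0 ≤ S := Finset.sum_nonneg fun _ _ => sq_nonneg _
  have key : ∀ t : ℝ, 0 < t → t < 1 → t * Real.sqrt S ≤ ‖f‖ := by
    intro t ht0 ht1
    have hx : ∀ j, ∃ x : X, ‖x‖ ≤ 1 ∧ dualCoord f j x = ((‖dualCoord f j x‖ : ℝ) : ℂ) ∧
        t * ‖dualCoord f j‖ ≤ ‖dualCoord f j x‖ := by
      intro j
      rcases (norm_nonneg (dualCoord f j)).eq_or_lt with h0 | h0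
      · exact ⟨0, by simp, by simp, by simp [← h0]⟩
      · obtain ⟨x, hx1, hx2⟩ := (dualCoord f j).exists_lt_apply_of_lt_opNorm
          (show t * ‖dualCoord f j‖ < ‖dualCoord f j‖ by nlinarith)
        have hne : dualCoord f j x ≠ 0 := by
          rw [← norm_pos_iff]; exact (mul_pos ht0 h0).trans hx2
        set c : ℂ := (‖dualCoord f j x‖ : ℂ) / dualCoord f j x with hc
        have hc1 : ‖c‖ = 1 := by
          rw [hc, norm_div, Complex.norm_real, norm_norm, div_self (norm_ne_zero_iff.2 hne)]
        have hcx : dualCoord f j (c • x) = ((‖dualCoord f j x‖ : ℝ) : ℂ) := by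
          rw [map_smul, smul_eq_mul, hc, div_mul_cancel₀ _ hne]
        refine ⟨c • x, ?_, ?_, ?_⟩
        · rw [norm_smul, hc1, one_mul]; exact hx1.le
        · rw [hcx, Complex.norm_real, norm_norm]
        · rw [hcx, Complex.norm_real, norm_norm]; exact hx2.le
    choose x hx1 hx2 hx3 using hx
    set y : BiSeq X := ∑ j ∈ s, lp.singleContinuousLinearMap ℂ (fun _ : ℤ => X) 2 j
      ((‖dualCoord f j‖ : ℂ) • x j) with hy
    have hy1 : ‖y‖ ≤ Real.sqrt S := by
      apply Real.le_sqrt_of_sq_le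
      rw [hy, BiSeq.norm_sum_single_sq (fun j => (‖dualCoord f j‖ : ℂ) • x j) s]
      refine Finset.sum_le_sum fun j _ => ?_
      rw [norm_smul, Complex.norm_real, norm_norm, mul_pow]
      exact mul_le_of_le_one_right (sq_nonneg _) (pow_le_one₀ (norm_nonneg _) (hx1 j))
    have hy2 : f y = ((∑ j ∈ s, ‖dualCoord f j‖ * ‖dualCoord f j (x j)‖ : ℝ) : ℂ) := by
      rw [hy, map_sum, Complex.ofReal_sum]
      refine Finset.sum_congr rfl fun j _ => ?_
      rw [← dualCoord_apply, map_smul, smul_eq_mul, hx2, Complex.ofReal_mul, Complex.norm_real,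
        norm_norm]
    have hy3 : t * S ≤ ‖f y‖ := by
      rw [hy2, Complex.norm_real]
      refine le_trans ?_ (le_abs_self _)
      rw [hS, Finset.mul_sum]
      refine Finset.sum_le_sum fun j _ => ?_
      have := mul_le_mul_of_nonneg_left (hx3 j) (norm_nonneg (dualCoord f j))
      linarith [this, sq (‖dualCoord f j‖)]
    have hy4 : t * S ≤ ‖f‖ * Real.sqrt S :=
      hy3.trans ((f.le_opNorm y).trans (mul_le_mul_of_nonneg_left hy1 (norm_nonneg _)))
    rcases (Real.sqrt_nonneg S).eq_or_lt with h0 | h0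
    · rw [← h0, mul_zero]; exact norm_nonneg _
    · have h5 : Real.sqrt S * Real.sqrt S = S := Real.mul_self_sqrt hS0
      refine le_of_mul_le_mul_right ?_ h0
      rwa [mul_assoc, h5]
  have hle : Real.sqrt S ≤ ‖f‖ := by
    have hlim : Tendsto (fun t : ℝ => t * Real.sqrt S) (𝓝[<] 1) (𝓝 (1 * Real.sqrt S)) :=
      ((continuous_id.mul continuous_const).tendsto 1).mono_left nhdsWithin_le_nhds
    rw [one_mul] at hlim
    refine le_of_tendsto hlim ?_
    filter_upwards [Ioo_mem_nhdsLT (show (0 : ℝ) < 1 by norm_num)] with t ht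
    exact key t ht.1 ht.2
  calc S = Real.sqrt S ^ 2 := (Real.sq_sqrt hS0).symm
    _ ≤ ‖f‖ ^ 2 := pow_le_pow_left₀ (Real.sqrt_nonneg _) hle 2

/-- The isometry of ℓ²(ℤ, X)* into ℓ²(ℤ, X*). It lets the real-valued averaging argument and the
convexity argument run on functionals as on vectors. -/
theorem hasSum_norm_dualCoord_sq (f : BiSeq X →L[ℂ] ℂ) :
    HasSum (fun j => ‖dualCoord f j‖ ^ 2) (‖f‖ ^ 2) := by
  have hsum : Summable fun j => ‖dualCoord f j‖ ^ 2 :=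
    summable_of_sum_le (fun _ => sq_nonneg _) (sum_norm_dualCoord_sq_le f)
  convert hsum.hasSum using 1
  refine le_antisymm ?_ (hsum.tsum_le_of_sum_le (sum_norm_dualCoord_sq_le f))
  set S := ∑' j, ‖dualCoord f j‖ ^ 2 with hS
  have hS0 : 0 ≤ S := tsum_nonneg fun _ => sq_nonneg _
  have hle : ‖f‖ ≤ Real.sqrt S := by
    refine ContinuousLinearMap.opNorm_le_bound _ (Real.sqrt_nonneg _) fun x => ?_
    have hlim := (f.hasSum (BiSeq.hasSum_single x)).norm
    refine le_of_tendsto hlim (Eventually.of_forall fun s => ?_)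
    calc ‖∑ j ∈ s, f (lp.singleContinuousLinearMap ℂ (fun _ : ℤ => X) 2 j (x j))‖
        ≤ ∑ j ∈ s, ‖dualCoord f j‖ * ‖x j‖ :=
          norm_sum_le_of_le _ fun j _ => (dualCoord f j).le_opNorm (x j)
      _ ≤ Real.sqrt (∑ j ∈ s, ‖dualCoord f j‖ ^ 2) * Real.sqrt (∑ j ∈ s, ‖x j‖ ^ 2) :=
          Real.sum_mul_le_sqrt_mul_sqrt _ _ _
      _ ≤ Real.sqrt S * ‖x‖ := by
          refine mul_le_mul (Real.sqrt_le_sqrt ?_) ?_ (Real.sqrt_nonneg _) (Real.sqrt_nonneg _)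
          · exact hsum.sum_le_tsum s fun _ _ => sq_nonneg _
          · rw [Real.sqrt_le_left (norm_nonneg _)]
            exact sum_le_hasSum s (fun _ _ => sq_nonneg _) (BiSeq.hasSum_norm_sq x)
  calc ‖f‖ ^ 2 ≤ Real.sqrt S ^ 2 := pow_le_pow_left₀ (norm_nonneg _) hle 2
    _ = S := Real.sq_sqrt hS0

end Coordinates

/-! ### Complex uniform convexity of `ℓ²` sums -/

section UniformConvexity

variable {Y : Type*} [NormedAddCommGroup Y] [NormedSpace ℂ Y]

/-- The mean of `‖x + ζ y‖²` over the fourth roots of unity `ζ`. -/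
noncomputable def fourMean (x y : Y) : ℝ :=
  (‖x + y‖ ^ 2 + ‖x - y‖ ^ 2 + ‖x + Complex.I • y‖ ^ 2 + ‖x - Complex.I • y‖ ^ 2) / 4

theorem two_mul_norm_sq_le (x y : Y) : 2 * ‖x‖ ^ 2 ≤ ‖x + y‖ ^ 2 + ‖x - y‖ ^ 2 := by
  have h : ‖(2 : ℂ) • x‖ ≤ ‖x + y‖ + ‖x - y‖ := by
    have e : (2 : ℂ) • x = (x + y) + (x - y) := by rw [two_smul]; abel
    rw [e]; exact norm_add_le _ _
  rw [norm_smul, Complex.norm_ofNat] at h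
  nlinarith [norm_nonneg x, norm_nonneg (x + y), norm_nonneg (x - y),
    sq_nonneg (‖x + y‖ - ‖x - y‖)]

theorem two_mul_norm_sq_le' (x y : Y) : 2 * ‖y‖ ^ 2 ≤ ‖x + y‖ ^ 2 + ‖x - y‖ ^ 2 := by
  have := two_mul_norm_sq_le y x
  rwa [add_comm y x, norm_sub_rev y x] at this

theorem norm_sq_le_fourMean (x y : Y) : ‖x‖ ^ 2 ≤ fourMean x y := by
  have h1 := two_mul_norm_sq_le x y
  have h2 := two_mul_norm_sq_le x (Complex.I • y)
  unfold fourMean; linarith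

theorem norm_sq_le_fourMean' (x y : Y) : ‖y‖ ^ 2 ≤ fourMean x y := by
  have h1 := two_mul_norm_sq_le' x y
  have h2 := two_mul_norm_sq_le' x (Complex.I • y)
  rw [norm_smul, Complex.norm_I, one_mul] at h2
  unfold fourMean; linarith

/-- If ‖x - y‖ ≥ ‖x‖, the gain comes from ‖x + y‖ alone; otherwise ‖x + y‖ and ‖x - y‖ differ by at
least τ‖x‖, and the gain comes from their spread. -/
theorem two_mul_norm_sq_add_le {x y : Y} {τ : ℝ} (hτ0 : 0 ≤ τ)
    (h : (1 + τ) * ‖x‖ ≤ ‖x + y‖) :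
    2 * ‖x‖ ^ 2 + τ ^ 2 / 2 * ‖x‖ ^ 2 ≤ ‖x + y‖ ^ 2 + ‖x - y‖ ^ 2 := by
  have hsum : ‖(2 : ℂ) • x‖ ≤ ‖x + y‖ + ‖x - y‖ := by
    have e : (2 : ℂ) • x = (x + y) + (x - y) := by rw [two_smul]; abel
    rw [e]; exact norm_add_le _ _
  rw [norm_smul, Complex.norm_ofNat] at hsum
  set p := ‖x + y‖
  set q := ‖x - y‖
  have hx := norm_nonneg x
  have hq : 0 ≤ q := norm_nonneg _
  rcases le_total ‖x‖ q with h1 | h1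
  · have a1 : ((1 + τ) * ‖x‖) ^ 2 ≤ p ^ 2 := pow_le_pow_left₀ (by positivity) h 2
    have a2 : ‖x‖ ^ 2 ≤ q ^ 2 := pow_le_pow_left₀ hx h1 2
    have a3 : 0 ≤ τ * ‖x‖ ^ 2 := by positivity
    have a4 : 0 ≤ τ ^ 2 * ‖x‖ ^ 2 := by positivity
    nlinarith
  · have a1 : (τ * ‖x‖) ^ 2 ≤ (p - q) ^ 2 := pow_le_pow_left₀ (by positivity) (by linarith) 2
    have a2 : (2 * ‖x‖) ^ 2 ≤ (p + q) ^ 2 := pow_le_pow_left₀ (by positivity) hsum 2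
    nlinarith

/-- Uniform convexity recast as an inequality homogeneous of degree two, which can be summed over
the coordinates of an ℓ² sum. Only intermediate sizes of `y` need convexity: for small `y` the term
with η suffices, and for large `y` the mean dominates ‖y‖². -/
theorem ComplexUniformlyConvex.exists_norm_sq_le (hY : ComplexUniformlyConvex Y) {η : ℝ}
    (hη : 0 < η) : ∃ C : ℝ, 0 < C ∧ ∀ x y : Y,
      ‖y‖ ^ 2 ≤ η * ‖x‖ ^ 2 + C * (fourMean x y - ‖x‖ ^ 2) := by
  obtain ⟨δ, hδ, hconv⟩ := hY (Real.sqrt η / 4) (by positivity)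
  set τ := min (δ / 2) 1 with hτ
  have hτ0 : 0 < τ := lt_min (by linarith) one_pos
  have hτ1 : τ ≤ 1 := min_le_right _ _
  have hτδ : τ < δ := (min_le_left _ _).trans_lt (by linarith)
  -- The 2 serves the case ‖y‖ > 2‖x‖. Otherwise ‖y‖² ≤ 4‖x‖², and the mean gains τ²/8 · ‖x‖²,
  -- whence 32/τ².
  refine ⟨2 + 32 / τ ^ 2, by positivity, fun x y => ?_⟩
  have hm := norm_sq_le_fourMean x y
  have hm' := norm_sq_le_fourMean' x y
  have hC : 0 < 32 / τ ^ 2 := by positivity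
  rcases le_or_gt (‖y‖ ^ 2) (η * ‖x‖ ^ 2) with h1 | h1
  · have : 0 ≤ (2 + 32 / τ ^ 2) * (fourMean x y - ‖x‖ ^ 2) :=
      mul_nonneg (by positivity) (by linarith)
    linarith
  have hη' : 0 ≤ η * ‖x‖ ^ 2 := by positivity
  rcases le_or_gt ‖y‖ (2 * ‖x‖) with h2 | h2
  swap
  · have : (2 * ‖x‖) ^ 2 ≤ ‖y‖ ^ 2 := pow_le_pow_left₀ (by positivity) h2.le 2
    have : 0 ≤ 32 / τ ^ 2 * (fourMean x y - ‖x‖ ^ 2) := mul_nonneg hC.le (by linarith)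
    nlinarith
  have hx0 : 0 < ‖x‖ := by
    rcases (norm_nonneg x).eq_or_lt with h0 | h0
    · rw [← h0] at h1 h2
      have : ‖y‖ = 0 := le_antisymm (by linarith) (norm_nonneg _)
      rw [this] at h1; simp at h1
    · exact h0
  have hy : Real.sqrt η * ‖x‖ ≤ ‖y‖ := by
    have : Real.sqrt (η * ‖x‖ ^ 2) ≤ ‖y‖ := Real.sqrt_le_iff.2 ⟨norm_nonneg _, h1.le⟩
    rwa [Real.sqrt_mul hη.le, Real.sqrt_sq hx0.le] at this
  -- If all four points lay in the ball of radius ρ = (1 + τ)‖x‖, so would the disc x + ζ y/2, |ζ| ≤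
  -- 1, by taking midpoints. After division by ρ, convexity gives ‖x‖ ≤ (1 - δ)ρ, impossible since
  -- (1 - δ)(1 + τ) < 1. The relative size of y/2 is at least √η/4 because τ ≤ 1.
  have hbig : (1 + τ) * ‖x‖ ≤ ‖x + y‖ ∨ (1 + τ) * ‖x‖ ≤ ‖x - y‖ ∨
      (1 + τ) * ‖x‖ ≤ ‖x + Complex.I • y‖ ∨ (1 + τ) * ‖x‖ ≤ ‖x - Complex.I • y‖ := by
    by_contra! hcon
    obtain ⟨g1, g2, g3, g4⟩ := hcon
    set ρ := (1 + τ) * ‖x‖ with hρ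
    have hρ0 : 0 < ρ := by positivity
    have hseg : ∀ (u : Y), ‖x + u‖ < ρ → ‖x - u‖ < ρ → ∀ a : ℝ, |a| ≤ 1 →
        ‖x + (a : ℂ) • u‖ ≤ ρ := by
      intro u hu1 hu2 a ha
      rw [abs_le] at ha
      have e : x + (a : ℂ) • u = (((1 + a) / 2 : ℝ) : ℂ) • (x + u)
          + (((1 - a) / 2 : ℝ) : ℂ) • (x - u) := by
        push_cast
        module
      rw [e]
      refine (norm_add_le _ _).trans ?_
      rw [norm_smul, norm_smul, Complex.norm_real, Complex.norm_real, Real.norm_eq_abs,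
        Real.norm_eq_abs, abs_of_nonneg (by linarith), abs_of_nonneg (by linarith)]
      nlinarith
    have hdisc : ∀ ζ : ℂ, ‖ζ‖ ≤ 1 → ‖x + ζ • ((1 / 2 : ℂ) • y)‖ ≤ ρ := by
      intro ζ hζ
      have k1 := hseg y g1 g2 ζ.re ((Complex.abs_re_le_norm ζ).trans hζ)
      have k2 := hseg (Complex.I • y) g3 g4 ζ.im ((Complex.abs_im_le_norm ζ).trans hζ)
      have e : x + ζ • ((1 / 2 : ℂ) • y) = (1 / 2 : ℂ) • ((x + (ζ.re : ℂ) • y)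
          + (x + (ζ.im : ℂ) • (Complex.I • y))) := by
        conv_lhs => rw [← Complex.re_add_im ζ]
        module
      rw [e, norm_smul]
      have := norm_add_le (x + (ζ.re : ℂ) • y) (x + (ζ.im : ℂ) • (Complex.I • y))
      rw [show ‖(1 / 2 : ℂ)‖ = 1 / 2 by norm_num]
      linarith
    have hfin := hconv ((ρ⁻¹ : ℂ) • x) ((ρ⁻¹ : ℂ) • ((1 / 2 : ℂ) • y)) ?_ ?_
    · rw [norm_smul, norm_inv, Complex.norm_real, Real.norm_eq_abs, abs_of_pos hρ0,
        inv_mul_eq_div, div_le_iff₀ hρ0] at hfin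
      have : ‖x‖ * ((1 - δ) * (1 + τ)) < ‖x‖ * 1 := by
        apply mul_lt_mul_of_pos_left _ hx0
        nlinarith
      nlinarith
    · rw [norm_smul, norm_smul, norm_inv, Complex.norm_real, Real.norm_eq_abs, abs_of_pos hρ0,
        inv_mul_eq_div, le_div_iff₀ hρ0]
      have e2 : ‖(1 / 2 : ℂ)‖ = 1 / 2 := by norm_num
      rw [e2]
      have : Real.sqrt η * ((1 + τ) * ‖x‖) ≤ 2 * (Real.sqrt η * ‖x‖) := by
        have : 0 ≤ Real.sqrt η * ‖x‖ := by positivity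
        nlinarith
      linarith
    · intro ζ hζ
      rw [smul_comm ζ, ← smul_add, norm_smul, norm_inv, Complex.norm_real, Real.norm_eq_abs,
        abs_of_pos hρ0, inv_mul_eq_div, div_le_one hρ0]
      exact hdisc ζ hζ
  have hgain : ‖x‖ ^ 2 + τ ^ 2 / 8 * ‖x‖ ^ 2 ≤ fourMean x y := by
    have b1 := two_mul_norm_sq_le x y
    have b2 := two_mul_norm_sq_le x (Complex.I • y)
    unfold fourMean
    rcases hbig with g | g | g | g
    · have := two_mul_norm_sq_add_le hτ0.le g
      linarith
    · have := two_mul_norm_sq_add_le (y := -y) hτ0.le (by rwa [← sub_eq_add_neg])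
      rw [← sub_eq_add_neg, sub_neg_eq_add] at this
      linarith
    · have := two_mul_norm_sq_add_le hτ0.le g
      linarith
    · have := two_mul_norm_sq_add_le (y := -(Complex.I • y)) hτ0.le (by rwa [← sub_eq_add_neg])
      rw [← sub_eq_add_neg, sub_neg_eq_add] at this
      linarith
  have hy4 : ‖y‖ ^ 2 ≤ 4 * ‖x‖ ^ 2 := by
    have := pow_le_pow_left₀ (norm_nonneg y) h2 2
    linarith [mul_pow 2 ‖x‖ 2]
  have hq : 4 * ‖x‖ ^ 2 = 32 / τ ^ 2 * (τ ^ 2 / 8 * ‖x‖ ^ 2) := by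
    field_simp; norm_num
  have : 32 / τ ^ 2 * (τ ^ 2 / 8 * ‖x‖ ^ 2) ≤ 32 / τ ^ 2 * (fourMean x y - ‖x‖ ^ 2) :=
    mul_le_mul_of_nonneg_left (by linarith) hC.le
  nlinarith

/-- The quadratic inequality with η = ε²/2 is summed over the coordinates. On the unit ball the
η-term absorbs half of ‖v‖² ≥ ε², and the rest bounds 1 - ‖u‖² from below. -/
theorem ComplexUniformlyConvex.of_hasSum {V : Type*} [NormedAddCommGroup V] [NormedSpace ℂ V]
    (hY : ComplexUniformlyConvex Y) (π : ℤ → V →ₗ[ℂ] Y)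
    (hπ : ∀ v, HasSum (fun j => ‖π j v‖ ^ 2) (‖v‖ ^ 2)) : ComplexUniformlyConvex V := by
  intro ε hε
  obtain ⟨C, hC, hle⟩ := hY.exists_norm_sq_le (show 0 < ε ^ 2 / 2 by positivity)
  refine ⟨ε ^ 2 / (4 * C), by positivity, fun u v hv huv => ?_⟩
  have hmean : HasSum (fun j => fourMean (π j u) (π j v)) (fourMean u v) := by
    unfold fourMean
    have h1 := hπ (u + v)
    have h2 := hπ (u - v)
    have h3 := hπ (u + Complex.I • v)
    have h4 := hπ (u - Complex.I • v)
    simp only [map_add, map_sub, map_smul] at h1 h2 h3 h4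
    exact (((h1.add h2).add h3).add h4).div_const 4
  have hsum : ‖v‖ ^ 2 ≤ ε ^ 2 / 2 * ‖u‖ ^ 2 + C * (fourMean u v - ‖u‖ ^ 2) :=
    hasSum_le (fun j => hle (π j u) (π j v)) (hπ v)
      (((hπ u).mul_left _).add ((hmean.sub (hπ u)).mul_left C))
  have sq_le : ∀ ζ : ℂ, ‖ζ‖ ≤ 1 → ‖u + ζ • v‖ ^ 2 ≤ 1 := fun ζ hζ =>
    pow_le_one₀ (norm_nonneg _) (huv ζ hζ)
  have a1 := sq_le 1 (by simp)
  have a2 := sq_le (-1) (by simp)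
  have a3 := sq_le Complex.I (by simp)
  have a4 := sq_le (-Complex.I) (by simp)
  have a0 := huv 0 (by simp)
  rw [zero_smul, add_zero] at a0
  rw [one_smul] at a1
  rw [neg_smul, one_smul, ← sub_eq_add_neg] at a2
  rw [neg_smul, ← sub_eq_add_neg] at a4
  have hm : fourMean u v ≤ 1 := by unfold fourMean; linarith
  have hu0 := norm_nonneg u
  have hv2 : ε ^ 2 ≤ ‖v‖ ^ 2 := pow_le_pow_left₀ hε.le hv 2
  have hu2 : ‖u‖ ^ 2 ≤ 1 := pow_le_one₀ hu0 a0
  have h5 : ε ^ 2 / 2 ≤ C * (1 - ‖u‖ ^ 2) := by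
    have : C * (fourMean u v - ‖u‖ ^ 2) ≤ C * (1 - ‖u‖ ^ 2) :=
      mul_le_mul_of_nonneg_left (by linarith) hC.le
    have : ε ^ 2 / 2 * ‖u‖ ^ 2 ≤ ε ^ 2 / 2 := mul_le_of_le_one_right (by positivity) hu2
    linarith
  have h6 : C * (1 - ‖u‖ ^ 2) ≤ C * (2 * (1 - ‖u‖)) :=
    mul_le_mul_of_nonneg_left (by nlinarith) hC.le
  have h7 : ε ^ 2 / (4 * C) ≤ 1 - ‖u‖ := by
    rw [div_le_iff₀ (by positivity)]; linarith
  linarith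

variable {X : Type*} [NormedAddCommGroup X] [NormedSpace ℂ X]

theorem ComplexUniformlyConvex.biSeq (hX : ComplexUniformlyConvex X) :
    ComplexUniformlyConvex (BiSeq X) :=
  hX.of_hasSum (fun j => (lp.evalCLM ℂ (fun _ : ℤ => X) 2 j).toLinearMap) BiSeq.hasSum_norm_sq

theorem ComplexUniformlyConvex.dual_biSeq (hX : ComplexUniformlyConvex (X →L[ℂ] ℂ)) :
    ComplexUniformlyConvex (BiSeq X →L[ℂ] ℂ) :=
  hX.of_hasSum (fun j =>
    { toFun := fun f => dualCoord f j, map_add' := fun _ _ => rfl, map_smul' := fun _ _ => rfl })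
    hasSum_norm_dualCoord_sq

end UniformConvexity

/-! ### Finite sections as compressions -/

section Sections

variable {X : Type*} [NormedAddCommGroup X] [NormedSpace ℂ X]

/-- The embedding of `Xⁿ` into `ℓ²(ℤ, X)` at the positions `k+1, …, k+n`. -/
noncomputable def windowEmbed (X : Type*) [NormedAddCommGroup X] [NormedSpace ℂ X] (n : ℕ) (k : ℤ) :
    PiLp 2 (fun _ : Fin n => X) →L[ℂ] BiSeq X :=
  ∑ i : Fin n, (lp.singleContinuousLinearMap ℂ (fun _ : ℤ => X) 2 (k + 1 + (i : ℤ))).comp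
    (PiLp.proj 2 (fun _ : Fin n => X) i)

/-- The restriction of a sequence to the positions `k+1, …, k+n`. -/
noncomputable def windowRestrict (X : Type*) [NormedAddCommGroup X] [NormedSpace ℂ X] (n : ℕ)
    (k : ℤ) : BiSeq X →L[ℂ] PiLp 2 (fun _ : Fin n => X) :=
  ((PiLp.continuousLinearEquiv 2 ℂ (fun _ : Fin n => X)).symm :
      (Fin n → X) →L[ℂ] PiLp 2 (fun _ : Fin n => X)).comp
    (ContinuousLinearMap.pi fun i : Fin n => lp.evalCLM ℂ (fun _ : ℤ => X) 2 (k + 1 + (i : ℤ)))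

/-- Multiplication by `c` on the positions `k+1, …, k+n` and by `0` elsewhere. -/
noncomputable def windowMul (X : Type*) [NormedAddCommGroup X] [NormedSpace ℂ X] (c : ℤ → ℂ) (n : ℕ)
    (k : ℤ) : BiSeq X →L[ℂ] BiSeq X :=
  ∑ i : Fin n, c (k + 1 + (i : ℤ)) •
    (lp.singleContinuousLinearMap ℂ (fun _ : ℤ => X) 2 (k + 1 + (i : ℤ))).comp
      (lp.evalCLM ℂ (fun _ : ℤ => X) 2 (k + 1 + (i : ℤ)))

theorem windowRestrict_apply (n : ℕ) (k : ℤ) (x : BiSeq X) (i : Fin n) :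
    windowRestrict X n k x i = x (k + 1 + (i : ℤ)) := rfl

theorem BiSeq.sum_apply {ι : Type*} (s : Finset ι) (f : ι → BiSeq X) (j : ℤ) :
    (∑ i ∈ s, f i : BiSeq X) j = ∑ i ∈ s, f i j :=
  map_sum (lp.evalCLM ℂ (fun _ : ℤ => X) 2 j) f s

theorem windowEmbed_apply (n : ℕ) (k : ℤ) (y : PiLp 2 (fun _ : Fin n => X)) :
    windowEmbed X n k y = ∑ i : Fin n,
      lp.singleContinuousLinearMap ℂ (fun _ : ℤ => X) 2 (k + 1 + (i : ℤ)) (y i) := by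
  simp [windowEmbed]

theorem windowEmbed_apply_mem (n : ℕ) (k : ℤ) (y : PiLp 2 (fun _ : Fin n => X)) (i : Fin n) :
    windowEmbed X n k y (k + 1 + (i : ℤ)) = y i := by
  rw [windowEmbed_apply, BiSeq.sum_apply, Finset.sum_eq_single i]
  · rw [BiSeq.single_apply, if_pos rfl]
  · intro j _ hj
    rw [BiSeq.single_apply, if_neg]
    intro h
    exact hj (Fin.ext (by omega))
  · intro h; exact absurd (Finset.mem_univ _) h

theorem windowMul_apply_mem (c : ℤ → ℂ) (n : ℕ) (k : ℤ) (x : BiSeq X) {j : ℤ} (h1 : k + 1 ≤ j)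
    (h2 : j ≤ k + n) : windowMul X c n k x j = c j • x j := by
  obtain ⟨i, hi⟩ : ∃ i : Fin n, k + 1 + (i : ℤ) = j :=
    ⟨⟨(j - k - 1).toNat, by omega⟩, by simp only; omega⟩
  subst hi
  simp only [windowMul, FunLike.coe_sum, Finset.sum_apply, BiSeq.sum_apply]
  rw [Finset.sum_eq_single i]
  · show (c _ • lp.singleContinuousLinearMap ℂ (fun _ : ℤ => X) 2 _ _ : BiSeq X) _ = _
    rw [lp.coeFn_smul, Pi.smul_apply, BiSeq.single_apply, if_pos rfl]
    rfl
  · intro j _ hj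
    show (c _ • lp.singleContinuousLinearMap ℂ (fun _ : ℤ => X) 2 _ _ : BiSeq X) _ = _
    rw [lp.coeFn_smul, Pi.smul_apply, BiSeq.single_apply, if_neg, smul_zero]
    intro h
    exact hj (Fin.ext (by omega))
  · intro h; exact absurd (Finset.mem_univ _) h

theorem windowMul_apply_notMem (c : ℤ → ℂ) (n : ℕ) (k : ℤ) (x : BiSeq X) {j : ℤ}
    (h : ¬ (k + 1 ≤ j ∧ j ≤ k + n)) : windowMul X c n k x j = 0 := by
  simp only [windowMul, FunLike.coe_sum, Finset.sum_apply, BiSeq.sum_apply]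
  refine Finset.sum_eq_zero fun i _ => ?_
  show (c _ • lp.singleContinuousLinearMap ℂ (fun _ : ℤ => X) 2 _ _ : BiSeq X) _ = _
  rw [lp.coeFn_smul, Pi.smul_apply, BiSeq.single_apply, if_neg, smul_zero]
  omega

theorem windowEmbed_restrict (n : ℕ) (k : ℤ) (x : BiSeq X) :
    windowEmbed X n k (windowRestrict X n k x) = windowMul X 1 n k x := by
  rw [windowEmbed_apply]
  simp only [windowMul, FunLike.coe_sum, Finset.sum_apply]
  refine Finset.sum_congr rfl fun i _ => ?_
  simp [windowRestrict_apply]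
  rfl

theorem windowRestrict_embed (n : ℕ) (k : ℤ) (y : PiLp 2 (fun _ : Fin n => X)) :
    windowRestrict X n k (windowEmbed X n k y) = y := by
  ext i
  rw [windowRestrict_apply, windowEmbed_apply_mem]

theorem sum_window (n : ℕ) (k : ℤ) (g : ℤ → ℝ) :
    ∑ i : Fin n, g (k + 1 + (i : ℤ)) = ∑ i ∈ Finset.range n, g (k + 1 + i) :=
  (Finset.sum_range (fun i : ℕ => g (k + 1 + i))).symm

theorem HasSum.eq_sum_window {g : ℤ → ℝ} {S : ℝ} (h : HasSum g S) (n : ℕ) (k : ℤ)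
    (h0 : ∀ j, ¬ (k + 1 ≤ j ∧ j ≤ k + n) → g j = 0) :
    S = ∑ i ∈ Finset.range n, g (k + 1 + i) := by
  have hinj : Function.Injective fun i : ℕ => k + 1 + (i : ℤ) := fun a b hab => by
    simp only at hab; omega
  have h2 : HasSum g (∑ j ∈ (Finset.range n).map ⟨_, hinj⟩, g j) := by
    refine hasSum_sum_of_ne_finset_zero fun j hj => h0 j fun hj' => hj ?_
    rw [Finset.mem_map]
    exact ⟨(j - k - 1).toNat, Finset.mem_range.2 (by omega), by
      simp only [Function.Embedding.coeFn_mk]; omega⟩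
  rw [h.unique h2, Finset.sum_map]
  rfl

theorem norm_windowRestrict_sq (n : ℕ) (k : ℤ) (x : BiSeq X) :
    ‖windowRestrict X n k x‖ ^ 2 = ∑ i ∈ Finset.range n, ‖x (k + 1 + i)‖ ^ 2 := by
  rw [PiLp.norm_sq_eq_of_L2, ← sum_window n k (fun j => ‖x j‖ ^ 2)]
  rfl

theorem norm_windowRestrict_apply_le (n : ℕ) (k : ℤ) (x : BiSeq X) :
    ‖windowRestrict X n k x‖ ≤ ‖x‖ := by
  refine le_of_sq_le_sq ?_ (norm_nonneg _)
  rw [norm_windowRestrict_sq]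
  have hinj : Function.Injective fun i : ℕ => k + 1 + (i : ℤ) := fun a b hab => by
    simp only at hab; omega
  have := sum_le_hasSum ((Finset.range n).map ⟨_, hinj⟩) (fun _ _ => sq_nonneg _)
    (BiSeq.hasSum_norm_sq x)
  rwa [Finset.sum_map] at this

theorem norm_windowEmbed_apply (n : ℕ) (k : ℤ) (y : PiLp 2 (fun _ : Fin n => X)) :
    ‖windowEmbed X n k y‖ = ‖y‖ := by
  have h := (BiSeq.hasSum_norm_sq (windowEmbed X n k y)).eq_sum_window n k fun j hj => by
    rw [← windowRestrict_embed n k y, windowEmbed_restrict, windowMul_apply_notMem _ _ _ _ hj]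
    simp
  rw [← norm_windowRestrict_sq, windowRestrict_embed] at h
  exact (pow_left_inj₀ (norm_nonneg _) (norm_nonneg _) two_ne_zero).1 h

theorem norm_windowRestrict_le (n : ℕ) (k : ℤ) : ‖windowRestrict X n k‖ ≤ 1 :=
  ContinuousLinearMap.opNorm_le_bound _ zero_le_one fun x => by
    rw [one_mul]; exact norm_windowRestrict_apply_le n k x

theorem norm_windowEmbed_le (n : ℕ) (k : ℤ) : ‖windowEmbed X n k‖ ≤ 1 :=
  ContinuousLinearMap.opNorm_le_bound _ zero_le_one fun x => by
    rw [one_mul, norm_windowEmbed_apply]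

theorem finiteSection_eq (A : BiSeq X →L[ℂ] BiSeq X) (n : ℕ) (k : ℤ) :
    finiteSection A n k = (windowRestrict X n k).comp (A.comp (windowEmbed X n k)) := by
  ext y i
  show (∑ j : Fin n, (matrixEntry A (k + 1 + (i : ℤ)) (k + 1 + (j : ℤ))).comp
        (PiLp.proj 2 (fun _ : Fin n => X) j)) y = A (windowEmbed X n k y) (k + 1 + (i : ℤ))
  rw [windowEmbed_apply, map_sum, BiSeq.sum_apply]
  simp only [FunLike.coe_sum, Finset.sum_apply]
  rfl

theorem finiteSection_sub_smul (A : BiSeq X →L[ℂ] BiSeq X) (n : ℕ) (k : ℤ) (z : ℂ) :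
    finiteSection A n k - z • ContinuousLinearMap.id ℂ _ =
      (windowRestrict X n k).comp ((A - z • ContinuousLinearMap.id ℂ _).comp (windowEmbed X n k)) := by
  rw [finiteSection_eq]
  ext y : 1
  show windowRestrict X n k (A (windowEmbed X n k y)) - z • y =
    windowRestrict X n k (A (windowEmbed X n k y) - z • windowEmbed X n k y)
  rw [map_sub, map_smul, windowRestrict_embed]

theorem matrixEntry_sub_smul (A : BiSeq X →L[ℂ] BiSeq X) (z : ℂ) {i j : ℤ} (h : i ≠ j) :
    matrixEntry (A - z • ContinuousLinearMap.id ℂ _) i j = matrixEntry A i j := by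
  ext x
  rw [matrixEntry_apply, matrixEntry_apply]
  show A _ i - z • (lp.singleContinuousLinearMap ℂ (fun _ : ℤ => X) 2 j x : BiSeq X) i = _
  rw [BiSeq.single_apply, if_neg h, smul_zero, sub_zero]

theorem IsTridiagonal.sub_smul {A : BiSeq X →L[ℂ] BiSeq X} (hA : IsTridiagonal A) (z : ℂ) :
    IsTridiagonal (A - z • ContinuousLinearMap.id ℂ _) := by
  intro i j hij
  rw [matrixEntry_sub_smul, hA i j hij]
  rintro rfl
  simp at hij

end Sections

/-! ### Pseudospectra are contained in those of the finite sections -/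

section Truncation

variable {X : Type*} [NormedAddCommGroup X] [NormedSpace ℂ X]

instance nontrivial_piLp_fin {n : ℕ} [NeZero n] [Nontrivial X] :
    Nontrivial (PiLp 2 (fun _ : Fin n => X)) := by
  obtain ⟨x, hx⟩ := exists_ne (0 : X)
  refine ⟨WithLp.toLp 2 (fun _ => x), 0, fun h => hx ?_⟩
  exact congrArg (fun y : PiLp 2 (fun _ : Fin n => X) => y 0) h

instance nontrivial_biSeq [Nontrivial X] : Nontrivial (BiSeq X) := by
  obtain ⟨x, hx⟩ := exists_ne (0 : X)
  refine ⟨lp.singleContinuousLinearMap ℂ (fun _ : ℤ => X) 2 0 x, 0, fun h => hx ?_⟩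
  have := BiSeq.single_apply 0 0 x
  rw [h, if_pos rfl] at this
  exact this.symm

variable {A : BiSeq X →L[ℂ] BiSeq X}

theorem norm_matrixEntry_sub_one_le (z : ℂ) (j : ℤ) :
    ‖matrixEntry (A - z • ContinuousLinearMap.id ℂ _) j (j - 1)‖ ≤ subdiagNorm A := by
  rw [matrixEntry_sub_smul _ _ (by omega)]
  have := norm_entry_le_subdiagNorm A (j - 1)
  rwa [sub_add_cancel] at this

theorem norm_matrixEntry_add_one_le (z : ℂ) (j : ℤ) :
    ‖matrixEntry (A - z • ContinuousLinearMap.id ℂ _) j (j + 1)‖ ≤ superdiagNorm A := by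
  rw [matrixEntry_sub_smul _ _ (by omega)]
  have := norm_entry_le_superdiagNorm A (j + 1)
  rwa [add_sub_cancel_right] at this

theorem windowMul_apply_of_support {w : ℤ → ℝ} {n : ℕ} (hw : ∀ i, ¬ (1 ≤ i ∧ i ≤ (n : ℤ)) → w i = 0)
    (k : ℤ) (x : BiSeq X) (j : ℤ) :
    windowMul X (fun j => (w (j - k) : ℂ)) n k x j = (w (j - k) : ℂ) • x j := by
  by_cases h : k + 1 ≤ j ∧ j ≤ k + n
  · exact windowMul_apply_mem _ _ _ _ h.1 h.2
  · rw [windowMul_apply_notMem _ _ _ _ h, hw _ (by omega), Complex.ofReal_zero, zero_smul]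

/-- The test vector for the section is `x` times the sliding weights; the averaging lemma finds a
window where the truncation error is affordable. -/
theorem inverseGap_finiteSection_lt_of_vector [Nontrivial X] (hA : IsTridiagonal A) {n : ℕ}
    {w : ℤ → ℝ} {φ μ ε κ : ℝ} {z : ℂ} {x : BiSeq X}
    (hφ0 : 0 < φ) (hφ1 : φ < 1) (hws : ∀ i, ¬ (1 ≤ i ∧ i ≤ (n : ℤ)) → w i = 0)
    (hw : ∑ i ∈ Finset.range n, ((1 - φ) * (w (i + 1 + 1) - w (i + 1)) ^ 2
        + φ * (w (i + 1) - w i) ^ 2) = μ ^ 2 * ∑ i ∈ Finset.range n, w (i + 1) ^ 2)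
    (hwpos : 0 < ∑ i ∈ Finset.range n, w (i + 1) ^ 2) (hε : 0 < ε) (hκ : 0 < κ)
    (hμ : (subdiagNorm A ^ 2 / φ + superdiagNorm A ^ 2 / (1 - φ)) * μ ^ 2 ≤ κ ^ 2)
    (hx : ‖(A - z • ContinuousLinearMap.id ℂ (BiSeq X)) x‖ < ε * ‖x‖) :
    ∃ k : ℤ, inverseGap (finiteSection A n k - z • ContinuousLinearMap.id ℂ _) < ε + κ := by
  set B := A - z • ContinuousLinearMap.id ℂ _ with hB
  have hBt : IsTridiagonal B := hA.sub_smul z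
  have hxy : ‖B x‖ ^ 2 < ε ^ 2 * ‖x‖ ^ 2 := by
    rw [← mul_pow]; exact pow_lt_pow_left₀ hx (norm_nonneg _) two_ne_zero
  obtain ⟨k, hk⟩ := exists_window (BiSeq.hasSum_norm_sq x) (BiSeq.hasSum_norm_sq (B x))
    hφ0 hφ1 hw hwpos hε hκ hμ hxy
  refine ⟨k, ?_⟩
  set W := windowMul X (fun j => (w (j - k) : ℂ)) n k with hW
  set y := windowRestrict X n k (W x) with hy
  have hJy : windowEmbed X n k y = W x := by
    rw [hy, windowEmbed_restrict]
    apply lp.ext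
    ext j
    by_cases h : k + 1 ≤ j ∧ j ≤ k + n
    · rw [windowMul_apply_mem _ _ _ _ h.1 h.2, Pi.one_apply, one_smul]
    · rw [windowMul_apply_notMem _ _ _ _ h, hW, windowMul_apply_notMem _ _ _ _ h]
  have hny : ‖y‖ ^ 2 = ∑ i ∈ Finset.range n, w (i + 1) ^ 2 * ‖x (k + 1 + i)‖ ^ 2 := by
    rw [hy, norm_windowRestrict_sq]
    refine Finset.sum_congr rfl fun i _ => ?_
    rw [hW, windowMul_apply_of_support hws, norm_smul, mul_pow, Complex.norm_real, Real.norm_eq_abs,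
      sq_abs, show k + 1 + (i : ℤ) - k = i + 1 by ring]
  have hrow : ∀ i : ℕ, ‖B (W x) (k + 1 + i)‖ ≤ |w (i + 1)| * ‖B x (k + 1 + i)‖
        + (subdiagNorm A * |w (i + 1) - w i| * ‖x (k + 1 + i - 1)‖
          + superdiagNorm A * |w (i + 1 + 1) - w (i + 1)| * ‖x (k + 1 + i + 1)‖) := by
    intro i
    set j : ℤ := k + 1 + i with hj
    -- Commuting `B` with the weights: the diagonal entry drops out, and each off-diagonal entry is
    -- multiplied by a difference of neighbouring weights.
    have e : B (W x) j = (w (i + 1) : ℂ) • B x j +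
        (((w i - w (i + 1) : ℝ) : ℂ) • matrixEntry B j (j - 1) (x (j - 1))
        + ((w (i + 1 + 1) - w (i + 1) : ℝ) : ℂ) • matrixEntry B j (j + 1) (x (j + 1))) := by
      rw [hBt.apply_eq (W x), hBt.apply_eq x, hW, windowMul_apply_of_support hws,
        windowMul_apply_of_support hws, windowMul_apply_of_support hws,
        show j - 1 - k = i by omega, show j - k = i + 1 by omega,
        show j + 1 - k = i + 1 + 1 by omega, map_smul, map_smul, map_smul]
      push_cast
      module
    rw [e]
    refine (norm_add_le _ _).trans (add_le_add ?_ ((norm_add_le _ _).trans (add_le_add ?_ ?_)))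
    · rw [norm_smul, Complex.norm_real, Real.norm_eq_abs]
    · rw [norm_smul, Complex.norm_real, Real.norm_eq_abs, abs_sub_comm, mul_comm (subdiagNorm A),
        mul_assoc]
      refine mul_le_mul_of_nonneg_left ?_ (abs_nonneg _)
      exact (ContinuousLinearMap.le_opNorm _ _).trans
        (mul_le_mul_of_nonneg_right (norm_matrixEntry_sub_one_le z j) (norm_nonneg _))
    · rw [norm_smul, Complex.norm_real, Real.norm_eq_abs, mul_comm (superdiagNorm A), mul_assoc]
      refine mul_le_mul_of_nonneg_left ?_ (abs_nonneg _)
      exact (ContinuousLinearMap.le_opNorm _ _).trans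
        (mul_le_mul_of_nonneg_right (norm_matrixEntry_add_one_le z j) (norm_nonneg _))
  have hsec : ‖(finiteSection A n k - z • ContinuousLinearMap.id ℂ (PiLp 2 fun _ : Fin n => X)) y‖ ^ 2
      < (ε + κ) ^ 2 * ‖y‖ ^ 2 := by
    rw [finiteSection_sub_smul, hny]
    refine lt_of_le_of_lt ?_ hk
    show ‖windowRestrict X n k (B (windowEmbed X n k y))‖ ^ 2 ≤ _
    rw [hJy, norm_windowRestrict_sq]
    exact Finset.sum_le_sum fun i _ => pow_le_pow_left₀ (norm_nonneg _) (hrow i) 2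
  have h1 := inverseGap_mul_norm_le (finiteSection A n k - z • ContinuousLinearMap.id ℂ _) y
  by_contra! hcon
  have h2 : (ε + κ) * ‖y‖ ≤ ‖(finiteSection A n k - z • ContinuousLinearMap.id ℂ (PiLp 2 fun _ : Fin n => X)) y‖ :=
    (mul_le_mul_of_nonneg_right hcon (norm_nonneg _)).trans h1
  have h3 := pow_le_pow_left₀ (by positivity) h2 2
  rw [mul_pow] at h3
  linarith

/-- The transposed argument, by columns instead of rows. Transposition swaps the sub- and
superdiagonal, which is why their norms are exchanged in `hμ`. -/
theorem inverseGap_finiteSection_lt_of_functional [Nontrivial X] (hA : IsTridiagonal A) {n : ℕ}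
    {w : ℤ → ℝ} {φ μ ε κ : ℝ} {z : ℂ} {f : BiSeq X →L[ℂ] ℂ}
    (hφ0 : 0 < φ) (hφ1 : φ < 1) (hws : ∀ i, ¬ (1 ≤ i ∧ i ≤ (n : ℤ)) → w i = 0)
    (hw : ∑ i ∈ Finset.range n, ((1 - φ) * (w (i + 1 + 1) - w (i + 1)) ^ 2
        + φ * (w (i + 1) - w i) ^ 2) = μ ^ 2 * ∑ i ∈ Finset.range n, w (i + 1) ^ 2)
    (hwpos : 0 < ∑ i ∈ Finset.range n, w (i + 1) ^ 2) (hε : 0 < ε) (hκ : 0 < κ)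
    (hμ : (superdiagNorm A ^ 2 / φ + subdiagNorm A ^ 2 / (1 - φ)) * μ ^ 2 ≤ κ ^ 2)
    (hf : ‖f.comp (A - z • ContinuousLinearMap.id ℂ _)‖ < ε * ‖f‖) :
    ∃ k : ℤ, inverseGap (finiteSection A n k - z • ContinuousLinearMap.id ℂ _) < ε + κ := by
  set B := A - z • ContinuousLinearMap.id ℂ _ with hB
  have hBt : IsTridiagonal B := hA.sub_smul z
  have hxy : ‖f.comp B‖ ^ 2 < ε ^ 2 * ‖f‖ ^ 2 := by
    rw [← mul_pow]; exact pow_lt_pow_left₀ hf (norm_nonneg _) two_ne_zero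
  obtain ⟨k, hk⟩ := exists_window (hasSum_norm_dualCoord_sq f)
    (hasSum_norm_dualCoord_sq (f.comp B)) hφ0 hφ1 hw hwpos hε hκ hμ hxy
  refine ⟨k, ?_⟩
  set W := windowMul X (fun j => (w (j - k) : ℂ)) n k with hW
  set P := windowMul X 1 n k with hP
  have hWP : ∀ x, W (P x) = W x := by
    intro x
    apply lp.ext
    ext j
    by_cases h : k + 1 ≤ j ∧ j ≤ k + n
    · rw [hW, windowMul_apply_mem _ _ _ _ h.1 h.2, windowMul_apply_mem _ _ _ _ h.1 h.2,
        windowMul_apply_mem _ _ _ _ h.1 h.2, Pi.one_apply, one_smul]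
    · rw [hW, windowMul_apply_notMem _ _ _ _ h, windowMul_apply_notMem _ _ _ _ h]
  have hWs : ∀ (j : ℤ) (x : X), W (lp.singleContinuousLinearMap ℂ (fun _ : ℤ => X) 2 j x)
      = (w (j - k) : ℂ) • lp.singleContinuousLinearMap ℂ (fun _ : ℤ => X) 2 j x := by
    intro j x
    apply lp.ext
    ext i
    rw [hW, windowMul_apply_of_support hws, lp.coeFn_smul, Pi.smul_apply, BiSeq.single_apply]
    by_cases h : i = j
    · rw [h]
    · rw [if_neg h, smul_zero, smul_zero]
  -- The weighted functional viewed on Xⁿ. No norm is lost, since `f.comp W` factors through the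
  -- restriction to the window.
  set G := (f.comp W).comp (windowEmbed X n k) with hG
  have hGQ : G.comp (windowRestrict X n k) = f.comp W := by
    ext x
    show f (W (windowEmbed X n k (windowRestrict X n k x))) = f (W x)
    rw [windowEmbed_restrict, hWP]
  have hG1 : ‖f.comp W‖ ≤ ‖G‖ := by
    rw [← hGQ]
    refine (ContinuousLinearMap.opNorm_comp_le _ _).trans ?_
    exact mul_le_of_le_one_right (norm_nonneg _) (norm_windowRestrict_le n k)
  have hG2 : G.comp (finiteSection A n k - z • ContinuousLinearMap.id ℂ _)
      = (((f.comp W).comp B).comp P).comp (windowEmbed X n k) := by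
    rw [finiteSection_sub_smul]
    ext y
    show f (W (windowEmbed X n k (windowRestrict X n k (B (windowEmbed X n k y)))))
      = f (W (B (P (windowEmbed X n k y))))
    rw [windowEmbed_restrict, hWP, hP, ← windowEmbed_restrict, windowRestrict_embed]
  have hG3 : ‖G.comp (finiteSection A n k - z • ContinuousLinearMap.id ℂ _)‖
      ≤ ‖((f.comp W).comp B).comp P‖ := by
    rw [hG2]
    refine (ContinuousLinearMap.opNorm_comp_le _ _).trans ?_
    exact mul_le_of_le_one_right (norm_nonneg _) (norm_windowEmbed_le n k)
  have hnf : ‖f.comp W‖ ^ 2 = ∑ i ∈ Finset.range n, w (i + 1) ^ 2 * ‖dualCoord f (k + 1 + i)‖ ^ 2 := by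
    have hc : ∀ j, ‖dualCoord (f.comp W) j‖ ^ 2 = w (j - k) ^ 2 * ‖dualCoord f j‖ ^ 2 := by
      intro j
      have : dualCoord (f.comp W) j = (w (j - k) : ℂ) • dualCoord f j := by
        ext x
        show f (W (lp.singleContinuousLinearMap ℂ (fun _ : ℤ => X) 2 j x)) = (w (j - k) : ℂ) • f (lp.singleContinuousLinearMap ℂ (fun _ : ℤ => X) 2 j x)
        rw [hWs, map_smul]
      rw [this, norm_smul, mul_pow, Complex.norm_real, Real.norm_eq_abs, sq_abs]
    rw [(hasSum_norm_dualCoord_sq (f.comp W)).eq_sum_window n k fun j hj => by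
      rw [hc, hws _ (by omega)]; simp]
    refine Finset.sum_congr rfl fun i _ => ?_
    rw [hc, show k + 1 + (i : ℤ) - k = i + 1 by ring]
  have hcol : ∀ i : ℕ, ‖dualCoord ((f.comp W).comp B) (k + 1 + i)‖ ≤
      |w (i + 1)| * ‖dualCoord (f.comp B) (k + 1 + i)‖
        + (superdiagNorm A * |w (i + 1) - w i| * ‖dualCoord f (k + 1 + i - 1)‖
          + subdiagNorm A * |w (i + 1 + 1) - w (i + 1)| * ‖dualCoord f (k + 1 + i + 1)‖) := by
    intro i
    set j : ℤ := k + 1 + i with hj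
    have e : dualCoord ((f.comp W).comp B) j = (w (i + 1) : ℂ) • dualCoord (f.comp B) j +
        (((w i - w (i + 1) : ℝ) : ℂ) • (dualCoord f (j - 1)).comp (matrixEntry B (j - 1) j)
        + ((w (i + 1 + 1) - w (i + 1) : ℝ) : ℂ) •
          (dualCoord f (j + 1)).comp (matrixEntry B (j + 1) j)) := by
      ext x
      set v := B (lp.singleContinuousLinearMap ℂ (fun _ : ℤ => X) 2 j x) with hv
      -- Column `j` of a tridiagonal operator occupies only the positions j - 1, j, j + 1.
      have hv3 : v = lp.singleContinuousLinearMap ℂ (fun _ : ℤ => X) 2 (j - 1) (v (j - 1))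
          + lp.singleContinuousLinearMap ℂ (fun _ : ℤ => X) 2 j (v j)
          + lp.singleContinuousLinearMap ℂ (fun _ : ℤ => X) 2 (j + 1) (v (j + 1)) := by
        apply lp.ext
        ext l
        rw [lp.coeFn_add, lp.coeFn_add, Pi.add_apply, Pi.add_apply, BiSeq.single_apply,
          BiSeq.single_apply, BiSeq.single_apply]
        by_cases h1 : l = j - 1
        · rw [if_pos h1, if_neg (by omega), if_neg (by omega), add_zero, add_zero, h1]
        by_cases h2 : l = j
        · rw [if_pos h2, if_neg (by omega), if_neg (by omega), add_zero, zero_add, h2]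
        by_cases h3 : l = j + 1
        · subst h3
          rw [if_neg (by omega), if_neg (by omega), if_pos rfl, zero_add, zero_add]
        · rw [if_neg h1, if_neg h2, if_neg h3, add_zero, add_zero]
          have := hBt l j (by rw [lt_abs]; omega)
          show matrixEntry B l j x = 0
          rw [this]; rfl
      show f (W v) = (w (i + 1) : ℂ) • f v + (((w i - w (i + 1) : ℝ) : ℂ) •
        f (lp.singleContinuousLinearMap ℂ (fun _ : ℤ => X) 2 (j - 1) (v (j - 1)))
        + ((w (i + 1 + 1) - w (i + 1) : ℝ) : ℂ) •
        f (lp.singleContinuousLinearMap ℂ (fun _ : ℤ => X) 2 (j + 1) (v (j + 1))))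
      have h4 : f (W v) = (w i : ℂ) •
          f (lp.singleContinuousLinearMap ℂ (fun _ : ℤ => X) 2 (j - 1) (v (j - 1)))
          + (w (i + 1) : ℂ) • f (lp.singleContinuousLinearMap ℂ (fun _ : ℤ => X) 2 j (v j))
          + (w (i + 1 + 1) : ℂ) •
          f (lp.singleContinuousLinearMap ℂ (fun _ : ℤ => X) 2 (j + 1) (v (j + 1))) := by
        conv_lhs => rw [hv3]
        simp only [map_add, hWs, map_smul]
        rw [show j - 1 - k = i by omega, show j - k = i + 1 by omega,
          show j + 1 - k = i + 1 + 1 by omega]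
      have h5 : f v = f (lp.singleContinuousLinearMap ℂ (fun _ : ℤ => X) 2 (j - 1) (v (j - 1)))
          + f (lp.singleContinuousLinearMap ℂ (fun _ : ℤ => X) 2 j (v j))
          + f (lp.singleContinuousLinearMap ℂ (fun _ : ℤ => X) 2 (j + 1) (v (j + 1))) := by
        conv_lhs => rw [hv3]
        rw [map_add, map_add]
      rw [h4, h5]
      push_cast
      module
    rw [e]
    refine (norm_add_le _ _).trans (add_le_add ?_ ((norm_add_le _ _).trans (add_le_add ?_ ?_)))
    · rw [norm_smul, Complex.norm_real, Real.norm_eq_abs]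
    · rw [norm_smul, Complex.norm_real, Real.norm_eq_abs, abs_sub_comm, mul_comm (superdiagNorm A),
        mul_assoc]
      refine mul_le_mul_of_nonneg_left ?_ (abs_nonneg _)
      refine (ContinuousLinearMap.opNorm_comp_le _ _).trans ?_
      rw [mul_comm]
      refine mul_le_mul_of_nonneg_right ?_ (norm_nonneg _)
      have := norm_matrixEntry_add_one_le (A := A) z (j - 1)
      rwa [sub_add_cancel] at this
    · rw [norm_smul, Complex.norm_real, Real.norm_eq_abs, mul_comm (subdiagNorm A), mul_assoc]
      refine mul_le_mul_of_nonneg_left ?_ (abs_nonneg _)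
      refine (ContinuousLinearMap.opNorm_comp_le _ _).trans ?_
      rw [mul_comm]
      refine mul_le_mul_of_nonneg_right ?_ (norm_nonneg _)
      have := norm_matrixEntry_sub_one_le (A := A) z (j + 1)
      rwa [add_sub_cancel_right] at this
  have hPs : ∀ (j : ℤ) (x : X), P (lp.singleContinuousLinearMap ℂ (fun _ : ℤ => X) 2 j x)
      = if k + 1 ≤ j ∧ j ≤ k + n then lp.singleContinuousLinearMap ℂ (fun _ : ℤ => X) 2 j x else 0 := by
    intro j x
    apply lp.ext
    ext i
    by_cases h : k + 1 ≤ i ∧ i ≤ k + n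
    · rw [hP, windowMul_apply_mem _ _ _ _ h.1 h.2, Pi.one_apply, one_smul]
      by_cases hij : i = j
      · subst hij; rw [if_pos h]
      · rw [BiSeq.single_apply, if_neg hij]
        split_ifs
        · rw [BiSeq.single_apply, if_neg hij]
        · rfl
    · rw [hP, windowMul_apply_notMem _ _ _ _ h]
      split_ifs with h'
      · rw [BiSeq.single_apply, if_neg]
        rintro rfl
        exact h h'
      · rfl
  have hsec : ‖((f.comp W).comp B).comp P‖ ^ 2 < (ε + κ) ^ 2 * ‖f.comp W‖ ^ 2 := by
    rw [hnf]
    refine lt_of_le_of_lt ?_ hk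
    rw [(hasSum_norm_dualCoord_sq (((f.comp W).comp B).comp P)).eq_sum_window n k fun j hj => by
      have : dualCoord (((f.comp W).comp B).comp P) j = 0 := by
        ext x
        show f (W (B (P (lp.singleContinuousLinearMap ℂ (fun _ : ℤ => X) 2 j x)))) = 0
        rw [hPs, if_neg hj, map_zero, map_zero, map_zero]
      rw [this]; simp]
    refine Finset.sum_le_sum fun i hi => ?_
    have : dualCoord (((f.comp W).comp B).comp P) (k + 1 + i)
        = dualCoord ((f.comp W).comp B) (k + 1 + i) := by
      ext x
      show f (W (B (P (lp.singleContinuousLinearMap ℂ (fun _ : ℤ => X) 2 (k + 1 + i) x)))) =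
        f (W (B (lp.singleContinuousLinearMap ℂ (fun _ : ℤ => X) 2 (k + 1 + i) x)))
      have := Finset.mem_range.1 hi
      rw [hPs, if_pos (by omega)]
    rw [this]
    exact pow_le_pow_left₀ (norm_nonneg _) (hcol i) 2
  have h1 := inverseGap_mul_norm_comp_le (finiteSection A n k - z • ContinuousLinearMap.id ℂ _) G
  by_contra! hcon
  have h2 : (ε + κ) * ‖f.comp W‖ ≤ ‖((f.comp W).comp B).comp P‖ :=
    (mul_le_mul hcon hG1 (norm_nonneg _) (inverseGap_nonneg _)).trans (h1.trans hG3)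
  have h3 := pow_le_pow_left₀ (by positivity) h2 2
  rw [mul_pow] at h3
  linarith

theorem exists_inverseGap_finiteSection_lt [CompleteSpace X] [Nontrivial X] (hA : IsTridiagonal A)
    {n : ℕ} (hn : 1 ≤ n) {ε : ℝ} {z : ℂ}
    (hz : inverseGap (A - z • ContinuousLinearMap.id ℂ _) < ε) :
    ∃ k : ℤ, inverseGap (finiteSection A n k - z • ContinuousLinearMap.id ℂ _)
      < ε + tauPenalty A n := by
  -- The infimum in the penalty need not be attained; the slack ε - ε' pays for a near-optimal φ.
  obtain ⟨ε', h1, h2⟩ := exists_between hz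
  have hε' : 0 < ε' := (inverseGap_nonneg _).trans_lt h1
  obtain ⟨φ, hφ0, hφ1, hφ⟩ := exists_penaltyTerm_lt A n
    (show tauPenalty A n < tauPenalty A n + (ε - ε') by linarith)
  set κ := tauPenalty A n + (ε - ε') with hκ
  have hκ0 : 0 < κ := by have := tauPenalty_nonneg A hn; linarith
  have hsum : ∀ ψ : ℝ, 0 < ψ → ψ < 1 → 0 < ∑ i ∈ Finset.range n, tauWeight n ψ (i + 1) ^ 2 := by
    intro ψ h0 h1
    refine Finset.sum_pos' (fun _ _ => sq_nonneg _) ⟨0, Finset.mem_range.2 (by omega), ?_⟩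
    have := tauWeight_one_pos hn h0 h1
    simp only [Nat.cast_zero, zero_add]
    positivity
  have hα : 0 ≤ subdiagNorm A ^ 2 / φ + superdiagNorm A ^ 2 / (1 - φ) := by
    have : 0 < 1 - φ := by linarith
    positivity
  have hμ : (subdiagNorm A ^ 2 / φ + superdiagNorm A ^ 2 / (1 - φ))
      * (2 * Real.sin (tauTheta n φ / 2)) ^ 2 ≤ κ ^ 2 := by
    have h3 : 0 ≤ penaltyTerm A n φ := penaltyTerm_nonneg A hn ⟨φ, hφ0, hφ1⟩
    have h4 := pow_le_pow_left₀ (by linarith) hφ.le 2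
    rw [penaltyTerm, mul_pow, mul_pow, Real.sq_sqrt hα] at h4
    linarith
  have hex : ∃ k : ℤ, inverseGap (finiteSection A n k - z • ContinuousLinearMap.id ℂ _)
      < ε' + κ := by
    rcases exists_small_of_inverseGap_lt hε' h1 with ⟨x, hx⟩ | ⟨f, hf⟩
    · exact inverseGap_finiteSection_lt_of_vector hA hφ0 hφ1 (fun i hi => tauWeight_eq_zero hi)
        (sum_sq_tauWeight hn hφ0 hφ1) (hsum φ hφ0 hφ1) hε' hκ0 hμ hx
    · have h0' : 0 < 1 - φ := by linarith
      have h1' : 1 - φ < 1 := by linarith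
      refine inverseGap_finiteSection_lt_of_functional hA h0' h1' (fun i hi => tauWeight_eq_zero hi)
        (sum_sq_tauWeight hn h0' h1') (hsum _ h0' h1') hε' hκ0 ?_ hf
      -- For functionals the weights are taken at 1 - φ; this restores the pairing of φ with the
      -- subdiagonal and leaves the angle unchanged.
      rw [tauTheta_symm, sub_sub_cancel, add_comm (superdiagNorm A ^ 2 / (1 - φ))]
      exact hμ
  obtain ⟨k, hk⟩ := hex
  exact ⟨k, by linarith⟩

theorem openPseudospectrum_subset_tauOpenSet [CompleteSpace X] [Nontrivial X]
    (hA : IsTridiagonal A) {n : ℕ} (hn : 1 ≤ n) {ε : ℝ} (hε : 0 < ε) :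
    openPseudospectrum A ε ⊆ tauOpenSet A n (ε + tauPenalty A n) := by
  intro z hz
  have : NeZero n := ⟨by omega⟩
  obtain ⟨k, hk⟩ := exists_inverseGap_finiteSection_lt hA hn ((mem_openPseudospectrum_iff hε).1 hz)
  refine Set.mem_iUnion.2 ⟨k, (mem_openPseudospectrum_iff ?_).2 hk⟩
  linarith [tauPenalty_nonneg A hn]

end Truncation

/-! ### Coefficients of bounded resolvents -/

section Resolvent

theorem circleAverage_inv_pow_smul {F : Type*} [NormedAddCommGroup F] [NormedSpace ℂ F]
    [CompleteSpace F] {ρ : ℝ} (hρ : ρ ≠ 0) {j : ℕ} (hj : 1 ≤ j) (a : F) :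
    Real.circleAverage (fun z : ℂ => (z⁻¹) ^ j • a) 0 ρ = 0 := by
  rw [Real.circleAverage_eq_circleIntegral hρ]
  have : ∀ z : ℂ, (z - 0)⁻¹ • (z⁻¹) ^ j • a = ((z - 0) ^ (-(j + 1 : ℤ))) • a := by
    intro z
    rw [smul_smul, sub_zero, zpow_neg, ← pow_succ', inv_pow]
    norm_cast
  simp_rw [this]
  rw [circleIntegral.integral_smul_const, circleIntegral.integral_sub_zpow_of_ne (by omega),
    zero_smul, smul_zero]

theorem norm_circleAverage_le {F : Type*} [NormedAddCommGroup F] [NormedSpace ℝ F]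
    (f : ℂ → F) (c : ℂ) (ρ : ℝ) :
    ‖Real.circleAverage f c ρ‖ ≤ Real.circleAverage (fun z => ‖f z‖) c ρ := by
  rw [Real.circleAverage_def, Real.circleAverage_def, norm_smul, smul_eq_mul, Real.norm_eq_abs,
    abs_of_pos (by positivity)]
  exact mul_le_mul_of_nonneg_left
    (intervalIntegral.norm_integral_le_integral_norm (by positivity)) (by positivity)

variable {V : Type*} [NormedAddCommGroup V] [NormedSpace ℂ V]

/-- On the circle |z| = ρ the kernel 1 + Re(ζ ρ^m z^{-m}) is non-negative with mean 1, so averaging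
the resolvent against it preserves the bound 1/s. The average picks out the Taylor coefficients of
orders 0 and m at the origin, namely R and R^{m+1}; the factor 1/2 comes from the real part. -/
theorem norm_inverse_add_smul_pow_le [CompleteSpace V] [Nontrivial V] {B : V →L[ℂ] V} {r s ρ : ℝ}
    (hs : 0 < s) (hρ : 0 < ρ) (hρr : ρ < r)
    (hB : ∀ z : ℂ, ‖z‖ < r → s ≤ inverseGap (B - z • ContinuousLinearMap.id ℂ V))
    {m : ℕ} (hm : 1 ≤ m) {ζ : ℂ} (hζ : ‖ζ‖ ≤ 1) :
    ‖Ring.inverse B + (ζ * ρ ^ m / 2) • Ring.inverse B ^ (m + 1)‖ ≤ s⁻¹ := by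
  set f : ℂ → (V →L[ℂ] V) := fun z => Ring.inverse (B - z • ContinuousLinearMap.id ℂ V) with hf
  set R := Ring.inverse B with hR
  have hu : ∀ z : ℂ, ‖z‖ < r → IsUnit (B - z • ContinuousLinearMap.id ℂ V) := fun z hz =>
    (norm_inverse_le_of_le_inverseGap hs (hB z hz)).1
  have hfn : ∀ z : ℂ, ‖z‖ < r → ‖f z‖ ≤ s⁻¹ := fun z hz =>
    (norm_inverse_le_of_le_inverseGap hs (hB z hz)).2
  have hBu : IsUnit B := by simpa using hu 0 (by rw [norm_zero]; linarith)
  have hRB : R * B = 1 := Ring.inverse_mul_cancel B hBu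
  have hf0 : f 0 = R := by simp [hf, hR]
  have hres : ∀ z : ℂ, ‖z‖ < r → f z = R + z • (R * f z) := by
    intro z hz
    have h1 : (B - z • (1 : V →L[ℂ] V)) * f z = 1 := Ring.mul_inverse_cancel _ (hu z hz)
    have h2 := congrArg (fun T => R * T) h1
    simp only [mul_one] at h2
    rw [sub_mul, mul_sub, ← mul_assoc, hRB, one_mul, smul_mul_assoc, one_mul, mul_smul_comm] at h2
    exact sub_eq_iff_eq_add.1 h2
  -- A finite Taylor expansion with holomorphic remainder, by iterating `hres`; no convergence of
  -- series is needed.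
  have hexp : ∀ z : ℂ, ‖z‖ < r → ∀ l : ℕ,
      f z = ∑ k ∈ Finset.range l, z ^ k • R ^ (k + 1) + z ^ l • (R ^ l * f z) := by
    intro z hz l
    induction l with
    | zero => simp
    | succ l ih =>
      rw [Finset.sum_range_succ, add_assoc]
      have : z ^ l • R ^ (l + 1) + z ^ (l + 1) • (R ^ (l + 1) * f z) = z ^ l • (R ^ l * f z) := by
        conv_rhs => rw [hres z hz]
        rw [mul_add, smul_add, mul_smul_comm, smul_smul, ← mul_assoc, ← pow_succ, ← pow_succ]
      rw [this]; exact ih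
  have hdiff : DifferentiableOn ℂ f (Metric.closedBall 0 ρ) := by
    intro z hz
    have hz' : ‖z‖ < r := (mem_closedBall_zero_iff.1 hz).trans_lt hρr
    obtain ⟨u, hu'⟩ := hu z hz'
    have h1 : DifferentiableAt ℂ (Ring.inverse : (V →L[ℂ] V) → (V →L[ℂ] V))
        (B - z • ContinuousLinearMap.id ℂ V) := by
      rw [← hu']; exact differentiableAt_inverse (𝕜 := ℂ) u.isUnit
    have h2 : DifferentiableAt ℂ (fun z : ℂ => B - z • ContinuousLinearMap.id ℂ V) z := by fun_prop
    exact (DifferentiableAt.comp z h1 h2).differentiableWithinAt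
  have hcl : ∀ g : ℂ → (V →L[ℂ] V), DifferentiableOn ℂ g (Metric.closedBall 0 ρ) →
      Real.circleAverage g 0 ρ = g 0 := by
    intro g hg
    refine DiffContOnCl.circleAverage (DifferentiableOn.diffContOnCl ?_)
    rw [closure_ball _ (abs_pos.2 hρ.ne').ne', abs_of_pos hρ]
    exact hg
  have hne : ∀ z ∈ Metric.sphere (0 : ℂ) |ρ|, z ≠ 0 ∧ ‖z‖ = ρ := by
    intro z hz
    rw [mem_sphere_zero_iff_norm, abs_of_pos hρ] at hz
    exact ⟨norm_pos_iff.1 (hz ▸ hρ), hz⟩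
  have hcont : ContinuousOn f (Metric.sphere 0 |ρ|) := by
    rw [abs_of_pos hρ]
    exact hdiff.continuousOn.mono Metric.sphere_subset_closedBall
  have hinv : ContinuousOn (fun z : ℂ => z⁻¹) (Metric.sphere 0 |ρ|) :=
    continuousOn_inv₀.mono fun z hz => (hne z hz).1
  have havg1 : Real.circleAverage (fun z => (z⁻¹) ^ m • f z) 0 ρ = R ^ (m + 1) := by
    have e : Set.EqOn (fun z => (z⁻¹) ^ m • f z)
        (fun z => ∑ k ∈ Finset.range m, (z⁻¹) ^ (m - k) • R ^ (k + 1) + R ^ m * f z)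
        (Metric.sphere 0 |ρ|) := by
      intro z hz
      obtain ⟨hz0, hzρ⟩ := hne z hz
      simp only
      conv_lhs => rw [hexp z (by linarith) m]
      rw [smul_add, Finset.smul_sum, smul_smul, ← mul_pow, inv_mul_cancel₀ hz0, one_pow, one_smul]
      congr 1
      refine Finset.sum_congr rfl fun k hk => ?_
      have hk' : k ≤ m := (Finset.mem_range.1 hk).le
      obtain ⟨l, rfl⟩ := Nat.exists_eq_add_of_le hk'
      rw [smul_smul, Nat.add_sub_cancel_left, pow_add, mul_right_comm, ← mul_pow,
        inv_mul_cancel₀ hz0, one_pow, one_mul]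
    have hi1 : ∀ k ∈ Finset.range m,
        CircleIntegrable (fun z : ℂ => (z⁻¹) ^ (m - k) • R ^ (k + 1)) 0 ρ := fun k _ =>
      ContinuousOn.circleIntegrable' ((hinv.pow _).smul continuousOn_const)
    have hi2 : CircleIntegrable (fun z : ℂ => R ^ m * f z) 0 ρ :=
      ContinuousOn.circleIntegrable' (continuousOn_const.mul hcont)
    rw [Real.circleAverage_congr_sphere e, Real.circleAverage_fun_add (CircleIntegrable.fun_sum _ hi1) hi2,
      Real.circleAverage_fun_sum hi1, Finset.sum_eq_zero, zero_add,
      hcl _ (DifferentiableOn.const_mul hdiff _), hf0, pow_succ]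
    intro k hk
    have := Finset.mem_range.1 hk
    exact circleAverage_inv_pow_smul hρ.ne' (by omega) _
  -- The conjugate half of the kernel pairs the resolvent with z^m, which gives a holomorphic
  -- function vanishing at 0.
  have havg2 : Real.circleAverage (fun z => z ^ m • f z) 0 ρ = 0 := by
    have h := hcl (fun z => z ^ m • f z) ((differentiableOn_id.pow m).smul hdiff)
    rwa [zero_pow (by omega), zero_smul] at h
  set K : ℂ → ℝ := fun z => 1 + (ζ * ρ ^ m * (z⁻¹) ^ m).re with hK
  have hi0 : CircleIntegrable (fun z : ℂ => ζ * ρ ^ m * (z⁻¹) ^ m) 0 ρ :=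
    ContinuousOn.circleIntegrable' (continuousOn_const.mul (hinv.pow _))
  have hKc : ContinuousOn K (Metric.sphere 0 |ρ|) :=
    continuousOn_const.add (Complex.continuous_re.comp_continuousOn
      (continuousOn_const.mul (hinv.pow _)))
  have hKavg : Real.circleAverage K 0 ρ = 1 := by
    have h1 : Real.circleAverage (fun z : ℂ => (ζ * ρ ^ m * (z⁻¹) ^ m).re) 0 ρ = 0 := by
      have h2 := Complex.reCLM.circleAverage_comp_comm hi0
      have h3 : Real.circleAverage (fun z : ℂ => ζ * ρ ^ m * (z⁻¹) ^ m) 0 ρ = 0 := by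
        have := circleAverage_inv_pow_smul hρ.ne' hm (ζ * ρ ^ m)
        simpa only [smul_eq_mul, mul_comm] using this
      rw [h3, map_zero] at h2
      exact h2
    have hi3 : CircleIntegrable (fun z : ℂ => (ζ * ρ ^ m * (z⁻¹) ^ m).re) 0 ρ :=
      ContinuousOn.circleIntegrable' (Complex.continuous_re.comp_continuousOn
        (continuousOn_const.mul (hinv.pow _)))
    rw [hK, Real.circleAverage_fun_add (circleIntegrable_const _ _ _) hi3, h1,
      Real.circleAverage_const, add_zero]
  have hK0 : ∀ z ∈ Metric.sphere (0 : ℂ) |ρ|, 0 ≤ K z := by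
    intro z hz
    obtain ⟨hz0, hzρ⟩ := hne z hz
    have h1 : ‖ζ * ρ ^ m * (z⁻¹) ^ m‖ ≤ 1 := by
      rw [norm_mul, norm_mul, norm_pow, norm_pow, norm_inv, hzρ, Complex.norm_real,
        Real.norm_eq_abs, abs_of_pos hρ, mul_assoc, ← mul_pow, mul_inv_cancel₀ hρ.ne', one_pow,
        mul_one]
      exact hζ
    have h2 := (abs_le.1 ((Complex.abs_re_le_norm _).trans h1)).1
    simp only [hK]; linarith
  have hKeq : Set.EqOn (fun z => (K z : ℂ) • f z) (fun z => f z +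
      ((ζ * ρ ^ m / 2) • ((z⁻¹) ^ m • f z) + ((starRingEnd ℂ) ζ / (ρ ^ m * 2)) • (z ^ m • f z)))
      (Metric.sphere 0 |ρ|) := by
    intro z hz
    obtain ⟨hz0, hzρ⟩ := hne z hz
    have hρ' : (ρ : ℂ) ≠ 0 := Complex.ofReal_ne_zero.2 hρ.ne'
    -- On the circle, conjugation of 1/z is z/ρ², which makes the conjugate term a polynomial in z.
    have hconj : (starRingEnd ℂ) z⁻¹ = z / ρ ^ 2 := by
      rw [map_inv₀, eq_div_iff (pow_ne_zero 2 hρ'), inv_mul_eq_iff_eq_mul₀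
        ((map_ne_zero (starRingEnd ℂ)).2 hz0), mul_comm, Complex.mul_conj, Complex.normSq_eq_norm_sq, hzρ]
      push_cast; rfl
    have hKz : (K z : ℂ) = 1 + (ζ * ρ ^ m / 2 * (z⁻¹) ^ m
        + (starRingEnd ℂ) ζ / (ρ ^ m * 2) * z ^ m) := by
      have h1 := Complex.re_eq_add_conj (ζ * ρ ^ m * (z⁻¹) ^ m)
      simp only [hK, Complex.ofReal_add, Complex.ofReal_one]
      rw [h1, map_mul, map_mul, map_pow, map_pow, hconj, Complex.conj_ofReal, div_pow, ← pow_mul,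
        mul_comm 2 m, pow_mul]
      have := pow_ne_zero m hρ'
      field_simp
    simp only [hKz, add_smul, one_smul, smul_smul]
  have hg1 : CircleIntegrable (fun z : ℂ => (ζ * ρ ^ m / 2) • ((z⁻¹) ^ m • f z)) 0 ρ :=
    ContinuousOn.circleIntegrable' (((hinv.pow m).smul hcont).const_smul (ζ * ρ ^ m / 2))
  have hg2 : CircleIntegrable (fun z : ℂ => ((starRingEnd ℂ) ζ / (ρ ^ m * 2)) • (z ^ m • f z)) 0 ρ :=
    ContinuousOn.circleIntegrable' (((continuousOn_id.pow m).smul hcont).const_smul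
      ((starRingEnd ℂ) ζ / (ρ ^ m * 2)))
  have havg : Real.circleAverage (fun z => (K z : ℂ) • f z) 0 ρ
      = R + (ζ * ρ ^ m / 2) • R ^ (m + 1) := by
    have hg12 : CircleIntegrable (fun z : ℂ => (ζ * ρ ^ m / 2) • ((z⁻¹) ^ m • f z) +
        ((starRingEnd ℂ) ζ / (ρ ^ m * 2)) • (z ^ m • f z)) 0 ρ := hg1.add hg2
    rw [Real.circleAverage_congr_sphere hKeq, Real.circleAverage_fun_add
      (ContinuousOn.circleIntegrable' hcont) hg12, Real.circleAverage_fun_add hg1 hg2,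
      Real.circleAverage_fun_smul, Real.circleAverage_fun_smul, havg1, havg2, smul_zero, add_zero,
      hcl _ hdiff, hf0]
  rw [← havg]
  refine (norm_circleAverage_le _ _ _).trans ?_
  have hmono : Real.circleAverage (fun z => ‖(K z : ℂ) • f z‖) 0 ρ
      ≤ Real.circleAverage (fun z => s⁻¹ • K z) 0 ρ := by
    refine Real.circleAverage_mono (ContinuousOn.circleIntegrable' ?_)
      (ContinuousOn.circleIntegrable' (hKc.const_smul s⁻¹)) fun z hz => ?_
    · exact ((Complex.continuous_ofReal.comp_continuousOn hKc).smul hcont).norm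
    · rw [norm_smul, Complex.norm_real, Real.norm_eq_abs, abs_of_nonneg (hK0 z hz), smul_eq_mul,
        mul_comm]
      exact mul_le_mul_of_nonneg_right (hfn z (by linarith [(hne z hz).2])) (hK0 z hz)
  rw [Real.circleAverage_fun_smul, hKavg, smul_eq_mul, mul_one] at hmono
  exact hmono

end Resolvent

/-! ### Pseudospectra of operators on complex uniformly convex spaces -/

section MaximumPrinciple

variable {V : Type*} [NormedAddCommGroup V] [NormedSpace ℂ V]

/-- A family of operators satisfies the uniform maximum principle if a lower bound of
`1 / ‖(B - z)⁻¹‖` in a disc cannot nearly be attained at its centre. -/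
def UniformMaximumPrinciple (𝓑 : Set (V →L[ℂ] V)) : Prop :=
  ∀ C r s : ℝ, 0 < r → 0 < s → ∃ δ > 0, ∀ B ∈ 𝓑, ‖B‖ ≤ C →
    (∀ z : ℂ, ‖z‖ < r → s ≤ inverseGap (B - z • ContinuousLinearMap.id ℂ V)) →
      s + δ ≤ inverseGap B

theorem norm_pow_two_inverse {B : V →L[ℂ] V} (hB : IsUnit B) (x : V) :
    B ((Ring.inverse B ^ 2) x) = Ring.inverse B x := by
  have : B * Ring.inverse B ^ 2 = Ring.inverse B := by
    rw [pow_two, ← mul_assoc, Ring.mul_inverse_cancel B hB, one_mul]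
  exact congrArg (fun T : V →L[ℂ] V => T x) this

theorem exists_norm_inverse_gt [Nontrivial V] {B : V →L[ℂ] V} {M : ℝ} (hB : IsUnit B)
    (hM : inverseGap B < M) : ∃ x : V, ‖x‖ < 1 ∧ M⁻¹ < ‖Ring.inverse B x‖ := by
  refine ContinuousLinearMap.exists_lt_apply_of_lt_opNorm _ ?_
  rw [inverseGap_of_isUnit hB] at hM
  have h := norm_inverse_pos hB
  rw [inv_lt_comm₀ (lt_of_le_of_lt (by positivity) hM) h]
  exact hM

/-- Convexity rescaled by `s`. If s‖x‖ ≤ 1/2, any increment up to `s` is harmless; otherwise s‖y‖ ≥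
c/2, convexity applies, and (1 - δ)(1 + δ) ≤ 1. -/
theorem ComplexUniformlyConvex.exists_norm_le {Y : Type*} [NormedAddCommGroup Y] [NormedSpace ℂ Y]
    (hY : ComplexUniformlyConvex Y) {c s : ℝ} (hc : 0 < c) (hs : 0 < s) :
    ∃ δ > 0, ∀ x y : Y, c * ‖x‖ ≤ ‖y‖ → (∀ ζ : ℂ, ‖ζ‖ ≤ 1 → ‖x + ζ • y‖ ≤ s⁻¹) →
      ‖x‖ ≤ (s + δ)⁻¹ := by
  obtain ⟨δ, hδ, h⟩ := hY (c / 2) (by positivity)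
  refine ⟨min s (s * δ), by positivity, fun x y hxy hx => ?_⟩
  have hm : 0 < min s (s * δ) := by positivity
  by_cases hxs : s * ‖x‖ ≤ 1 / 2
  · rw [← one_div, le_div_iff₀ (by positivity)]
    nlinarith [mul_le_mul_of_nonneg_left (min_le_left s (s * δ)) (norm_nonneg x)]
  · have h1 := h ((s : ℂ) • x) ((s : ℂ) • y) ?_ fun ζ hζ => ?_
    · rw [norm_smul, Complex.norm_real, Real.norm_eq_abs, abs_of_pos hs] at h1
      rw [← one_div, le_div_iff₀ (by positivity)]
      have h2 : ‖x‖ * min s (s * δ) ≤ ‖x‖ * (s * δ) :=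
        mul_le_mul_of_nonneg_left (min_le_right _ _) (norm_nonneg _)
      nlinarith [mul_le_mul_of_nonneg_right h1 hδ.le, sq_nonneg δ]
    · rw [norm_smul, Complex.norm_real, Real.norm_eq_abs, abs_of_pos hs]
      nlinarith [mul_le_mul_of_nonneg_left hxy hs.le]
    · rw [smul_comm, ← smul_add, norm_smul, Complex.norm_real, Real.norm_eq_abs, abs_of_pos hs]
      calc s * ‖x + ζ • y‖ ≤ s * s⁻¹ := by gcongr; exact hx ζ hζ
        _ = 1 := mul_inv_cancel₀ hs.ne'

variable [CompleteSpace V] [Nontrivial V]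

/-- With R = B⁻¹, convexity is applied to Rx and (r/4) R²x, the case m = 1, ρ = r/2 of the kernel
estimate. The second vector is not small compared with the first since Rx = B R²x and ‖B‖ ≤ C. So δ
depends on C, r, s only. -/
theorem ComplexUniformlyConvex.uniformMaximumPrinciple (hV : ComplexUniformlyConvex V)
    (𝓑 : Set (V →L[ℂ] V)) : UniformMaximumPrinciple 𝓑 := by
  intro C r s hr hs
  obtain ⟨δ, hδ, h⟩ := hV.exists_norm_le (c := r / 4 / max C 1) (by positivity) hs
  refine ⟨δ, hδ, fun B _ hC hB => ?_⟩
  by_contra! hlt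
  have hs0 : s ≤ inverseGap B := by simpa using hB 0 (by simpa using hr)
  have hu : IsUnit B := isUnit_of_inverseGap_pos (hs.trans_le hs0)
  obtain ⟨x, hx, hxM⟩ := exists_norm_inverse_gt hu hlt
  refine hxM.not_ge (h _ ((r / 4 : ℂ) • (Ring.inverse B ^ 2) x) ?_ fun ζ hζ => ?_)
  · have h1 : ‖Ring.inverse B x‖ ≤ max C 1 * ‖(Ring.inverse B ^ 2) x‖ := by
      rw [← norm_pow_two_inverse hu]
      exact B.le_of_opNorm_le (hC.trans (le_max_left _ _)) _
    have h2 : ‖(r / 4 : ℂ)‖ = r / 4 := by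
      rw [norm_div, Complex.norm_real, Real.norm_eq_abs, abs_of_pos hr]; norm_num
    rw [norm_smul, h2, div_mul_eq_mul_div, div_le_iff₀ (by positivity)]
    nlinarith
  · have h1 := norm_inverse_add_smul_pow_le hs (half_pos hr) (half_lt_self hr) hB le_rfl hζ
    have h2 := (Ring.inverse B + (ζ * ((r / 2 : ℝ) : ℂ) ^ 1 / 2) • Ring.inverse B ^ (1 + 1)).le_of_opNorm_le_of_le h1 hx.le
    rw [mul_one] at h2
    have h3 : Ring.inverse B x + ζ • ((r / 4 : ℂ) • (Ring.inverse B ^ 2) x) =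
        (Ring.inverse B + (ζ * ((r / 2 : ℝ) : ℂ) ^ 1 / 2) • Ring.inverse B ^ (1 + 1)) x := by
      change _ = Ring.inverse B x + (ζ * ((r / 2 : ℝ) : ℂ) ^ 1 / 2) • (Ring.inverse B ^ 2) x
      rw [smul_smul]
      congr 2
      push_cast; ring
    rwa [h3]

/-- The same argument for the functionals g ∘ R and g ∘ R², where `g` norms Rx for a nearly extremal
x. -/
theorem ComplexUniformlyConvex.uniformMaximumPrinciple_of_dual
    (hV : ComplexUniformlyConvex (V →L[ℂ] ℂ))
    (𝓑 : Set (V →L[ℂ] V)) : UniformMaximumPrinciple 𝓑 := by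
  intro C r s hr hs
  obtain ⟨δ, hδ, h⟩ := hV.exists_norm_le (c := r / 4 / max C 1) (by positivity) hs
  refine ⟨δ, hδ, fun B _ hC hB => ?_⟩
  by_contra! hlt
  have hs0 : s ≤ inverseGap B := by simpa using hB 0 (by simpa using hr)
  have hu : IsUnit B := isUnit_of_inverseGap_pos (hs.trans_le hs0)
  obtain ⟨x, hx, hxM⟩ := exists_norm_inverse_gt hu hlt
  obtain ⟨g, hg, hgx⟩ := exists_dual_vector'' ℂ (Ring.inverse B x)
  have hgn : ‖Ring.inverse B x‖ ≤ ‖g.comp (Ring.inverse B)‖ := by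
    calc ‖Ring.inverse B x‖ = ‖(g.comp (Ring.inverse B)) x‖ := by
          rw [ContinuousLinearMap.comp_apply, hgx]; simp
      _ ≤ ‖g.comp (Ring.inverse B)‖ * 1 := ContinuousLinearMap.le_opNorm_of_le _ hx.le
      _ = _ := mul_one _
  refine (hxM.trans_le hgn).not_ge (h _ ((r / 4 : ℂ) • g.comp (Ring.inverse B ^ 2)) ?_ fun ζ hζ => ?_)
  · have h1 : ‖g.comp (Ring.inverse B)‖ ≤ max C 1 * ‖g.comp (Ring.inverse B ^ 2)‖ := by
      have : g.comp (Ring.inverse B) = (g.comp (Ring.inverse B ^ 2)).comp B := by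
        rw [ContinuousLinearMap.comp_assoc]
        congr 1
        change _ = Ring.inverse B ^ 2 * B
        rw [pow_two, mul_assoc, Ring.inverse_mul_cancel B hu, mul_one]
      rw [this, mul_comm]
      exact (ContinuousLinearMap.opNorm_comp_le _ _).trans
        (mul_le_mul_of_nonneg_left (hC.trans (le_max_left _ _)) (norm_nonneg _))
    have h2 : ‖(r / 4 : ℂ)‖ = r / 4 := by
      rw [norm_div, Complex.norm_real, Real.norm_eq_abs, abs_of_pos hr]; norm_num
    rw [norm_smul, h2, div_mul_eq_mul_div, div_le_iff₀ (by positivity)]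
    nlinarith
  · have h1 := norm_inverse_add_smul_pow_le hs (half_pos hr) (half_lt_self hr) hB le_rfl hζ
    have h2 : g.comp (Ring.inverse B) + ζ • ((r / 4 : ℂ) • g.comp (Ring.inverse B ^ 2)) =
        g.comp (Ring.inverse B + (ζ * ((r / 2 : ℝ) : ℂ) ^ 1 / 2) • Ring.inverse B ^ (1 + 1)) := by
      rw [ContinuousLinearMap.comp_add, ContinuousLinearMap.comp_smul, smul_smul]
      congr 2
      push_cast; ring
    rw [h2]
    refine (ContinuousLinearMap.opNorm_comp_le _ _).trans ?_
    calc _ ≤ 1 * s⁻¹ := mul_le_mul hg h1 (norm_nonneg _) zero_le_one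
      _ = s⁻¹ := one_mul _

end MaximumPrinciple

/-! ### Backward orbits of tridiagonal maps -/

section BackwardOrbit

variable {X : Type*} [AddCommGroup X] [Module ℂ X]

/-- The tridiagonal linear map on all of `ℤ → X` with entries `a i j`, `|i - j| ≤ 1`. -/
def tridiagonalMap (a : ℤ → ℤ → X →ₗ[ℂ] X) : (ℤ → X) →ₗ[ℂ] (ℤ → X) :=
  LinearMap.pi fun i => a i (i - 1) ∘ₗ LinearMap.proj (i - 1) + a i i ∘ₗ LinearMap.proj i
    + a i (i + 1) ∘ₗ LinearMap.proj (i + 1)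

theorem tridiagonalMap_apply (a : ℤ → ℤ → X →ₗ[ℂ] X) (w : ℤ → X) (i : ℤ) :
    tridiagonalMap a w i = a i (i - 1) (w (i - 1)) + a i i (w i) + a i (i + 1) (w (i + 1)) := rfl

theorem tridiagonalMap_apply_eq_zero (a : ℤ → ℤ → X →ₗ[ℂ] X) {w : ℤ → X} {i : ℤ}
    (h : ∀ l, |l - i| ≤ 1 → w l = 0) : tridiagonalMap a w i = 0 := by
  rw [tridiagonalMap_apply, h (i - 1) (by simp), h i (by simp), h (i + 1) (by simp)]
  simp

/-- Finite propagation: each application of the map reaches only one site further. -/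
theorem tridiagonalMap_pow_apply_eq_zero (a : ℤ → ℤ → X →ₗ[ℂ] X) {j : ℤ} (M : ℕ) {w : ℤ → X}
    (h : ∀ i, |i - j| ≤ M → w i = 0) : (tridiagonalMap a ^ M) w j = 0 := by
  induction M generalizing w with
  | zero => exact h j (by simp)
  | succ M ih =>
    rw [pow_succ, Module.End.mul_apply]
    refine ih fun i hi => tridiagonalMap_apply_eq_zero a fun l hl => h l ?_
    push_cast
    rw [abs_le] at *
    constructor <;> linarith [hl.1, hl.2, hi.1, hi.2]

theorem pow_apply_backwardOrbit {W : Type*} [AddCommGroup W] [Module ℂ W] {T : W →ₗ[ℂ] W}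
    {e : ℕ → W} (he : ∀ m, T (e (m + 1)) = e m) (M l : ℕ) : (T ^ M) (e (M + l)) = e l := by
  induction M with
  | zero => simp
  | succ M ih => rw [pow_succ, Module.End.mul_apply, Nat.add_right_comm, he, ih]

/-- The projection of `ℤ → X` that keeps the coordinates in `I`. -/
def coordProj (X : Type*) [AddCommGroup X] [Module ℂ X] (I : Finset ℤ) : (ℤ → X) →ₗ[ℂ] (ℤ → X) :=
  LinearMap.pi fun i => if i ∈ I then LinearMap.proj i else 0

theorem coordProj_apply (I : Finset ℤ) (w : ℤ → X) (i : ℤ) :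
    coordProj X I w i = if i ∈ I then w i else 0 := by
  rw [coordProj, LinearMap.pi_apply]; split_ifs <;> rfl

theorem coordProj_eq_comp (I : Finset ℤ) :
    ∃ f : (I → X) →ₗ[ℂ] (ℤ → X), coordProj X I = f ∘ₗ LinearMap.funLeft ℂ X ((↑) : I → ℤ) := by
  refine ⟨LinearMap.pi fun i => if h : i ∈ I then LinearMap.proj ⟨i, h⟩ else 0, ?_⟩
  ext w i : 2
  rw [coordProj_apply, LinearMap.comp_apply, LinearMap.pi_apply]
  split_ifs <;> rfl

theorem finiteDimensional_range_coordProj [FiniteDimensional ℂ X] (I : Finset ℤ) :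
    FiniteDimensional ℂ (LinearMap.range (coordProj X I)) := by
  obtain ⟨f, hf⟩ := coordProj_eq_comp (X := X) I
  rw [hf]
  exact Submodule.finiteDimensional_of_le (LinearMap.range_comp_le_range _ f)

instance finiteDimensional_map_coordProj [FiniteDimensional ℂ X] (I : Finset ℤ)
    (S : Submodule ℂ (ℤ → X)) : FiniteDimensional ℂ (S.map (coordProj X I)) :=
  have := finiteDimensional_range_coordProj (X := X) I
  Submodule.finiteDimensional_of_le (LinearMap.map_le_range)

theorem finrank_map_coordProj_le [FiniteDimensional ℂ X] (I : Finset ℤ)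
    (S : Submodule ℂ (ℤ → X)) :
    Module.finrank ℂ (S.map (coordProj X I)) ≤ I.card * Module.finrank ℂ X := by
  obtain ⟨f, hf⟩ := coordProj_eq_comp (X := X) I
  rw [hf, Submodule.map_comp]
  refine (Submodule.finrank_map_le f _).trans ((Submodule.finrank_le _).trans ?_)
  rw [Module.finrank_pi_fintype]
  simp

theorem finrank_map_coordProj_union_le [FiniteDimensional ℂ X] {I J : Finset ℤ}
    (h : Disjoint I J) (S : Submodule ℂ (ℤ → X)) :
    Module.finrank ℂ (S.map (coordProj X (I ∪ J))) ≤
      Module.finrank ℂ (S.map (coordProj X I)) + Module.finrank ℂ (S.map (coordProj X J)) := by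
  have e : coordProj X (I ∪ J) = coordProj X I + coordProj X J := by
    ext w i : 2
    rw [LinearMap.add_apply, Pi.add_apply, coordProj_apply, coordProj_apply, coordProj_apply]
    by_cases hi : i ∈ I
    · simp [hi, Finset.disjoint_left.1 h hi]
    · simp [hi]
  rw [e]
  refine le_trans (Submodule.finrank_mono ?_) (Submodule.finrank_add_le_finrank_add_finrank _ _)
  exact Submodule.map_add_le S _ _

variable [FiniteDimensional ℂ X] {a : ℤ → ℤ → X →ₗ[ℂ] X} {e : ℕ → ℤ → X}

/-- If the rank did not drop, e_M would agree on `I` with some v in the span of the later vectors.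
By `hloc`, T^M then takes both to the same value at `j`. But T^M e_M = e_0 is not annihilated by φ
there, while T^M v is a combination of e_m with m ≥ 1 and is annihilated. -/
theorem finrank_backwardOrbit_lt (he : ∀ m, tridiagonalMap a (e (m + 1)) = e m)
    {I : Finset ℤ} {M : ℕ} {j : ℤ} {φ : X →ₗ[ℂ] ℂ} (h0 : φ (e 0 j) ≠ 0)
    (hφ : ∀ m, 1 ≤ m → φ (e m j) = 0)
    (hloc : ∀ w ∈ Submodule.span ℂ (e '' Set.Ici M), (∀ i ∈ I, w i = 0) →
      (tridiagonalMap a ^ M) w j = 0) :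
    Module.finrank ℂ ((Submodule.span ℂ (e '' Set.Ici (M + 1))).map (coordProj X I)) <
      Module.finrank ℂ ((Submodule.span ℂ (e '' Set.Ici M)).map (coordProj X I)) := by
  have hle : Submodule.span ℂ (e '' Set.Ici (M + 1)) ≤ Submodule.span ℂ (e '' Set.Ici M) :=
    Submodule.span_mono (Set.image_mono (Set.Ici_subset_Ici.2 M.le_succ))
  have hM : e M ∈ Submodule.span ℂ (e '' Set.Ici M) :=
    Submodule.subset_span ⟨M, Set.self_mem_Ici, rfl⟩
  refine Submodule.finrank_lt_finrank_of_lt (lt_of_le_of_ne (Submodule.map_mono hle) fun heq => ?_)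
  have hmem : coordProj X I (e M) ∈ (Submodule.span ℂ (e '' Set.Ici (M + 1))).map (coordProj X I) :=
    heq ▸ Submodule.mem_map_of_mem hM
  obtain ⟨v, hv, hvM⟩ := hmem
  have h1 : ∀ v ∈ Submodule.span ℂ (e '' Set.Ici (M + 1)), φ ((tridiagonalMap a ^ M) v j) = 0 := by
    intro v hv
    have : Submodule.span ℂ (e '' Set.Ici (M + 1)) ≤
        LinearMap.ker (φ ∘ₗ LinearMap.proj j ∘ₗ (tridiagonalMap a ^ M)) := by
      rw [Submodule.span_le]
      rintro _ ⟨m, hm, rfl⟩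
      have hm' : M + 1 ≤ m := hm
      obtain ⟨l, rfl⟩ := Nat.exists_eq_add_of_le hm'
      have : (tridiagonalMap a ^ M) (e (M + 1 + l)) = e (1 + l) := by
        rw [add_assoc]; exact pow_apply_backwardOrbit he _ _
      change φ ((tridiagonalMap a ^ M) (e (M + 1 + l)) j) = 0
      rw [this]
      exact hφ _ (by omega)
    exact this hv
  have h2 := hloc (e M - v) (Submodule.sub_mem _ hM (hle hv)) fun i hi => by
    have := congrFun hvM i
    rw [coordProj_apply, coordProj_apply, if_pos hi, if_pos hi] at this
    rw [Pi.sub_apply, this, sub_self]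
  rw [map_sub, Pi.sub_apply, sub_eq_zero] at h2
  have h3 : (tridiagonalMap a ^ M) (e M) = e 0 := pow_apply_backwardOrbit he M 0
  rw [h3] at h2
  exact h0 (h2 ▸ h1 v hv)

/-- A backward orbit that vanishes at two points on either side of `j` cannot be annihilated at
`j`, except at time zero. -/
theorem false_of_backwardOrbit_of_vanish (he : ∀ m, tridiagonalMap a (e (m + 1)) = e m)
    {j b c : ℤ} (hb : b < j) (hc : j < c) (heb : ∀ m, e m b = 0) (hec : ∀ m, e m c = 0)
    {φ : X →ₗ[ℂ] ℂ} (h0 : φ (e 0 j) ≠ 0) (hφ : ∀ m, 1 ≤ m → φ (e m j) = 0) : False := by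
  set G : ℕ → ℕ := fun M => Module.finrank ℂ
    ((Submodule.span ℂ (e '' Set.Ici M)).map (coordProj X (Finset.Ioo b c))) with hG
  have hzero : ∀ (M : ℕ) (w : ℤ → X), w ∈ Submodule.span ℂ (e '' Set.Ici M) →
      w b = 0 ∧ w c = 0 := by
    intro M w hw
    have h1 : Submodule.span ℂ (e '' Set.Ici M) ≤
        LinearMap.ker (LinearMap.proj b : (ℤ → X) →ₗ[ℂ] X) ⊓
          LinearMap.ker (LinearMap.proj c : (ℤ → X) →ₗ[ℂ] X) := by
      rw [Submodule.span_le]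
      rintro _ ⟨m, -, rfl⟩
      exact ⟨heb m, hec m⟩
    exact h1 hw
  have hshift : ∀ (M : ℕ) (w : ℤ → X), w ∈ Submodule.span ℂ (e '' Set.Ici (M + 1)) →
      tridiagonalMap a w ∈ Submodule.span ℂ (e '' Set.Ici M) := by
    intro M w hw
    have h1 : Submodule.span ℂ (e '' Set.Ici (M + 1)) ≤
        (Submodule.span ℂ (e '' Set.Ici M)).comap (tridiagonalMap a) := by
      rw [Submodule.span_le]
      rintro _ ⟨m, hm, rfl⟩
      have hm' : M + 1 ≤ m := hm
      obtain ⟨l, rfl⟩ := Nat.exists_eq_add_of_le hm'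
      change tridiagonalMap a (e (M + 1 + l)) ∈ Submodule.span ℂ (e '' Set.Ici M)
      rw [Nat.add_right_comm, he]
      exact Submodule.subset_span ⟨M + l, Nat.le_add_right _ _, rfl⟩
    exact h1 hw
  -- The zeros at `b` and `c` block propagation into the interval, so the rank must drop for every
  -- M, without end.
  have hloc : ∀ (M : ℕ) (w : ℤ → X), w ∈ Submodule.span ℂ (e '' Set.Ici M) →
      (∀ i ∈ Finset.Ioo b c, w i = 0) → (tridiagonalMap a ^ M) w j = 0 := by
    intro M
    induction M with
    | zero => exact fun w _ h => h j (Finset.mem_Ioo.2 ⟨hb, hc⟩)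
    | succ M ih =>
      intro w hw h
      rw [pow_succ, Module.End.mul_apply]
      refine ih _ (hshift M w hw) fun i hi => tridiagonalMap_apply_eq_zero a fun l hl => ?_
      rw [Finset.mem_Ioo] at hi
      rw [abs_le] at hl
      rcases eq_or_lt_of_le (show b ≤ l by omega) with rfl | h1
      · exact (hzero _ w hw).1
      rcases eq_or_lt_of_le (show l ≤ c by omega) with rfl | h2
      · exact (hzero _ w hw).2
      exact h l (Finset.mem_Ioo.2 ⟨h1, h2⟩)
  have hlt : ∀ M, G (M + 1) < G M := fun M => finrank_backwardOrbit_lt he h0 hφ (hloc M)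
  have hb : ∀ M, G M + M ≤ G 0 := by
    intro M
    induction M with
    | zero => simp
    | succ M ih => have := hlt M; omega
  have := hb (G 0 + 1)
  omega

/-- The rank per site is at most dim X - k/4 at scale k. Doubling an interval at most adds the ranks
of its halves; then raising M from 2^k to 2^{k+1} loses at least 2^k dimensions on 2^{k+2} sites,
which is another 1/4 per site. -/
theorem finrank_backwardOrbit_dyadic (he : ∀ m, tridiagonalMap a (e (m + 1)) = e m)
    {φ : ℤ → X →ₗ[ℂ] ℂ} (h0 : ∀ j, 0 ≤ j → φ j (e 0 j) ≠ 0)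
    (hφ : ∀ m, 1 ≤ m → ∀ j, 0 ≤ j → φ j (e m j) = 0) (k : ℕ) (b : ℤ) (hb : 0 ≤ b) :
    4 * Module.finrank ℂ ((Submodule.span ℂ (e '' Set.Ici (2 ^ k))).map
      (coordProj X (Finset.Ico b (b + 2 ^ (k + 1))))) + k * 2 ^ (k + 1) ≤
      4 * (2 ^ (k + 1) * Module.finrank ℂ X) := by
  induction k generalizing b with
  | zero =>
    have := finrank_map_coordProj_le (X := X) (Finset.Ico b (b + 2 ^ (0 + 1)))
      (Submodule.span ℂ (e '' Set.Ici (2 ^ 0)))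
    rw [Int.card_Ico] at this
    simp only [zero_add, pow_one, add_sub_cancel_left] at this
    simpa using this
  | succ k ih =>
    set c : ℤ := b + 2 ^ (k + 1) with hc
    have hpos : (0 : ℤ) < 2 ^ (k + 1) := by positivity
    set I := Finset.Ico b (b + 2 ^ (k + 1 + 1)) with hI
    set G : ℕ → ℕ := fun M => Module.finrank ℂ
      ((Submodule.span ℂ (e '' Set.Ici M)).map (coordProj X I)) with hG
    have e1 : (2 : ℤ) ^ (k + 1 + 1) = 2 ^ (k + 1) + 2 ^ (k + 1) := by ring
    have e2 : 2 ^ (k + 1) = 2 ^ k + 2 ^ k := by ring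
    have e3 : 2 ^ (k + 1 + 1) = 2 ^ (k + 1) + 2 ^ (k + 1) := by ring
    have hIu : I = Finset.Ico b (b + 2 ^ (k + 1)) ∪ Finset.Ico c (c + 2 ^ (k + 1)) := by
      ext i
      simp only [hI, Finset.mem_union, Finset.mem_Ico, hc]
      omega
    have hdisj : Disjoint (Finset.Ico b (b + 2 ^ (k + 1))) (Finset.Ico c (c + 2 ^ (k + 1))) :=
      Finset.Ico_disjoint_Ico_consecutive _ _ _
    have h1 := finrank_map_coordProj_union_le hdisj (Submodule.span ℂ (e '' Set.Ici (2 ^ k)))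
    rw [← hIu] at h1
    change G (2 ^ k) ≤ _ at h1
    -- The midpoint `c` sees only sites inside `I` within M < 2^{k+1} steps.
    have hlt : ∀ M, M < 2 ^ (k + 1) → G (M + 1) < G M := by
      intro M hM
      refine finrank_backwardOrbit_lt he (h0 c (by omega)) (fun m hm => hφ m hm c (by omega))
        fun w _ hw => tridiagonalMap_pow_apply_eq_zero a M fun i hi => hw i ?_
      have hM' : (M : ℤ) < 2 ^ (k + 1) := by exact_mod_cast hM
      rw [abs_le] at hi
      rw [hI, Finset.mem_Ico]
      omega
    have hdrop : ∀ l, l ≤ 2 ^ k → G (2 ^ k + l) + l ≤ G (2 ^ k) := by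
      intro l hl
      induction l with
      | zero => simp
      | succ l ihl =>
        have h2 := ihl (by omega)
        have h3 := hlt (2 ^ k + l) (by omega)
        change G (2 ^ k + l + 1) + (l + 1) ≤ G (2 ^ k)
        omega
    have h2 := hdrop _ le_rfl
    rw [← e2] at h2
    have h3 := ih b hb
    have h4 := ih c (by omega)
    change 4 * G (2 ^ (k + 1)) + _ ≤ _
    have h5 : (k + 1) * 2 ^ (k + 1 + 1) = k * 2 ^ (k + 1) + k * 2 ^ (k + 1) + 4 * 2 ^ k := by ring
    have h6 : 4 * (2 ^ (k + 1 + 1) * Module.finrank ℂ X) =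
        4 * (2 ^ (k + 1) * Module.finrank ℂ X) + 4 * (2 ^ (k + 1) * Module.finrank ℂ X) := by ring
    omega

/-- A backward orbit cannot be annihilated, except at time zero, at all points of a half-line. -/
theorem false_of_backwardOrbit_of_nonneg (he : ∀ m, tridiagonalMap a (e (m + 1)) = e m)
    {φ : ℤ → X →ₗ[ℂ] ℂ} (h0 : ∀ j, 0 ≤ j → φ j (e 0 j) ≠ 0)
    (hφ : ∀ m, 1 ≤ m → ∀ j, 0 ≤ j → φ j (e m j) = 0) : False := by
  -- At this scale the bound dim X - k/4 on the rank per site is negative.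
  have h := finrank_backwardOrbit_dyadic he h0 hφ (4 * Module.finrank ℂ X + 1) 0 le_rfl
  have h2 : 0 < 2 ^ (4 * Module.finrank ℂ X + 1 + 1) := by positivity
  nlinarith

/-- Either e_0 has no zero on one of the two half-lines from 0, the left one being handled by
reflection, or it has zeros on both sides of 0, which persist for all e_m and isolate a finite
interval. -/
theorem false_of_backwardOrbit (he : ∀ m, tridiagonalMap a (e (m + 1)) = e m)
    {φ : ℤ → X →ₗ[ℂ] ℂ} (h0 : e 0 0 ≠ 0) (hφ0 : ∀ j, e 0 j ≠ 0 → φ j (e 0 j) ≠ 0)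
    (hφ : ∀ m, 1 ≤ m → ∀ j, φ j (e m j) = 0) (hz : ∀ j, e 0 j = 0 → ∀ m, e m j = 0) : False := by
  by_cases hp : ∀ j, 0 ≤ j → e 0 j ≠ 0
  · exact false_of_backwardOrbit_of_nonneg he (fun j hj => hφ0 j (hp j hj)) fun m hm j _ => hφ m hm j
  by_cases hn : ∀ j, j ≤ 0 → e 0 j ≠ 0
  · refine false_of_backwardOrbit_of_nonneg (a := fun i j => a (-i) (-j))
      (e := fun m i => e m (-i)) (φ := fun j => φ (-j)) (fun m => ?_)
      (fun j hj => hφ0 (-j) (hn (-j) (by omega))) fun m hm j _ => hφ m hm (-j)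
    ext i
    rw [tridiagonalMap_apply, ← he m, tridiagonalMap_apply, show -(i - 1) = -i + 1 by ring,
      show -(i + 1) = -i - 1 by ring]
    abel
  push Not at hp hn
  obtain ⟨c, hc, hc0⟩ := hp
  obtain ⟨b, hb, hb0⟩ := hn
  refine false_of_backwardOrbit_of_vanish he (lt_of_le_of_ne hb ?_) (lt_of_le_of_ne hc ?_)
    (hz b hb0) (hz c hc0) (hφ0 0 h0) fun m hm => hφ m hm 0
  · rintro rfl; exact h0 hb0
  · rintro rfl; exact h0 hc0

end BackwardOrbit

/-! ### The uniform maximum principle on finite-dimensional coefficients -/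

section Localization

open scoped NNReal

/-- A pigeonhole principle: if each site failed at some offset, summing over sites and offsets would
contradict `h`. One comparison of totals thus controls `g` around a single site at all offsets at
once, with decaying quality. -/
theorem exists_le_mul_of_tsum_lt {p f g : ℤ → ℝ≥0∞} {K : ℝ≥0∞}
    (h : (∑' i, p i) * ∑' i, g i < K * ∑' i, f i) :
    ∃ j, f j ≠ 0 ∧ ∀ i, p i * g (j + i) ≤ K * f j := by
  by_contra! hcon
  refine h.not_ge ?_
  have h1 : ∀ j, K * f j ≤ ∑' i, p i * g (j + i) := by
    intro j
    by_cases hj : f j = 0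
    · rw [hj, mul_zero]; exact zero_le
    · obtain ⟨i, hi⟩ := hcon j hj
      exact hi.le.trans (ENNReal.le_tsum i)
  calc K * ∑' j, f j = ∑' j, K * f j := ENNReal.tsum_mul_left.symm
    _ ≤ ∑' j, ∑' i, p i * g (j + i) := ENNReal.tsum_le_tsum h1
    _ = ∑' i, ∑' j, p i * g (j + i) := ENNReal.tsum_comm
    _ = ∑' i, p i * ∑' j, g j := by
        refine tsum_congr fun i => ?_
        rw [ENNReal.tsum_mul_left]
        congr 1
        exact (Equiv.addRight i).tsum_eq g
    _ = _ := ENNReal.tsum_mul_right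

theorem exists_le_mul_of_hasSum_lt {p : ℤ → ℝ≥0} (hp : ∑' i, (p i : ℝ≥0∞) ≤ 1)
    {f g : ℤ → ℝ} (hf : ∀ j, 0 ≤ f j) (hg : ∀ j, 0 ≤ g j) {U W K : ℝ} (hfU : HasSum f U)
    (hgW : HasSum g W) (hK : 0 ≤ K) (h : W < K * U) :
    ∃ j, 0 < f j ∧ ∀ i, p i * g (j + i) ≤ K * f j := by
  obtain ⟨j, hj, hji⟩ := exists_le_mul_of_tsum_lt (p := fun i => (p i : ℝ≥0∞))
    (f := fun j => ENNReal.ofReal (f j)) (g := fun j => ENNReal.ofReal (g j))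
    (K := ENNReal.ofReal K) (by
      rw [← ENNReal.ofReal_tsum_of_nonneg hf hfU.summable,
        ← ENNReal.ofReal_tsum_of_nonneg hg hgW.summable, hfU.tsum_eq, hgW.tsum_eq,
        ← ENNReal.ofReal_mul hK]
      refine lt_of_le_of_lt (mul_le_of_le_one_left zero_le hp) ?_
      have hW : 0 ≤ W := hgW.nonneg hg
      exact (ENNReal.ofReal_lt_ofReal_iff (hW.trans_lt h)).2 h)
  refine ⟨j, by simpa using hj, fun i => ?_⟩
  have h1 := hji i
  rw [← ENNReal.ofReal_coe_nnreal, ← ENNReal.ofReal_mul (p i).coe_nonneg,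
    ← ENNReal.ofReal_mul hK, ENNReal.ofReal_le_ofReal_iff (mul_nonneg hK (hf j))] at h1
  exact h1

variable {X : Type*} [NormedAddCommGroup X] [NormedSpace ℂ X]

/-- The defect in the convexity of the squared norm, along `y`, at the midpoint `x`. -/
noncomputable def convexDefect (x y : X) : ℝ := ‖x + y‖ ^ 2 + ‖x - y‖ ^ 2 - 2 * ‖x‖ ^ 2

theorem convexDefect_nonneg (x y : X) : 0 ≤ convexDefect x y :=
  sub_nonneg.2 (two_mul_norm_sq_le x y)

theorem convexDefect_smul (c : ℂ) (x y : X) :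
    convexDefect (c • x) (c • y) = ‖c‖ ^ 2 * convexDefect x y := by
  simp only [convexDefect, ← smul_add, ← smul_sub, norm_smul, mul_pow]
  ring

theorem hasSum_convexDefect {Y : Type*} [NormedAddCommGroup Y] (x y : BiSeq Y) :
    HasSum (fun j => convexDefect (x j) (y j)) (convexDefect x y) :=
  (((x + y).hasSum_norm_sq).add ((x - y).hasSum_norm_sq)).sub (x.hasSum_norm_sq.mul_left 2)

theorem norm_sq_le_convexDefect (x y : X) : 2 * ‖y‖ ^ 2 ≤ convexDefect x y + 2 * ‖x‖ ^ 2 := by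
  have := two_mul_norm_sq_le' x y
  unfold convexDefect; linarith

/-- The parallelogram law for the scalars φ x and φ y leaves no room for φ y, since φ attains the
norm at `x`. -/
theorem apply_eq_zero_of_convexDefect_le {x y : X} (h : convexDefect x y ≤ 0) {φ : X →L[ℂ] ℂ}
    (hφ : ‖φ‖ ≤ 1) (hx : φ x = ‖x‖) : φ y = 0 := by
  have h1 : ‖φ x + φ y‖ ≤ ‖x + y‖ := by
    rw [← map_add]; exact (φ.le_of_opNorm_le hφ _).trans_eq (one_mul _)
  have h2 : ‖φ x - φ y‖ ≤ ‖x - y‖ := by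
    rw [← map_sub]; exact (φ.le_of_opNorm_le hφ _).trans_eq (one_mul _)
  have h3 := parallelogram_law_with_norm ℝ (φ x) (φ y)
  have h4 : ‖φ x‖ = ‖x‖ := by rw [hx, Complex.norm_real, norm_norm]
  rw [h4] at h3
  unfold convexDefect at h
  have h5 := pow_le_pow_left₀ (norm_nonneg _) h1 2
  have h6 := pow_le_pow_left₀ (norm_nonneg _) h2 2
  have h7 : ‖φ y‖ ^ 2 ≤ 0 := by nlinarith
  exact norm_eq_zero.1 (pow_eq_zero_iff (two_ne_zero)|>.1 (le_antisymm h7 (sq_nonneg _)))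

theorem pow_inverse_succ_apply {V : Type*} [NormedAddCommGroup V] [NormedSpace ℂ V]
    {B : V →L[ℂ] V} (hB : IsUnit B) (m : ℕ) (x : V) :
    B ((Ring.inverse B ^ (m + 1)) x) = (Ring.inverse B ^ m) x := by
  have : B * Ring.inverse B ^ (m + 1) = Ring.inverse B ^ m := by
    rw [pow_succ', ← mul_assoc, Ring.mul_inverse_cancel B hB, one_mul]
  exact congrArg (fun T : V →L[ℂ] V => T x) this

variable [CompleteSpace X] [Nontrivial X]

/-- An almost extremal tridiagonal operator has a normalised backward orbit whose convexity
defects are small near the origin. -/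
theorem exists_localized_backwardOrbit {r s : ℝ} (hr : 0 < r) (hs : 0 < s) {p : ℤ → ℝ≥0}
    (hp : ∑' i, (p i : ℝ≥0∞) ≤ 1) (n : ℕ) :
    ∃ δ > 0, ∀ B : BiSeq X →L[ℂ] BiSeq X, IsTridiagonal B →
      (∀ z : ℂ, ‖z‖ < r → s ≤ inverseGap (B - z • ContinuousLinearMap.id ℂ (BiSeq X))) →
      inverseGap B < s + δ →
      ∃ (a : ℤ → ℤ → X →L[ℂ] X) (e : ℕ → ℤ → X), (∀ i j, ‖a i j‖ ≤ ‖B‖) ∧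
        (∀ m i, e m i = a i (i - 1) (e (m + 1) (i - 1)) + a i i (e (m + 1) i)
          + a i (i + 1) (e (m + 1) (i + 1))) ∧
        ‖e 0 0‖ = 1 ∧ (∀ i, p i * ‖e 0 i‖ ^ 2 ≤ 3) ∧
        ∀ m, 1 ≤ m → m ≤ n → ∀ i,
          p i * (n * convexDefect (e 0 i) ((((r / 2 : ℝ) : ℂ) ^ m / 2) • e m i)) ≤ 3 := by
  -- This choice makes n² (s⁻² - ‖E 0‖²) < ‖E 0‖² once ‖E 0‖ > 1/(s + δ); the n defects, each
  -- weighted by n, then total less than 2‖E 0‖².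
  obtain ⟨δ, hδn, hδ⟩ : ∃ δ : ℝ, (n : ℝ) ^ 2 * (s + δ) ^ 2 < ((n : ℝ) ^ 2 + 1) * s ^ 2 ∧ 0 < δ := by
    have h1 : Tendsto (fun δ : ℝ => (n : ℝ) ^ 2 * (s + δ) ^ 2) (𝓝[>] 0)
        (𝓝 ((n : ℝ) ^ 2 * (s + 0) ^ 2)) :=
      (Continuous.tendsto (by fun_prop) 0).mono_left nhdsWithin_le_nhds
    have h2 : (n : ℝ) ^ 2 * (s + 0) ^ 2 < ((n : ℝ) ^ 2 + 1) * s ^ 2 := by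
      rw [add_zero]; nlinarith [pow_pos hs 2]
    exact ((h1.eventually_lt_const h2).and self_mem_nhdsWithin).exists
  refine ⟨δ, hδ, fun B hB hBz hlt => ?_⟩
  have hs0 : s ≤ inverseGap B := by simpa using hBz 0 (by simpa using hr)
  have hu : IsUnit B := isUnit_of_inverseGap_pos (hs.trans_le hs0)
  obtain ⟨x, hx, hxM⟩ := exists_norm_inverse_gt hu hlt
  set E : ℕ → BiSeq X := fun m => (Ring.inverse B ^ (m + 1)) x with hE
  set c : ℕ → ℂ := fun m => ((r / 2 : ℝ) : ℂ) ^ m / 2 with hc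
  have hE0 : E 0 = Ring.inverse B x := by simp [hE]
  set f : ℤ → ℝ := fun j => ‖E 0 j‖ ^ 2 with hf
  set d : ℕ → ℤ → ℝ := fun m j => convexDefect (E 0 j) (c m • E m j) with hd
  have hdn : ∀ m j, 0 ≤ d m j := fun m j => convexDefect_nonneg _ _
  have hds : ∀ m, HasSum (d m) (convexDefect (E 0) (c m • E m)) := fun m =>
    hasSum_convexDefect (E 0) (c m • E m)
  have hU : (s + δ)⁻¹ ^ 2 < ‖E 0‖ ^ 2 := by
    rw [hE0]; exact pow_lt_pow_left₀ hxM (by positivity) two_ne_zero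
  have hdle : ∀ m, 1 ≤ m → convexDefect (E 0) (c m • E m) ≤ 2 * s⁻¹ ^ 2 - 2 * ‖E 0‖ ^ 2 := by
    intro m hm
    -- Only ζ = ±1 is used: both ends of the segment have norm at most 1/s, while its midpoint E 0
    -- almost has that norm.
    have key : ∀ ζ : ℂ, ‖ζ‖ ≤ 1 → ‖E 0 + (ζ * c m) • E m‖ ^ 2 ≤ s⁻¹ ^ 2 := by
      intro ζ hζ
      have h1 := norm_inverse_add_smul_pow_le hs (half_pos hr) (half_lt_self hr) hBz hm hζ
      have h2 := ContinuousLinearMap.le_of_opNorm_le_of_le _ h1 hx.le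
      rw [mul_one] at h2
      refine pow_le_pow_left₀ (norm_nonneg _) (le_trans (le_of_eq ?_) h2) 2
      rw [hE0]
      simp only [hE, hc, ← mul_div_assoc]
      rfl
    have h1 := key 1 (by simp)
    have h2 := key (-1) (by simp)
    rw [one_mul] at h1
    rw [neg_mul, one_mul, neg_smul, ← sub_eq_add_neg] at h2
    unfold convexDefect; linarith
  -- Mass and weighted defects are put into one density, so that a single site controls all of them.
  have hgs : HasSum (fun j => f j + n * ∑ m ∈ Finset.Icc 1 n, d m j)
      (‖E 0‖ ^ 2 + n * ∑ m ∈ Finset.Icc 1 n, convexDefect (E 0) (c m • E m)) :=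
    ((E 0).hasSum_norm_sq).add ((hasSum_sum fun m _ => hds m).mul_left _)
  have hW : ‖E 0‖ ^ 2 + n * ∑ m ∈ Finset.Icc 1 n, convexDefect (E 0) (c m • E m)
      < 3 * ‖E 0‖ ^ 2 := by
    have h1 : ∑ m ∈ Finset.Icc 1 n, convexDefect (E 0) (c m • E m)
        ≤ n * (2 * s⁻¹ ^ 2 - 2 * ‖E 0‖ ^ 2) := by
      refine (Finset.sum_le_card_nsmul _ _ _ fun m hm => hdle m (Finset.mem_Icc.1 hm).1).trans ?_
      simp
    have h2 : (n : ℝ) ^ 2 * s⁻¹ ^ 2 < ((n : ℝ) ^ 2 + 1) * (s + δ)⁻¹ ^ 2 := by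
      rw [inv_pow, inv_pow, ← div_eq_mul_inv, ← div_eq_mul_inv, div_lt_div_iff₀ (by positivity)
        (by positivity)]
      exact hδn
    have h3 := mul_le_mul_of_nonneg_left h1 (Nat.cast_nonneg (α := ℝ) n)
    have h4 := mul_lt_mul_of_pos_left hU (show 0 < (n : ℝ) ^ 2 + 1 by positivity)
    nlinarith
  obtain ⟨j, hj, hji⟩ := exists_le_mul_of_hasSum_lt hp (fun j => sq_nonneg _)
    (fun j => add_nonneg (sq_nonneg _) (mul_nonneg (Nat.cast_nonneg _)
      (Finset.sum_nonneg fun m _ => hdn m j))) (E 0).hasSum_norm_sq hgs (by norm_num) hW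
  have hj' : 0 < ‖E 0 j‖ := by
    by_contra h
    rw [le_antisymm (not_lt.1 h) (norm_nonneg _)] at hj
    simp at hj
  -- Recentre at `j` and normalise the value of E 0 there to norm one.
  set t : ℂ := ((‖E 0 j‖⁻¹ : ℝ) : ℂ) with ht
  have htn : ‖t‖ = ‖E 0 j‖⁻¹ := by
    rw [ht, Complex.norm_real, norm_inv, norm_norm]
  have hscale : ∀ i y, p i * y ≤ 3 * ‖E 0 j‖ ^ 2 → p i * (‖t‖ ^ 2 * y) ≤ 3 := by
    intro i y hy
    rw [htn, mul_left_comm, inv_pow, inv_mul_le_iff₀ (by positivity), mul_comm _ (3 : ℝ)]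
    exact hy
  refine ⟨fun i l => matrixEntry B (j + i) (j + l), fun m i => t • E m (j + i),
    fun i l => norm_matrixEntry_le B _ _, fun m i => ?_, ?_, fun i => ?_, fun m hm hmn i => ?_⟩
  · have h1 : B (E (m + 1)) = E m := pow_inverse_succ_apply hu _ _
    change t • E m (j + i) = matrixEntry B (j + i) (j + (i - 1)) (t • E (m + 1) (j + (i - 1)))
      + matrixEntry B (j + i) (j + i) (t • E (m + 1) (j + i))
      + matrixEntry B (j + i) (j + (i + 1)) (t • E (m + 1) (j + (i + 1)))
    rw [← h1, hB.apply_eq, smul_add, smul_add, map_smul, map_smul, map_smul]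
    rw [add_sub_assoc, add_assoc j i 1]
  · change ‖t • E 0 (j + 0)‖ = 1
    rw [add_zero, norm_smul, htn, inv_mul_cancel₀ hj'.ne']
  · change p i * ‖t • E 0 (j + i)‖ ^ 2 ≤ 3
    rw [norm_smul, mul_pow]
    refine hscale i _ (le_trans ?_ (hji i))
    refine mul_le_mul_of_nonneg_left ?_ (p i).coe_nonneg
    exact le_add_of_nonneg_right (mul_nonneg (Nat.cast_nonneg _)
      (Finset.sum_nonneg fun m _ => hdn m _))
  · change p i * (n * convexDefect (t • E 0 (j + i)) (c m • t • E m (j + i))) ≤ 3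
    rw [smul_comm, convexDefect_smul, mul_left_comm (n : ℝ)]
    refine hscale i _ (le_trans ?_ (hji i))
    refine mul_le_mul_of_nonneg_left ?_ (p i).coe_nonneg
    refine le_trans (mul_le_mul_of_nonneg_left ?_ (Nat.cast_nonneg _))
      (le_add_of_nonneg_left (sq_nonneg _))
    exact Finset.single_le_sum (f := fun m => d m (j + i)) (fun m _ => hdn m _)
      (Finset.mem_Icc.2 ⟨hm, hmn⟩)

/-- A fixed ultrafilter gives simultaneous limits of all entries and all orbit coordinates, in place
of a diagonal subsequence. -/
theorem exists_tendsto_hyperfilter {Y : Type*} [PseudoMetricSpace Y] [ProperSpace Y] {x : ℕ → Y}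
    {y : Y} {K : ℝ} (h : ∀ᶠ n in atTop, dist (x n) y ≤ K) :
    ∃ z, Tendsto x (hyperfilter ℕ : Filter ℕ) (𝓝 z) := by
  have h1 : ∀ᶠ n in (hyperfilter ℕ : Filter ℕ), x n ∈ Metric.closedBall y K :=
    Filter.Eventually.filter_mono (Nat.hyperfilter_le_atTop) h
  obtain ⟨z, -, hz⟩ := (isCompact_closedBall y K).ultrafilter_le_nhds ((hyperfilter ℕ).map x)
    (le_principal_iff.2 h1)
  exact ⟨z, hz⟩

/-- If no δ worked, the localised backward orbits for n → ∞ would have bounded coordinates and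
entries, and so an ultralimit. In the limit all defects vanish, so a functional norming e_0 at a
site kills every later e_m there, which the dimension count excludes. -/
theorem uniformMaximumPrinciple_of_finiteDimensional [FiniteDimensional ℂ X] :
    UniformMaximumPrinciple {B : BiSeq X →L[ℂ] BiSeq X | IsTridiagonal B} := by
  intro C r s hr hs
  obtain ⟨p, hp, hpsum⟩ := ENNReal.exists_pos_sum_of_countable (one_ne_zero (α := ℝ≥0∞)) ℤ
  by_contra! hcon
  have hex : ∀ n : ℕ, ∃ (a : ℤ → ℤ → X →L[ℂ] X) (e : ℕ → ℤ → X), (∀ i j, ‖a i j‖ ≤ C) ∧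
        (∀ m i, e m i = a i (i - 1) (e (m + 1) (i - 1)) + a i i (e (m + 1) i)
          + a i (i + 1) (e (m + 1) (i + 1))) ∧
        ‖e 0 0‖ = 1 ∧ (∀ i, p i * ‖e 0 i‖ ^ 2 ≤ 3) ∧
        ∀ m, 1 ≤ m → m ≤ n → ∀ i,
          p i * (n * convexDefect (e 0 i) ((((r / 2 : ℝ) : ℂ) ^ m / 2) • e m i)) ≤ 3 := by
    intro n
    obtain ⟨δ, hδ, h⟩ := exists_localized_backwardOrbit (X := X) hr hs hpsum.le n
    obtain ⟨B, hB, hBC, hBz, hBδ⟩ := hcon δ hδ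
    obtain ⟨a, e, h1, h2⟩ := h B hB hBz hBδ
    exact ⟨a, e, fun i j => (h1 i j).trans hBC, h2⟩
  choose a e ha he h1 hp0 hd using hex
  set c : ℕ → ℂ := fun m => ((r / 2 : ℝ) : ℂ) ^ m / 2 with hc
  have hc0 : ∀ m, c m ≠ 0 := fun m =>
    div_ne_zero (pow_ne_zero _ (Complex.ofReal_ne_zero.2 (half_pos hr).ne')) two_ne_zero
  have hpr : ∀ i, 0 < (p i : ℝ) := fun i => NNReal.coe_pos.2 (hp i)
  have := FiniteDimensional.proper ℂ X
  have := FiniteDimensional.proper ℂ (X →L[ℂ] X)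
  have h0le : ∀ n i, ‖e n 0 i‖ ^ 2 ≤ 3 / p i := fun n i => by
    rw [le_div_iff₀' (hpr i)]; exact hp0 n i
  have hdle : ∀ m, 1 ≤ m → ∀ i, ∀ᶠ n : ℕ in atTop,
      convexDefect (e n 0 i) (c m • e n m i) ≤ 3 / p i / n := by
    intro m hm i
    filter_upwards [eventually_ge_atTop m] with n hn
    rw [le_div_iff₀' (Nat.cast_pos.2 (by omega)), le_div_iff₀' (hpr i)]
    exact hd n m hm hn i
  have hbd : ∀ m i, ∃ K, ∀ᶠ n in atTop, dist (e n m i) 0 ≤ K := by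
    intro m i
    rcases Nat.eq_zero_or_pos m with rfl | hm
    · refine ⟨Real.sqrt (3 / p i), Eventually.of_forall fun n => ?_⟩
      rw [dist_zero_right]
      exact Real.le_sqrt_of_sq_le (h0le n i)
    · refine ⟨Real.sqrt (9 / p i) / ‖c m‖, ?_⟩
      filter_upwards [hdle m hm i, eventually_ge_atTop 1] with n hn hn1
      rw [dist_zero_right, le_div_iff₀ (norm_pos_iff.2 (hc0 m)), mul_comm, ← norm_smul]
      refine Real.le_sqrt_of_sq_le ?_
      have e1 := norm_sq_le_convexDefect (e n 0 i) (c m • e n m i)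
      have e2 : 3 / p i / n ≤ 3 / (p i : ℝ) :=
        div_le_self (div_nonneg (by norm_num) (hpr i).le) (by exact_mod_cast hn1)
      have e3 := h0le n i
      have e4 : 9 / (p i : ℝ) = 3 * (3 / p i) := by ring
      have e5 : 0 ≤ 3 / (p i : ℝ) := div_nonneg (by norm_num) (hpr i).le
      rw [e4]; linarith
  choose K hK using hbd
  choose e' he' using fun m i => exists_tendsto_hyperfilter (hK m i)
  choose a' ha' using fun i j => exists_tendsto_hyperfilter (x := fun n => a n i j) (y := 0)
    (K := C) (Eventually.of_forall fun n => by rw [dist_zero_right]; exact ha n i j)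
  have hT : ∀ m, tridiagonalMap (fun i j => (a' i j : X →ₗ[ℂ] X)) (e' (m + 1)) = e' m := by
    intro m
    ext i
    refine tendsto_nhds_unique ?_ (he' m i)
    have : (fun n => e n m i) = fun n => a n i (i - 1) (e n (m + 1) (i - 1))
        + a n i i (e n (m + 1) i) + a n i (i + 1) (e n (m + 1) (i + 1)) := funext fun n => he n m i
    rw [this]
    have hap : ∀ k, Tendsto (fun n => a n i k (e n (m + 1) k)) (hyperfilter ℕ : Filter ℕ)
        (𝓝 (a' i k (e' (m + 1) k))) := fun k =>
      ((isBoundedBilinearMap_apply (𝕜 := ℂ) (E := X) (F := X)).continuous.tendsto _).comp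
        ((ha' i k).prodMk_nhds (he' (m + 1) k))
    exact ((hap _).add (hap _)).add (hap _)
  have hd' : ∀ m, 1 ≤ m → ∀ i, convexDefect (e' 0 i) (c m • e' m i) ≤ 0 := by
    intro m hm i
    have l1 : Tendsto (fun n => convexDefect (e n 0 i) (c m • e n m i))
        (hyperfilter ℕ : Filter ℕ) (𝓝 (convexDefect (e' 0 i) (c m • e' m i))) :=
      ((((he' 0 i).add ((he' m i).const_smul (c m))).norm.pow 2).add
        (((he' 0 i).sub ((he' m i).const_smul (c m))).norm.pow 2)).sub
        (((he' 0 i).norm.pow 2).const_mul 2)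
    have l2 : Tendsto (fun n : ℕ => 3 / (p i : ℝ) / n) (hyperfilter ℕ : Filter ℕ) (𝓝 0) :=
      (tendsto_const_div_atTop_nhds_zero_nat _).mono_left Nat.hyperfilter_le_atTop
    exact le_of_tendsto_of_tendsto l1 l2 ((hdle m hm i).filter_mono Nat.hyperfilter_le_atTop)
  have h1' : ‖e' 0 0‖ = 1 :=
    tendsto_nhds_unique (he' 0 0).norm (by simp only [h1]; exact tendsto_const_nhds)
  choose φ hφ1 hφ2 using fun i => exists_dual_vector'' ℂ (e' 0 i)
  refine false_of_backwardOrbit (e := e') (φ := fun j => (φ j : X →ₗ[ℂ] ℂ)) hT ?_ ?_ ?_ ?_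
  · intro h; rw [h, norm_zero] at h1'; exact zero_ne_one h1'
  · intro j hj h
    have : φ j (e' 0 j) = 0 := h
    rw [hφ2] at this
    exact hj (norm_eq_zero.1 (Complex.ofReal_eq_zero.1 this))
  · intro m hm j
    have h2 := apply_eq_zero_of_convexDefect_le (hd' m hm j) (hφ1 j) (hφ2 j)
    rw [map_smul, smul_eq_mul] at h2
    exact (mul_eq_zero.1 h2).resolve_left (hc0 m)
  -- With e_0 zero at the site, the defect is 2‖c e_m‖², so e_m vanishes there too.
  · intro j hj m
    rcases Nat.eq_zero_or_pos m with rfl | hm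
    · exact hj
    · have h2 := norm_sq_le_convexDefect (e' 0 j) (c m • e' m j)
      have h3 := hd' m hm j
      rw [hj, norm_zero] at h2
      rw [hj] at h3
      have h4 : ‖c m • e' m j‖ ^ 2 ≤ 0 := by nlinarith
      have h5 := norm_eq_zero.1 (pow_eq_zero_iff (two_ne_zero)|>.1 (le_antisymm h4 (sq_nonneg _)))
      exact (smul_eq_zero.1 h5).resolve_left (hc0 m)

theorem GlobevnikProperty.uniformMaximumPrinciple (hX : GlobevnikProperty X) :
    UniformMaximumPrinciple {B : BiSeq X →L[ℂ] BiSeq X | IsTridiagonal B} := by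
  rcases hX with h | h | h
  · exact uniformMaximumPrinciple_of_finiteDimensional
  · exact h.biSeq.uniformMaximumPrinciple _
  · exact h.dual_biSeq.uniformMaximumPrinciple_of_dual _

end Localization

/-! ### Extension of operators from a window -/

section WindowExtension

variable {X : Type*} [NormedAddCommGroup X] [NormedSpace ℂ X]

theorem windowEmbed_apply_notMem (n : ℕ) (k : ℤ) (y : PiLp 2 (fun _ : Fin n => X)) {j : ℤ}
    (h : ¬ (k + 1 ≤ j ∧ j ≤ k + n)) : windowEmbed X n k y j = 0 := by
  rw [← windowRestrict_embed n k y, windowEmbed_restrict, windowMul_apply_notMem _ _ _ _ h]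

theorem norm_windowEmbed_add_sq (n : ℕ) (k : ℤ) (y : PiLp 2 (fun _ : Fin n => X)) {x : BiSeq X}
    (hx : windowRestrict X n k x = 0) :
    ‖windowEmbed X n k y + x‖ ^ 2 = ‖y‖ ^ 2 + ‖x‖ ^ 2 := by
  rw [← norm_windowEmbed_apply n k y]
  have e : (fun j => ‖(windowEmbed X n k y + x) j‖ ^ 2) =
      fun j => ‖windowEmbed X n k y j‖ ^ 2 + ‖x j‖ ^ 2 := by
    funext j
    rw [lp.coeFn_add, Pi.add_apply]
    by_cases h : k + 1 ≤ j ∧ j ≤ k + n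
    · obtain ⟨i, hi⟩ : ∃ i : Fin n, k + 1 + (i : ℤ) = j :=
        ⟨⟨(j - k - 1).toNat, by omega⟩, by simp only; omega⟩
      have hj : x j = 0 := by
        rw [← hi, ← windowRestrict_apply, hx]; rfl
      rw [hj, add_zero, norm_zero]; simp
    · rw [windowEmbed_apply_notMem _ _ _ h, zero_add, norm_zero]; simp
  have h := BiSeq.hasSum_norm_sq (windowEmbed X n k y + x)
  rw [e] at h
  exact h.unique ((BiSeq.hasSum_norm_sq (windowEmbed X n k y)).add (BiSeq.hasSum_norm_sq x))

/-- The operator that acts as `G` on a window and as the scalar `t` outside of it. -/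
noncomputable def windowExtend {n : ℕ} (k : ℤ)
    (G : PiLp 2 (fun _ : Fin n => X) →L[ℂ] PiLp 2 (fun _ : Fin n => X)) (t : ℂ) :
    BiSeq X →L[ℂ] BiSeq X :=
  (windowEmbed X n k).comp (G.comp (windowRestrict X n k)) +
    t • (ContinuousLinearMap.id ℂ (BiSeq X) - (windowEmbed X n k).comp (windowRestrict X n k))

variable {n : ℕ} {k : ℤ} {G H : PiLp 2 (fun _ : Fin n => X) →L[ℂ] PiLp 2 (fun _ : Fin n => X)}
  {t u : ℂ}

theorem windowExtend_apply (x : BiSeq X) : windowExtend k G t x =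
    windowEmbed X n k (G (windowRestrict X n k x)) +
      t • (x - windowEmbed X n k (windowRestrict X n k x)) := rfl

theorem windowRestrict_sub_embed (x : BiSeq X) :
    windowRestrict X n k (x - windowEmbed X n k (windowRestrict X n k x)) = 0 := by
  rw [map_sub, windowRestrict_embed, sub_self]

theorem windowRestrict_windowExtend (x : BiSeq X) :
    windowRestrict X n k (windowExtend k G t x) = G (windowRestrict X n k x) := by
  rw [windowExtend_apply, map_add, map_smul, windowRestrict_sub_embed, smul_zero, add_zero,
    windowRestrict_embed]

theorem windowExtend_windowEmbed (y : PiLp 2 (fun _ : Fin n => X)) :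
    windowExtend k G t (windowEmbed X n k y) = windowEmbed X n k (G y) := by
  rw [windowExtend_apply, windowRestrict_embed, sub_self, smul_zero, add_zero]

theorem windowExtend_mul :
    windowExtend k G t * windowExtend k H u = windowExtend k (G * H) (t * u) := by
  ext1 x
  change windowExtend k G t (windowExtend k H u x) = _
  rw [windowExtend_apply, windowRestrict_windowExtend, windowExtend_apply, windowExtend_apply,
    add_sub_cancel_left, smul_smul]
  rfl

theorem windowExtend_one : windowExtend k (1 : PiLp 2 (fun _ : Fin n => X) →L[ℂ] _) 1 = 1 := by
  ext1 x
  rw [windowExtend_apply, one_smul]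
  exact add_sub_cancel _ _

theorem windowExtend_sub_smul (z : ℂ) :
    windowExtend k G t - z • ContinuousLinearMap.id ℂ (BiSeq X) =
      windowExtend k (G - z • ContinuousLinearMap.id ℂ _) (t - z) := by
  ext1 x
  change windowExtend k G t x - z • x = _
  rw [windowExtend_apply, windowExtend_apply]
  change _ = windowEmbed X n k (G (windowRestrict X n k x) - z • windowRestrict X n k x) + _
  rw [map_sub, map_smul, sub_smul, smul_sub, smul_sub]
  abel

theorem isUnit_windowExtend (hG : IsUnit G) (ht : t ≠ 0) : IsUnit (windowExtend k G t) := by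
  refine ⟨⟨windowExtend k G t, windowExtend k (Ring.inverse G) t⁻¹, ?_, ?_⟩, rfl⟩
  · rw [windowExtend_mul, Ring.mul_inverse_cancel _ hG, mul_inv_cancel₀ ht, windowExtend_one]
  · rw [windowExtend_mul, Ring.inverse_mul_cancel _ hG, inv_mul_cancel₀ ht, windowExtend_one]

theorem norm_windowExtend_sq (x : BiSeq X) : ‖windowExtend k G t x‖ ^ 2 =
    ‖G (windowRestrict X n k x)‖ ^ 2 +
      ‖t‖ ^ 2 * ‖x - windowEmbed X n k (windowRestrict X n k x)‖ ^ 2 := by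
  rw [windowExtend_apply, norm_windowEmbed_add_sq _ _ _ (by
    rw [map_smul, windowRestrict_sub_embed, smul_zero]), norm_smul, mul_pow]

theorem norm_windowExtend_le : ‖windowExtend k G t‖ ≤ ‖G‖ + 2 * ‖t‖ := by
  have h1 := norm_windowEmbed_le (X := X) n k
  have h2 := norm_windowRestrict_le (X := X) n k
  refine (norm_add_le _ _).trans (add_le_add ?_ ?_)
  · refine (ContinuousLinearMap.opNorm_comp_le _ _).trans ?_
    have h3 := ContinuousLinearMap.opNorm_comp_le G (windowRestrict X n k)
    calc _ ≤ 1 * (‖G‖ * 1) := mul_le_mul h1 (h3.trans (by gcongr)) (norm_nonneg _) zero_le_one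
      _ = ‖G‖ := by ring
  · rw [norm_smul, mul_comm]
    refine mul_le_mul_of_nonneg_right ((norm_sub_le _ _).trans ?_) (norm_nonneg _)
    have h3 := ContinuousLinearMap.opNorm_comp_le (windowEmbed X n k) (windowRestrict X n k)
    have h4 := mul_le_mul h1 h2 (norm_nonneg _) zero_le_one
    have h5 := ContinuousLinearMap.norm_id_le (𝕜 := ℂ) (E := BiSeq X)
    linarith

/-- The extension is block diagonal for an orthogonal ℓ² splitting, so lower bounds for the two
blocks combine. -/
theorem le_inverseGap_windowExtend [Nontrivial X] {s : ℝ} (hs : 0 < s) (hG : s ≤ inverseGap G)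
    (ht : s ≤ ‖t‖) : s ≤ inverseGap (windowExtend k G t) := by
  have hu := isUnit_of_inverseGap_pos (hs.trans_le hG)
  refine le_inverseGap_of_forall (isUnit_windowExtend hu (norm_pos_iff.1 (hs.trans_le ht))) hs
    fun x => ?_
  refine le_of_sq_le_sq ?_ (norm_nonneg _)
  have hx := norm_windowEmbed_add_sq n k (windowRestrict X n k x)
    (windowRestrict_sub_embed (n := n) (k := k) x)
  rw [add_sub_cancel] at hx
  rw [norm_windowExtend_sq, mul_pow, hx, mul_add]
  refine add_le_add ?_ (mul_le_mul_of_nonneg_right (pow_le_pow_left₀ hs.le ht 2) (sq_nonneg _))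
  rw [← mul_pow]
  exact pow_le_pow_left₀ (by positivity) ((mul_le_mul_of_nonneg_right hG (norm_nonneg _)).trans
    (inverseGap_mul_norm_le G _)) 2

theorem le_inverseGap_of_windowExtend [NeZero n] [Nontrivial X] {s : ℝ} (hs : 0 < s)
    (hG : IsUnit G) (h : s ≤ inverseGap (windowExtend k G t)) : s ≤ inverseGap G := by
  refine le_inverseGap_of_forall hG hs fun y => ?_
  rw [← norm_windowEmbed_apply n k y, ← norm_windowEmbed_apply n k (G y),
    ← windowExtend_windowEmbed (t := t)]
  exact (mul_le_mul_of_nonneg_right h (norm_nonneg _)).trans (inverseGap_mul_norm_le _ _)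

theorem isTridiagonal_windowExtend {A : BiSeq X →L[ℂ] BiSeq X} (hA : IsTridiagonal A) (n : ℕ)
    (k : ℤ) (t : ℂ) : IsTridiagonal (windowExtend k (finiteSection A n k) t) := by
  intro i j hij
  have hne : i ≠ j := by rintro rfl; simp at hij
  have hP : ∀ (y : BiSeq X) (l : ℤ), y l = 0 →
      windowEmbed X n k (windowRestrict X n k y) l = 0 := by
    intro y l hy
    rw [windowEmbed_restrict]
    by_cases hl : k + 1 ≤ l ∧ l ≤ k + n
    · rw [windowMul_apply_mem _ _ _ _ hl.1 hl.2, hy, smul_zero]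
    · exact windowMul_apply_notMem _ _ _ _ hl
  ext x
  rw [matrixEntry_apply, zero_apply]
  set y : BiSeq X := lp.singleContinuousLinearMap ℂ (fun _ : ℤ => X) 2 j x with hy
  have hyl : ∀ l, l ≠ j → y l = 0 := fun l hl => by rw [hy, BiSeq.single_apply, if_neg hl]
  have h1 : windowExtend k (finiteSection A n k) t y i =
      windowEmbed X n k (windowRestrict X n k
        (A (windowEmbed X n k (windowRestrict X n k y)))) i +
      t • (y i - windowEmbed X n k (windowRestrict X n k y) i) := by
    rw [finiteSection_eq]; rfl
  rw [h1, hyl i hne, hP y i (hyl i hne), sub_zero, smul_zero, add_zero]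
  refine hP _ _ ?_
  rw [hA.apply_eq, hP y _ (hyl _ ?_), hP y _ (hyl _ ?_), hP y _ (hyl _ ?_)]
  · simp
  all_goals rintro rfl; simp at hij

theorem norm_finiteSection_le (A : BiSeq X →L[ℂ] BiSeq X) (n : ℕ) (k : ℤ) :
    ‖finiteSection A n k‖ ≤ ‖A‖ := by
  rw [finiteSection_eq]
  refine (ContinuousLinearMap.opNorm_comp_le _ _).trans ?_
  have h3 := ContinuousLinearMap.opNorm_comp_le A (windowEmbed X n k)
  calc _ ≤ 1 * (‖A‖ * 1) := mul_le_mul (norm_windowRestrict_le n k)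
        (h3.trans (mul_le_mul_of_nonneg_left (norm_windowEmbed_le n k) (norm_nonneg _)))
        (norm_nonneg _) zero_le_one
    _ = ‖A‖ := by ring

theorem finiteSection_sub_smul_eq (A : BiSeq X →L[ℂ] BiSeq X) (n : ℕ) (k : ℤ) (z : ℂ) :
    finiteSection A n k - z • ContinuousLinearMap.id ℂ _ =
      finiteSection (A - z • ContinuousLinearMap.id ℂ _) n k := by
  rw [finiteSection_sub_smul, finiteSection_eq]

theorem sub_add_smul_id {V : Type*} [NormedAddCommGroup V] [NormedSpace ℂ V] (B : V →L[ℂ] V)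
    (w z : ℂ) : B - (z + w) • ContinuousLinearMap.id ℂ V =
      B - w • ContinuousLinearMap.id ℂ V - z • ContinuousLinearMap.id ℂ V := by
  rw [add_comm, add_smul, sub_sub]

theorem finiteSection_sub_add_smul (A : BiSeq X →L[ℂ] BiSeq X) (n : ℕ) (k : ℤ) (w z : ℂ) :
    finiteSection A n k - (z + w) • ContinuousLinearMap.id ℂ _ =
      finiteSection (A - w • ContinuousLinearMap.id ℂ _) n k - z • ContinuousLinearMap.id ℂ _ :=
  (sub_add_smul_id _ _ _).trans (congrArg (· - z • ContinuousLinearMap.id ℂ _)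
    (finiteSection_sub_smul_eq A n k w))

theorem pow_card_le_norm_prod {r : ℝ} (hr : 0 ≤ r) (m : Multiset ℂ) (h : ∀ μ ∈ m, r ≤ ‖μ‖) :
    r ^ m.card ≤ ‖m.prod‖ := by
  induction m using Multiset.induction_on with
  | empty => simp
  | cons a m ih =>
    rw [Multiset.card_cons, Multiset.prod_cons, norm_mul, pow_succ']
    exact mul_le_mul (h a (Multiset.mem_cons_self a m))
      (ih fun μ hμ => h μ (Multiset.mem_cons_of_mem hμ)) (pow_nonneg hr _) (norm_nonneg _)

theorem tauClosedSet_subset_closure {A : BiSeq X →L[ℂ] BiSeq X} {η : ℝ} {n : ℕ} {ε δ : ℝ} (hε : 0 ≤ ε) (h : ε < δ)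
    (hη : ∀ k, openPseudospectrum (finiteSection A n k) δ ⊆ openPseudospectrum A (δ + η)) :
    tauClosedSet A n ε ⊆ closure (openPseudospectrum A (δ + η)) :=
  closure_mono (Set.iUnion_subset fun k => (closedPseudospectrum_subset_open hε h).trans (hη k))

end WindowExtension

/-! ### Closed pseudospectral inclusion and Hausdorff convergence -/

section SpectralInclusion

variable {X : Type*} [NormedAddCommGroup X] [NormedSpace ℂ X] [CompleteSpace X] [Nontrivial X]
  {A : BiSeq X →L[ℂ] BiSeq X}

/-- The point is that δ does not depend on k: all extended sections are tridiagonal operators on the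
same space with a common norm bound. -/
theorem exists_le_inverseGap_finiteSection (hX : GlobevnikProperty X) (hA : IsTridiagonal A)
    {n : ℕ} (hn : 1 ≤ n) {r s : ℝ} (hr : 0 < r) (hs : 0 < s) {w : ℂ}
    (h : ∀ k z, ‖z - w‖ < r →
      s ≤ inverseGap (finiteSection A n k - z • ContinuousLinearMap.id ℂ _)) :
    ∃ δ > 0, ∀ k, s + δ ≤ inverseGap (finiteSection A n k - w • ContinuousLinearMap.id ℂ _) := by
  have : NeZero n := ⟨by omega⟩
  set A' := A - w • ContinuousLinearMap.id ℂ (BiSeq X) with hA'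
  -- With |t| = r + s, the scalar part satisfies |t - z| ≥ s on the whole disc |z| < r.
  set t : ℂ := ((r + s : ℝ) : ℂ) with ht
  have htn : ‖t‖ = r + s := by
    rw [ht, Complex.norm_real, Real.norm_eq_abs, abs_of_pos (by positivity)]
  obtain ⟨δ, hδ, hB⟩ := hX.uniformMaximumPrinciple (‖A'‖ + 2 * ‖t‖) r s hr hs
  refine ⟨δ, hδ, fun k => ?_⟩
  have hz : ∀ z : ℂ, ‖z‖ < r →
      s ≤ inverseGap (finiteSection A' n k - z • ContinuousLinearMap.id ℂ _) := by
    intro z hz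
    have h1 := h k (z + w) (by rwa [add_sub_cancel_right])
    rwa [finiteSection_sub_add_smul] at h1
  have h0 : s ≤ inverseGap (finiteSection A' n k) := by
    have h1 := h k w (by simpa using hr)
    rwa [finiteSection_sub_smul_eq] at h1
  rw [finiteSection_sub_smul_eq]
  refine le_inverseGap_of_windowExtend (k := k) (t := t) (by positivity)
    (isUnit_of_inverseGap_pos (hs.trans_le h0)) ?_
  refine hB _ (isTridiagonal_windowExtend (hA.sub_smul w) n k t)
    (norm_windowExtend_le.trans (add_le_add_left (norm_finiteSection_le _ _ _) _)) fun z hzr => ?_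
  rw [windowExtend_sub_smul]
  refine le_inverseGap_windowExtend hs (hz z hzr) ?_
  have := norm_sub_norm_le t z
  linarith

/-- In finite dimensions, a bounded family of operators whose spectra stay away from `0` is
uniformly invertible. -/
theorem exists_le_inverseGap_of_finiteDimensional {Y : Type*} [NormedAddCommGroup Y]
    [NormedSpace ℂ Y] [FiniteDimensional ℂ Y] [Nontrivial Y] (C : ℝ) {r : ℝ} (hr : 0 < r) :
    ∃ δ > 0, ∀ B : Y →L[ℂ] Y, ‖B‖ ≤ C →
      (∀ z : ℂ, ‖z‖ < r → IsUnit (B - z • ContinuousLinearMap.id ℂ Y)) → δ ≤ inverseGap B := by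
  have := FiniteDimensional.complete ℂ Y
  have := FiniteDimensional.proper ℂ (Y →L[ℂ] Y)
  -- The determinant is the product of the eigenvalues, none of which lies in the disc of radius
  -- `r`. This bound passes to limits, unlike invertibility.
  have hdet : ∀ B : Y →L[ℂ] Y,
      (∀ z : ℂ, ‖z‖ < r → IsUnit (B - z • ContinuousLinearMap.id ℂ Y)) →
      r ^ Module.finrank ℂ Y ≤ ‖B.det‖ := by
    intro B hB
    set f : Y →ₗ[ℂ] Y := (B : Y →ₗ[ℂ] Y) with hf
    have hsplit : f.charpoly.Splits := IsAlgClosed.splits _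
    have hmonic := LinearMap.charpoly_monic f
    have hcard : f.charpoly.roots.card = Module.finrank ℂ Y := by
      rw [← hsplit.natDegree_eq_card_roots, LinearMap.charpoly_natDegree]
    have h1 : B.det = f.charpoly.roots.prod := by
      change LinearMap.det f = _
      rw [LinearMap.det_eq_sign_charpoly_coeff, hsplit.coeff_zero_eq_prod_roots_of_monic hmonic,
        LinearMap.charpoly_natDegree, ← mul_assoc, ← mul_pow]
      simp
    have h2 : ∀ μ ∈ f.charpoly.roots, r ≤ ‖μ‖ := by
      intro μ hμ
      by_contra! hlt
      have hroot := Polynomial.isRoot_of_mem_roots hμ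
      have hev := (Module.End.hasEigenvalue_iff_isRoot_charpoly f μ).2 hroot
      obtain ⟨v, hv⟩ := hev.exists_hasEigenvector
      have hBv : (B - μ • ContinuousLinearMap.id ℂ Y) v = 0 := by
        have : B v = μ • v := hv.apply_eq_smul
        change B v - μ • v = 0
        rw [this, sub_self]
      have h3 := Ring.inverse_mul_cancel _ (hB μ hlt)
      have h4 := congrArg (fun T : Y →L[ℂ] Y => T v) h3
      change Ring.inverse (B - μ • ContinuousLinearMap.id ℂ Y) ((B - μ • ContinuousLinearMap.id ℂ Y) v) = v at h4
      rw [hBv, map_zero] at h4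
      exact hv.2 h4.symm
    rw [h1, ← hcard]
    exact pow_card_le_norm_prod hr.le _ h2
  by_contra! hcon
  have hpos : ∀ n : ℕ, (0 : ℝ) < 1 / ((n : ℝ) + 1) := fun n => by positivity
  choose B hBC hBu hBδ using fun n : ℕ => hcon _ (hpos n)
  obtain ⟨B', hB'⟩ := exists_tendsto_hyperfilter (x := B) (y := 0) (K := C)
    (Eventually.of_forall fun n => by rw [dist_zero_right]; exact hBC n)
  have h1 : r ^ Module.finrank ℂ Y ≤ ‖B'.det‖ :=
    ge_of_tendsto ((ContinuousLinearMap.continuous_det.tendsto B').comp hB').norm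
      (Eventually.of_forall fun n => hdet _ (hBu n))
  have hunit : IsUnit B' := by
    rw [ContinuousLinearMap.isUnit_iff_isUnit_toLinearMap, LinearMap.isUnit_iff_isUnit_det,
      isUnit_iff_ne_zero]
    intro h0
    have h3 : B'.det = 0 := h0
    rw [h3, norm_zero] at h1
    exact (pow_pos hr _).not_ge h1
  have hgap : 0 < inverseGap B' := by
    rw [inverseGap_of_isUnit hunit]; exact inv_pos.2 (norm_inverse_pos hunit)
  have h4 := hB'.eventually (eventually_lt_inverseGap (half_pos hgap).le (half_lt_self hgap))
  have h5 : ∀ᶠ n : ℕ in (hyperfilter ℕ : Filter ℕ), 1 / ((n : ℝ) + 1) < inverseGap B' / 2 :=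
    (tendsto_one_div_add_atTop_nhds_zero_nat.eventually_lt_const (half_pos hgap)).filter_mono
      Nat.hyperfilter_le_atTop
  obtain ⟨n, hn1, hn2⟩ := (h4.and h5).exists
  linarith [hBδ n]

/-- Outside the closed set the sections have a gap above the level on a whole disc, uniformly in k.
The maximum principle turns this into a margin δ at the centre, which the averaging argument at
level ε + δ refutes. -/
theorem closedPseudospectrum_subset_tauClosedSet (hX : GlobevnikProperty X) (hA : IsTridiagonal A)
    {ε : ℝ} (hε : 0 ≤ ε) (h : 0 < ε ∨ ¬ IsDiagonalOperator A ∨ FiniteDimensional ℂ X) {n : ℕ}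
    (hn : 1 ≤ n) : closedPseudospectrum A ε ⊆ tauClosedSet A n (ε + tauPenalty A n) := by
  have : NeZero n := ⟨by omega⟩
  intro w hw
  rw [mem_closedPseudospectrum_iff hε] at hw
  by_contra hcon
  have hpen := tauPenalty_nonneg A hn
  have hε' : 0 ≤ ε + tauPenalty A n := by positivity
  obtain ⟨r, hr, hball⟩ := Metric.isOpen_iff.1 (isClosed_closure (s := ⋃ k : ℤ,
    closedPseudospectrum (finiteSection A n k) (ε + tauPenalty A n))).isOpen_compl w hcon
  have hz : ∀ k z, ‖z - w‖ < r → ε + tauPenalty A n <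
      inverseGap (finiteSection A n k - z • ContinuousLinearMap.id ℂ _) := by
    intro k z hzr
    by_contra! hle
    have hzb : z ∈ Metric.ball w r := by rwa [Metric.mem_ball, dist_eq_norm]
    refine hball hzb (subset_closure ?_)
    exact Set.mem_iUnion.2 ⟨k, (mem_closedPseudospectrum_iff hε').2 hle⟩
  have key : ∃ δ > 0, ∀ k, ε + tauPenalty A n + δ ≤
      inverseGap (finiteSection A n k - w • ContinuousLinearMap.id ℂ _) := by
    -- At level zero the maximum principle is not available. This forces ε = 0 and zero penalty, so
    -- A is diagonal, and the proviso leaves finite-dimensional X, where determinants do the job.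
    rcases hε'.eq_or_lt with h0 | h0
    · have h1 : ε = 0 := by linarith
      have h2 : tauPenalty A n = 0 := by linarith
      have hfd : FiniteDimensional ℂ X := by
        rcases h with h | h | h
        · exact absurd h1 h.ne'
        · exact absurd h2 (tauPenalty_pos hA h hn).ne'
        · exact h
      obtain ⟨δ, hδ, hB⟩ := exists_le_inverseGap_of_finiteDimensional
        (Y := PiLp 2 (fun _ : Fin n => X)) ‖A - w • ContinuousLinearMap.id ℂ (BiSeq X)‖ hr
      refine ⟨δ, hδ, fun k => ?_⟩
      rw [← h0, zero_add, finiteSection_sub_smul_eq]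
      refine hB _ (norm_finiteSection_le _ _ _) fun z hzr => ?_
      have h3 := hz k (z + w) (by rwa [add_sub_cancel_right])
      rw [finiteSection_sub_add_smul] at h3
      exact isUnit_of_inverseGap_pos (hε'.trans_lt h3)
    · exact exists_le_inverseGap_finiteSection hX hA hn hr h0 fun k z hzr => (hz k z hzr).le
  obtain ⟨δ, hδ, hk⟩ := key
  obtain ⟨k, hlt⟩ := exists_inverseGap_finiteSection_lt hA hn
    (show inverseGap (A - w • ContinuousLinearMap.id ℂ _) < ε + δ by linarith)
  linarith [hk k]

/-- The maximum principle excludes that the gap equals ε at a point and is at least ε on a disc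
around it. -/
theorem closedPseudospectrum_subset_closure (hX : GlobevnikProperty X) (hA : IsTridiagonal A)
    {ε : ℝ} (hε : 0 < ε) : closedPseudospectrum A ε ⊆ closure (openPseudospectrum A ε) := by
  intro w hw
  rw [mem_closedPseudospectrum_iff hε.le] at hw
  by_contra hcon
  obtain ⟨r, hr, hball⟩ := Metric.isOpen_iff.1
    (isClosed_closure (s := openPseudospectrum A ε)).isOpen_compl w hcon
  obtain ⟨δ, hδ, hB⟩ := hX.uniformMaximumPrinciple
    ‖A - w • ContinuousLinearMap.id ℂ (BiSeq X)‖ r ε hr hε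
  have := hB _ (hA.sub_smul w) le_rfl fun z hz => by
    rw [← sub_add_smul_id]
    by_contra! hlt
    have hzb : z + w ∈ Metric.ball w r := by
      rwa [Metric.mem_ball, dist_eq_norm, add_sub_cancel_right]
    exact hball hzb (subset_closure ((mem_openPseudospectrum_iff hε).2 hlt))
  linarith

theorem hausdorffTendsto_of_eventually_subset_cthickening {S : ℕ → Set ℂ} {T : Set ℂ}
    (hT : T.Nonempty) (hTb : Bornology.IsBounded T)
    (hS : ∀ n, 1 ≤ n → Bornology.IsBounded (S n)) (hTS : ∀ n, 1 ≤ n → T ⊆ closure (S n))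
    (hST : ∀ ρ > 0, ∀ᶠ n in atTop, S n ⊆ Metric.cthickening ρ T) : HausdorffTendsto S T := by
  have hne : ∀ n, 1 ≤ n → (S n).Nonempty := fun n hn =>
    closure_nonempty_iff.1 (hT.mono (hTS n hn))
  refine ⟨fun n hn => ⟨hne n hn, hS n hn⟩, hT, hTb, ?_⟩
  rw [Metric.tendsto_atTop']
  intro ρ hρ
  obtain ⟨N, hN⟩ := eventually_atTop.1 (hST (ρ / 2) (half_pos hρ))
  refine ⟨max N 1, fun n hn => ?_⟩
  have hn1 : 1 ≤ n := (le_max_right N 1).trans hn.le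
  rw [Real.dist_0_eq_abs, abs_of_nonneg Metric.hausdorffDist_nonneg]
  refine lt_of_le_of_lt (Metric.hausdorffDist_le_of_infDist (half_pos hρ).le (fun x hx => ?_)
    fun x hx => ?_) (half_lt_self hρ)
  · have h1 := Metric.mem_cthickening_iff.1 (hN n ((le_max_left N 1).trans hn.le) hx)
    exact ENNReal.toReal_le_of_le_ofReal (half_pos hρ).le h1
  · rw [(Metric.mem_closure_iff_infDist_zero (hne n hn1)).1 (hTS n hn1 hx)]
    exact (half_pos hρ).le

theorem closedPseudospectrum_nonempty (A : BiSeq X →L[ℂ] BiSeq X) {ε : ℝ} (hε : 0 ≤ ε) :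
    (closedPseudospectrum A ε).Nonempty := by
  refine Set.Nonempty.mono (closedPseudospectrum_mono hε) ?_
  rw [closedPseudospectrum_zero]
  exact spectrum.nonempty A

theorem isBounded_openPseudospectrum (A : BiSeq X →L[ℂ] BiSeq X) {ε : ℝ} (hε : 0 < ε) :
    Bornology.IsBounded (openPseudospectrum A ε) :=
  isBounded_iff_forall_norm_le.2 ⟨‖A‖ + ε, fun _ hz => norm_le_of_mem_openPseudospectrum hε hz⟩

theorem isBounded_closedPseudospectrum (A : BiSeq X →L[ℂ] BiSeq X) {ε : ℝ} (hε : 0 ≤ ε) :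
    Bornology.IsBounded (closedPseudospectrum A ε) :=
  (isBounded_openPseudospectrum A (by positivity : 0 < ε + 1)).subset
    (closedPseudospectrum_subset_open hε (by linarith))

theorem hausdorffTendsto_tauClosedSet (hX : GlobevnikProperty X) (hA : IsTridiagonal A)
    (hpol : TauNoSpectralPollution A) {ε : ℝ} (hε : 0 ≤ ε)
    (h : 0 < ε ∨ ¬ IsDiagonalOperator A ∨ FiniteDimensional ℂ X) :
    HausdorffTendsto (fun n => tauClosedSet A n (ε + tauPenalty A n))
      (closedPseudospectrum A ε) := by
  obtain ⟨η, hη0, hη, hsub⟩ := hpol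
  have hpen : ∀ n, 1 ≤ n → 0 ≤ tauPenalty A n := fun n hn => tauPenalty_nonneg A hn
  -- Pollution is controlled for open pseudospectra only; the extra τ passes from the closed to the
  -- open ones.
  have hincl : ∀ τ > 0, ∀ n, 1 ≤ n → tauClosedSet A n (ε + tauPenalty A n) ⊆
      closure (openPseudospectrum A (ε + tauPenalty A n + τ + η n)) := fun τ hτ n hn =>
    tauClosedSet_subset_closure (by linarith [hpen n hn]) (by linarith)
      fun k => hsub _ (by linarith [hpen n hn]) n hn k
  refine hausdorffTendsto_of_eventually_subset_cthickening (closedPseudospectrum_nonempty A hε)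
    (isBounded_closedPseudospectrum A hε) (fun n hn => ?_) (fun n hn => ?_) fun ρ hρ => ?_
  · refine (Bornology.IsBounded.closure ?_).subset (hincl 1 one_pos n hn)
    exact isBounded_openPseudospectrum A (by linarith [hpen n hn, hη0 n])
  · exact (closedPseudospectrum_subset_tauClosedSet hX hA hε h hn).trans subset_closure
  · obtain ⟨τ, hτ, hτs⟩ := exists_openPseudospectrum_subset_thickening A hε hρ
    have hlim : Tendsto (fun n => tauPenalty A n + τ / 2 + η n) atTop (𝓝 (0 + τ / 2 + 0)) :=
      ((tendsto_tauPenalty A).add tendsto_const_nhds).add hη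
    filter_upwards [hlim.eventually_lt_const (show 0 + τ / 2 + 0 < τ by linarith),
      eventually_ge_atTop 1] with n hn hn1
    refine (hincl (τ / 2) (half_pos hτ) n hn1).trans ?_
    refine (closure_mono ((openPseudospectrum_mono (by linarith)).trans hτs)).trans ?_
    exact Metric.closure_thickening_subset_cthickening ρ _

theorem hausdorffTendsto_tauOpenSet (hX : GlobevnikProperty X) (hA : IsTridiagonal A)
    (hpol : TauNoSpectralPollution A) {ε : ℝ} (hε : 0 < ε) :
    HausdorffTendsto (fun n => tauOpenSet A n (ε + tauPenalty A n)) (openPseudospectrum A ε) := by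
  obtain ⟨η, hη0, hη, hsub⟩ := hpol
  have hpen : ∀ n, 1 ≤ n → 0 ≤ tauPenalty A n := fun n hn => tauPenalty_nonneg A hn
  have hincl : ∀ n, 1 ≤ n → tauOpenSet A n (ε + tauPenalty A n) ⊆
      openPseudospectrum A (ε + tauPenalty A n + η n) := fun n hn =>
    Set.iUnion_subset fun k => hsub _ (by linarith [hpen n hn]) n hn k
  refine hausdorffTendsto_of_eventually_subset_cthickening
    ((closedPseudospectrum_nonempty A le_rfl).mono (closedPseudospectrum_subset_open le_rfl hε))
    (isBounded_openPseudospectrum A hε) (fun n hn => ?_) (fun n hn => ?_) fun ρ hρ => ?_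
  · exact (isBounded_openPseudospectrum A (by linarith [hpen n hn, hη0 n])).subset (hincl n hn)
  · exact (openPseudospectrum_subset_tauOpenSet hA hn hε).trans subset_closure
  · obtain ⟨τ, hτ, hτs⟩ := exists_openPseudospectrum_subset_thickening A hε.le hρ
    have hlim : Tendsto (fun n => tauPenalty A n + η n) atTop (𝓝 (0 + 0)) :=
      (tendsto_tauPenalty A).add hη
    filter_upwards [hlim.eventually_lt_const (show (0 : ℝ) + 0 < τ by linarith),
      eventually_ge_atTop 1] with n hn hn1
    refine (hincl n hn1).trans ?_
    refine ((openPseudospectrum_mono (by linarith)).trans hτs).trans ?_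
    -- Semicontinuity leads to a neighbourhood of the closed pseudospectrum; density of the open one
    -- brings it back.
    refine (Metric.thickening_subset_of_subset ρ
      (closedPseudospectrum_subset_closure hX hA hε)).trans ?_
    rw [Metric.thickening_closure]
    exact Metric.thickening_subset_cthickening ρ _

end SpectralInclusion

theorem theorem1p3 {X : Type*} [NormedAddCommGroup X] [NormedSpace ℂ X] [CompleteSpace X]
    [Nontrivial X] (hX : GlobevnikProperty X)
    (A : BiSeq X →L[ℂ] BiSeq X) (hA : IsTridiagonal A) (hpol : TauNoSpectralPollution A) :
    (∀ ε : ℝ, 0 ≤ ε → (0 < ε ∨ ¬ IsDiagonalOperator A ∨ FiniteDimensional ℂ X) →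
      HausdorffTendsto (fun n => tauClosedSet A n (ε + tauPenalty A n))
        (closedPseudospectrum A ε)) ∧
    ((¬ IsDiagonalOperator A ∨ FiniteDimensional ℂ X) →
      HausdorffTendsto (fun n => tauClosedSet A n (tauPenalty A n)) (spectrum ℂ A)) ∧
    (∀ ε : ℝ, 0 < ε →
      HausdorffTendsto (fun n => tauOpenSet A n (ε + tauPenalty A n))
        (openPseudospectrum A ε)) := by
  refine ⟨fun ε hε h => hausdorffTendsto_tauClosedSet hX hA hpol hε h, fun h => ?_,
    fun ε hε => hausdorffTendsto_tauOpenSet hX hA hpol hε⟩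
  have h0 := hausdorffTendsto_tauClosedSet hX hA hpol le_rfl (Or.inr h)
  simp only [zero_add, closedPseudospectrum_zero] at h0
  exact h0
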